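/- **Conventions.** All classes $M$ and maps $j$ below are classes over the universe $V$ of sets. $j:V\to M$ always denotes an elementary embedding of $(V,\in)$ into $(M,\in)$ with $M$ a transitive class, and $\operatorname{crit}(j)$ is the least ordinal moved by $j$. For a cardinal $\lambda$, $H_\lambda$ is the class of sets $x$ such that $x$ and all members of its transitive closure have cardinality less than $\lambda$. For an ordinal $\alpha$, a cardinal $\lambda$ and a set $X$, we say that $\alpha$ is *$(\lambda\text{-}X)$-strong* if there is $j:V\to M$ with $\operatorname{crit}(j)=\alpha$, $j(\alpha)\ge\lambda$ and $j(X)\cap H_\lambda=X\cap H_\lambda$. A cardinal $\delta$ is a *Woodin cardinal* if it is strongly inaccessible and for every $X\subseteq H_\delta$ there is a cardinal $\mu<\delta$ which is $(\lambda\text{-}X)$-strong for every cardinal $\lambda<\delta$. A set $X\subseteq\kappa$ is *Woodin in $\kappa$* if for every $f:\kappa\to\kappa$ there are $\alpha\in X$ with $f''\alpha\subseteq\alpha$ and $j:V\to M$ with $\operatorname{crit}(j)=\alpha$ and $V_{j(f)(\alpha)}\subseteq M$. Given $j:V\to M$ and ordinals with $\operatorname{crit}(j)=\mu\le\lambda\le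 j(\mu)$, the *extender* derived from them is the family $\mathbb E=(E_A: A\in[\lambda]^{<\omega})$, where $E_A=\{X\subseteq[\mu]^{<\omega}: A\in j(X)\}$. $\mathrm{Ult}_{\mathbb E}$ consists of the classes $[A,f]_{\mathbb E}$ of pairs with $A\in[\lambda]^{<\omega}$ and $f:[\mu]^{|A|}\to V$. Here $(A,f)$ and $(B,g)$ are identified iff $\{t\in[\mu]^{|A\cup B|}: f(\pi_{A\cup B,A}(t))=g(\pi_{A\cup B,B}(t))\}\in E_{A\cup B}$, and membership is defined in the same way with $\in$ for $=$, where $\pi_{D,C}(t)$ consists of the elements of $t$ whose positions in the increasing enumeration of $t$ are the positions in $D$ of the elements of $C\subseteq D$. $\mathrm{Ult}_{\mathbb E}$ is identified with its transitive collapse, and $j_{\mathbb E}(Y)=[\emptyset,c_Y]_{\mathbb E}$, where $c_Y$ is the function constantly equal to $Y$. **Theorem 1.1.** Let $\kappa$ be a cardinal. The following are equivalent: 1. $\kappa$ is a Woodin cardinal. 2. For every $f:\kappa\to\kappa$ there are $\alpha<\kappa$ with $f''\alpha\subseteq\alpha$ and $j:V\to M$ with $\operatorname{crit}(j)=\alpha$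 and $V_{j(f)(\alpha)}\subseteq M$. 3. For every $A\subseteq V_\kappa$ the set $\{\alpha<\kappa : \alpha\text{ is }(\gamma\text{-}A)\text{-strong for all cardinals }\gamma<\kappa\}$ is stationary in $\kappa$, i.e. it meets every cofinal subset $C$ of $\kappa$ that contains the supremum of each of its nonempty subsets that has a supremum in $\kappa$ (closed unbounded sets, if $\kappa$ is infinite). 4. $F=\{X\subseteq\kappa : \kappa\setminus X\text{ is not Woodin in }\kappa\}$ is a proper filter over $\kappa$ (the *Woodin filter*). 5. For every $f:\kappa\to\kappa$ there are $\alpha<\kappa$ with $f''\alpha\subseteq\alpha$ and an extender $\mathbb E\in V_\kappa$ with $\operatorname{crit}(j_{\mathbb E})=\alpha$, $j_{\mathbb E}(f)(\alpha)=f(\alpha)$ and $V_{j_{\mathbb E}(f)(\alpha)}\subseteq\mathrm{Ult}_{\mathbb E}$. -/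

import Mathlib

/-! Throughout, the universe of sets `V` is `ZFSet.{u}`, classes are `Set ZFSet.{u}`, and an
ordinal or cardinal is identified with its von Neumann ordinal through `Ordinal.toZFSet`. -/

universe u

namespace WoodinCard

open FirstOrder Cardinal

/-- The only symbol of the language of set theory: a binary relation symbol. -/
inductive MemRel : ℕ → Type
  | mem : MemRel 2

/-- The first-order language of set theory. -/
def setLanguage : Language := ⟨fun _ => Empty, MemRel⟩

/-- The structure `(V, ∈)`. -/
instance structureV : setLanguage.Structure ZFSet.{u} where
  funMap := fun f _ => Empty.elim f
  RelMap := fun r v => match r, v with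
    | MemRel.mem, v => v 0 ∈ v 1

/-- The structure `(M, ∈)` for a class `M`. -/
instance structureClass (M : Set ZFSet.{u}) : setLanguage.Structure M where
  funMap := fun f _ => Empty.elim f
  RelMap := fun r v => match r, v with
    | MemRel.mem, v => (v 0 : ZFSet.{u}) ∈ (v 1 : ZFSet.{u})

/-- `M` is a transitive class. -/
def IsTransitiveClass (M : Set ZFSet.{u}) : Prop :=
  ∀ x ∈ M, ∀ y ∈ x, y ∈ M

/-- `M` is a transitive class and `j : V → M` is an elementary embedding. -/
def IsElementary (M : Set ZFSet.{u}) (j : ZFSet.{u} → ZFSet.{u}) : Prop :=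
  IsTransitiveClass M ∧ ∃ i : ZFSet.{u} ↪ₑ[setLanguage] M, ∀ x, (i x : ZFSet.{u}) = j x

/-- `crit(j) = α`: `α` is the least ordinal at which `j` is not the identity. -/
def IsCrit (j : ZFSet.{u} → ZFSet.{u}) (α : Ordinal.{u}) : Prop :=
  j α.toZFSet ≠ α.toZFSet ∧ ∀ β < α, j β.toZFSet = β.toZFSet

/-- `H_ν`, the class of the sets hereditarily of cardinality less than `ν`. -/
def H (ν : Cardinal.{u}) : Set ZFSet.{u} :=
  {x | x.Hereditarily fun y => y.card < ν}

/-- `α` is `(ν - X)`-strong. The critical point `α` of `j : V → M` is automatically a cardinal. -/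
def IsStrong (α : Ordinal.{u}) (ν : Cardinal.{u}) (X : ZFSet.{u}) : Prop :=
  ∃ (M : Set ZFSet.{u}) (j : ZFSet.{u} → ZFSet.{u}), IsElementary M j ∧ IsCrit j α ∧
    ν.ord.toZFSet ⊆ j α.toZFSet ∧
    (j X : Set ZFSet.{u}) ∩ H ν = (X : Set ZFSet.{u}) ∩ H ν

/-- `δ` is a Woodin cardinal. -/
def IsWoodin (δ : Cardinal.{u}) : Prop :=
  δ.IsInaccessible ∧ ∀ X : ZFSet.{u}, (X : Set ZFSet.{u}) ⊆ H δ →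
    ∃ μ < δ, ∀ ν < δ, IsStrong μ.ord ν X

/-- `f '' α ⊆ α`, for a set-theoretic function `f` on ordinals. -/
def IsClosurePoint (f : ZFSet.{u}) (α : Ordinal.{u}) : Prop :=
  ∀ β γ : Ordinal.{u}, β < α → ZFSet.pair β.toZFSet γ.toZFSet ∈ f → γ < α

/-- `f '' α ⊆ α`, and there is `j : V → M` with `crit(j) = α` and `V_{j(f)(α)} ⊆ M`
(below, `η = j(f)(α)`). -/
def IsEmbeddingPoint (f : ZFSet.{u}) (α : Ordinal.{u}) : Prop :=
  IsClosurePoint f α ∧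
    ∃ (M : Set ZFSet.{u}) (j : ZFSet.{u} → ZFSet.{u}), IsElementary M j ∧ IsCrit j α ∧
      ∃ η : Ordinal.{u}, ZFSet.pair α.toZFSet η.toZFSet ∈ j f ∧
        (ZFSet.vonNeumann η : Set ZFSet.{u}) ⊆ M

/-- The set `X ⊆ κ` is Woodin in `κ`. -/
def IsWoodinIn (κ : Cardinal.{u}) (X : Set (Set.Iio κ.ord)) : Prop :=
  ∀ f : ZFSet.{u}, ZFSet.IsFunc κ.ord.toZFSet κ.ord.toZFSet f →
    ∃ α ∈ X, IsEmbeddingPoint f α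

/-- `[o]^{<ω}`, the set of finite subsets of `o`. -/
noncomputable def finSubsets (o : Ordinal.{u}) : ZFSet.{u} :=
  ZFSet.sep (fun s => (s : Set ZFSet.{u}).Finite) o.toZFSet.powerset

/-- `[o]^{|A|}`, the set of finite subsets of `o` with as many elements as `A`. -/
noncomputable def finSubsetsLike (o : Ordinal.{u}) (A : ZFSet.{u}) : ZFSet.{u} :=
  ZFSet.sep (fun s => s.card = A.card) (finSubsets o)

/-- The measure `E_A = {X ⊆ [μ]^{<ω} : A ∈ j(X)}`. -/
noncomputable def derivedMeasure (j : ZFSet.{u} → ZFSet.{u}) (μ : Ordinal.{u})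
    (A : ZFSet.{u}) : ZFSet.{u} :=
  ZFSet.sep (fun X => A ∈ j X) (finSubsets μ).powerset

/-- The family `(E_A : A ∈ [lam]^{<ω})`, as a set: the set of the pairs `(A, E_A)`. -/
noncomputable def derivedExtender (j : ZFSet.{u} → ZFSet.{u}) (μ lam : Ordinal.{u}) : ZFSet.{u} :=
  ZFSet.sep (fun z => ∃ A, z = ZFSet.pair A (derivedMeasure j μ A))
    ((finSubsets lam).prod (finSubsets μ).powerset.powerset)

/-- `E` is an extender with critical point `μ` and support `lam`. -/
def IsExtender (E : ZFSet.{u}) (μ lam : Ordinal.{u}) : Prop :=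
  ∃ (M : Set ZFSet.{u}) (j : ZFSet.{u} → ZFSet.{u}), IsElementary M j ∧ IsCrit j μ ∧
    μ ≤ lam ∧ lam.toZFSet ⊆ j μ.toZFSet ∧ E = derivedExtender j μ lam

/-- `X ∈ E_A`. -/
def InMeasure (E A X : ZFSet.{u}) : Prop :=
  ∃ U, ZFSet.pair A U ∈ E ∧ X ∈ U

/-- For finite sets of ordinals `C ⊆ D` and `t` with `|t| = |D|`: the set of the elements of `t`
whose position in the increasing enumeration of `t` is the position in `D` of an element of `C`.
(For an ordinal `x`, the number of elements of `D` below `x` is the cardinality of `D ∩ x`.) -/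
noncomputable def proj (D C t : ZFSet.{u}) : ZFSet.{u} :=
  ZFSet.sep (fun y => ∃ x ∈ C, (D ∩ x).card = (t ∩ y).card) t

/-- The pairs `(A, f)` with `A ∈ [lam]^{<ω}` and `f : [μ]^{|A|} → V`. The second component is given
as a function on all of `V`, of which only the restriction to `[μ]^{|A|}` matters in `Ult`. -/
abbrev UltRep (lam : Ordinal.{u}) : Type (u + 1) :=
  {A : ZFSet.{u} // A ∈ finSubsets lam} × (ZFSet.{u} → ZFSet.{u})

/-- `(A, f)` and `(B, g)` are identified: `{t : f(π(t)) = g(π(t))} ∈ E_{A ∪ B}`. -/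
def UltEq (E : ZFSet.{u}) (μ : Ordinal.{u}) {lam : Ordinal.{u}} (a b : UltRep lam) : Prop :=
  let D := a.1.1 ∪ b.1.1
  InMeasure E D (ZFSet.sep (fun t => a.2 (proj D a.1.1 t) = b.2 (proj D b.1.1 t))
    (finSubsetsLike μ D))

/-- The membership relation on representatives: `{t : f(π(t)) ∈ g(π(t))} ∈ E_{A ∪ B}`. -/
def UltMem (E : ZFSet.{u}) (μ : Ordinal.{u}) {lam : Ordinal.{u}} (a b : UltRep lam) : Prop :=
  let D := a.1.1 ∪ b.1.1
  InMeasure E D (ZFSet.sep (fun t => a.2 (proj D a.1.1 t) ∈ b.2 (proj D b.1.1 t))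
    (finSubsetsLike μ D))

/-- The ultrapower `Ult_E`, before the transitive collapse. -/
def Ult (E : ZFSet.{u}) (μ lam : Ordinal.{u}) : Type (u + 1) :=
  Quot (UltEq E μ (lam := lam))

/-- The membership relation of `Ult_E`. -/
def Ult.Mem {E : ZFSet.{u}} {μ lam : Ordinal.{u}} (x y : Ult E μ lam) : Prop :=
  ∃ a b : UltRep lam, Quot.mk _ a = x ∧ Quot.mk _ b = y ∧ UltMem E μ a b

theorem empty_mem_finSubsets (o : Ordinal.{u}) : (∅ : ZFSet.{u}) ∈ finSubsets o := by
  simp [finSubsets]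

/-- The canonical map `Y ↦ [∅, c_Y]` of `V` into the ultrapower. -/
def Ult.const (E : ZFSet.{u}) (μ lam : Ordinal.{u}) (Y : ZFSet.{u}) : Ult E μ lam :=
  Quot.mk _ (⟨∅, empty_mem_finSubsets lam⟩, fun _ => Y)

/-- `π` is the Mostowski collapse of the ultrapower: an isomorphism of it with a transitive class
(the range of `π`). Such a `π` is unique; through it, the ultrapower is identified with the
transitive class. -/
structure IsCollapse {E : ZFSet.{u}} {μ lam : Ordinal.{u}} (π : Ult E μ lam → ZFSet.{u}) :
    Prop where
  injective : Function.Injective π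
  mem_iff : ∀ x y, π x ∈ π y ↔ Ult.Mem x y
  transitive : IsTransitiveClass (Set.range π)

/-- `f '' α ⊆ α`, and there is an extender `E ∈ V_κ` with `crit(j_E) = α`, `j_E(f)(α) = f(α)` and
`V_{j_E(f)(α)} ⊆ Ult_E` (below, `η = j_E(f)(α)`). -/
def IsExtenderPoint (κ : Cardinal.{u}) (f : ZFSet.{u}) (α : Ordinal.{u}) : Prop :=
  IsClosurePoint f α ∧
    ∃ (E : ZFSet.{u}) (μ lam : Ordinal.{u}), E ∈ ZFSet.vonNeumann κ.ord ∧ IsExtender E μ lam ∧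
      ∃ π : Ult E μ lam → ZFSet.{u}, IsCollapse π ∧
        IsCrit (fun Y => π (Ult.const E μ lam Y)) α ∧
        ∃ η : Ordinal.{u}, ZFSet.pair α.toZFSet η.toZFSet ∈ π (Ult.const E μ lam f) ∧
          ZFSet.pair α.toZFSet η.toZFSet ∈ f ∧
          (ZFSet.vonNeumann η : Set ZFSet.{u}) ⊆ Set.range π

end WoodinCard

namespace WoodinCard

open FirstOrder Cardinal

/-! Embeddings are arbitrary maps here, so every argument passes through formulas with set
parameters. `Expressible` says that one formula defines a relation in `V` and in all inner models;
`AbsFun` says that a function is computed alike in all of them. Instances assemble the formulas, and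
`IsElementary.transfer` and `IsElementary.map_absFun` then apply `j`.

The core is (2) → (1), `HasEmbeddingPoints.isWoodin`. If no cardinal below `κ` is strong for `X` up
to `κ`, let `G ξ` be a regular cardinal above a degree at which `ξ` fails, and take an embedding
point `α` of `G + 1`. Put `γ = j(G)(α)`. Closure of `α` gives `γ < j(α)`, so every `b ∈ V_γ` lies in
`j(V_α)` and generates the ultrafilter `{y ⊆ V_α : b ∈ j(y)}`. The family of these is coded by a
subset of `V_γ`, hence belongs to `M ⊇ V_{γ+1}`, and there it satisfies the first-order conditions
`StrongSystem` for `α` and `j(X)`. By elementarity `M` has no such system: in `V`, a system for `ξ`,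
`V_{G ξ}` and `X` yields by a limit ultrapower an embedding with exactly the strength that `ξ` lacks
(`StrongSystem.isStrong`).

For (1) → (5), `IsWoodin.hasExtenderPoints`, take `μ` strong for both `f` and an enumeration `Y` of
`V_κ` by ordinals, and derive an extender of length `λ` from an embedding agreeing with both on
`H_λ`. For large `λ < κ` the factor map into `M` has in its range all ordinals below `λ` and every
`x ∈ V_{f(μ)}`, since `x = j(Y)(ξ)` for some `ξ < λ`; so the collapse returns these sets unchanged.
(5) → (2) is the theorem of Łoś for the extender ultrapower.

(1) → (3) codes `A` and a club `C` in one predicate; a `μ` strong for it is a limit of `C`, hence in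
`C`. In (3) → (1), as in (2), inaccessibility must be proved: critical points are inaccessible, and
a short cofinal map into `κ` would reflect to one of them. In (2) ↔ (4), properness is (2) itself,
and intersections are handled by the pointwise maximum of two functions. -/

/-- A transitive class that is elementarily equivalent to the universe. -/
def IsInner (M : Set ZFSet.{u}) : Prop :=
  IsTransitiveClass M ∧ FirstOrder.Language.ElementarilyEquivalent setLanguage ZFSet.{u} M

/-- The identification of `V` with the class of all sets. -/
def univEquiv : ZFSet.{u} ≃[setLanguage] (Set.univ : Set ZFSet.{u}) where
  toEquiv := (Equiv.Set.univ _).symm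
  map_fun' f := Empty.elim f
  map_rel' r v := by cases r; exact Iff.rfl

theorem isInner_univ : IsInner (Set.univ : Set ZFSet.{u}) :=
  ⟨fun _ _ _ _ => trivial, univEquiv.toElementaryEmbedding.elementarilyEquivalent⟩

theorem IsElementary.isInner {M : Set ZFSet.{u}} {j : ZFSet.{u} → ZFSet.{u}}
    (h : IsElementary M j) : IsInner M :=
  ⟨h.1, h.2.choose.elementarilyEquivalent⟩

/-- `P M v`, a relation between a transitive model `M` and a sequence of its elements, is uniformly
expressed over all inner models by one first-order formula. -/
class Expressible (P : Set ZFSet.{u} → (ℕ → ZFSet.{u}) → Prop) : Prop where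
  exists_formula : ∃ φ : setLanguage.Formula ℕ, ∀ M, IsInner M → ∀ v : ℕ → M,
    φ.Realize v ↔ P M (fun n => v n)

/-- A function on sets whose graph is expressible; it is then absolute for inner models. -/
class AbsFun (f : (ℕ → ZFSet.{u}) → ZFSet.{u}) : Prop where
  graph : Expressible fun _ v => v 0 = f (fun n => v (n + 1))

/-! ### Formulas over inner models, and absolute functions. -/

section rules

variable {P Q : Set ZFSet.{u} → (ℕ → ZFSet.{u}) → Prop}

theorem Expressible.congr (hP : Expressible P)
    (h : ∀ M, IsInner M → ∀ v : ℕ → ZFSet.{u}, (∀ n, v n ∈ M) → (P M v ↔ Q M v)) :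
    Expressible Q := by
  obtain ⟨φ, hφ⟩ := hP.exists_formula
  exact ⟨φ, fun M hM v => (hφ M hM v).trans (h M hM _ fun n => (v n).2)⟩

theorem Expressible.congr' (hP : Expressible P) (h : ∀ M v, P M v ↔ Q M v) : Expressible Q :=
  hP.congr fun M _ v _ => h M v

theorem Expressible.reindex (hP : Expressible P) (ρ : ℕ → ℕ) :
    Expressible fun M v => P M (fun n => v (ρ n)) := by
  obtain ⟨φ, hφ⟩ := hP.exists_formula
  refine ⟨φ.relabel ρ, fun M hM v => ?_⟩
  rw [Language.Formula.realize_relabel, hφ M hM]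
  rfl

instance expressible_not [hP : Expressible P] : Expressible fun M v => ¬ P M v := by
  obtain ⟨φ, hφ⟩ := hP.exists_formula
  exact ⟨φ.not, fun M hM v => by rw [Language.Formula.realize_not, hφ M hM]⟩

instance expressible_imp [hP : Expressible P] [hQ : Expressible Q] :
    Expressible fun M v => P M v → Q M v := by
  obtain ⟨φ, hφ⟩ := hP.exists_formula
  obtain ⟨ψ, hψ⟩ := hQ.exists_formula
  exact ⟨φ.imp ψ, fun M hM v => by rw [Language.Formula.realize_imp, hφ M hM, hψ M hM]⟩

instance expressible_and [Expressible P] [Expressible Q] :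
    Expressible fun M v => P M v ∧ Q M v :=
  Expressible.congr' (P := fun M v => ¬ (P M v → ¬ Q M v)) (by infer_instance) fun M v => by tauto

instance expressible_or [Expressible P] [Expressible Q] :
    Expressible fun M v => P M v ∨ Q M v :=
  Expressible.congr' (P := fun M v => ¬ P M v → Q M v) (by infer_instance) fun M v => by tauto

instance expressible_iff [Expressible P] [Expressible Q] :
    Expressible fun M v => (P M v ↔ Q M v) :=
  Expressible.congr' (P := fun M v => (P M v → Q M v) ∧ (Q M v → P M v)) (by infer_instance)
    fun M v => by tauto

/-- The symbol for membership. -/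
def memSymbol : setLanguage.Relations 2 := MemRel.mem

theorem expressible_mem_var (m n : ℕ) : Expressible fun _ v => v m ∈ v n := by
  refine ⟨Language.Relations.formula₂ memSymbol
    (Language.Term.var m) (Language.Term.var n), fun M hM v => ?_⟩
  rw [Language.Formula.realize_rel₂]
  rfl

theorem expressible_eq_var (m n : ℕ) : Expressible fun _ v => v m = v n := by
  refine ⟨Language.Term.equal (L := setLanguage) (Language.Term.var m) (Language.Term.var n),
    fun M hM v => ?_⟩
  rw [Language.Formula.realize_equal]
  exact Subtype.ext_iff

instance expressible_ex {P : Set ZFSet.{u} → (ℕ → ZFSet.{u}) → ZFSet.{u} → Prop}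
    [hP : Expressible fun M v => P M (fun n => v (n + 1)) (v 0)] :
    Expressible fun M v => ∃ x ∈ M, P M v x := by
  obtain ⟨φ, hφ⟩ := hP.exists_formula
  -- Variable `0` becomes the quantified one and variable `n + 1` becomes the free variable `n`.
  refine ⟨(φ.relabel fun n : ℕ => (n.casesOn (Sum.inr ()) Sum.inl : ℕ ⊕ Unit)).iExs Unit,
    fun M hM v => ?_⟩
  rw [Language.Formula.realize_iExs]
  simp only [Language.Formula.realize_relabel, hφ M hM]
  exact ⟨fun ⟨i, hi⟩ => ⟨i (), (i ()).2, hi⟩, fun ⟨x, hx, h⟩ => ⟨fun _ => ⟨x, hx⟩, h⟩⟩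

instance expressible_all {P : Set ZFSet.{u} → (ℕ → ZFSet.{u}) → ZFSet.{u} → Prop}
    [Expressible fun M v => P M (fun n => v (n + 1)) (v 0)] :
    Expressible fun M v => ∀ x ∈ M, P M v x :=
  Expressible.congr' (P := fun M v => ¬ ∃ x ∈ M, ¬ P M v x) (by infer_instance)
    fun M v => by push Not; rfl

/-- A formula that holds everywhere in `V` holds everywhere in an inner model. -/
theorem IsInner.valid {M : Set ZFSet.{u}} (hM : IsInner M) [hP : Expressible P]
    (h : ∀ v, P Set.univ v) {v : ℕ → ZFSet.{u}} (hv : ∀ n, v n ∈ M) : P M v := by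
  classical
  obtain ⟨φ, hφ⟩ := (by infer_instance : Expressible fun M v => ¬ P M v).exists_formula
  by_contra hc
  -- Failure of `P` at some assignment is a single sentence, the existential closure of the
  -- negation, so elementary equivalence applies to it.
  have key : ∀ N : Set ZFSet.{u}, IsInner N →
      ((N ⊨ φ.exClosure) ↔ ∃ v : ℕ → N, ¬ P N (fun n => v n)) := by
    intro N hN
    -- Extending an assignment of the finitely many free variables to all of `ℕ` needs an element of
    -- `N`; the sentence asserting one element supplies it.
    have hne : Nonempty N := by
      have := (hN.2.symm.trans isInner_univ.2)
      by_contra hemp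
      rw [not_nonempty_iff] at hemp
      have h2 : (N ⊨ (Language.Sentence.cardGe setLanguage 1)) ↔
          ((Set.univ : Set ZFSet.{u}) ⊨ (Language.Sentence.cardGe setLanguage 1)) :=
        Language.elementarilyEquivalent_iff.1 this _
      rw [Language.Sentence.realize_cardGe, Language.Sentence.realize_cardGe] at h2
      simp only [Nat.cast_one, Cardinal.one_le_iff_ne_zero, Cardinal.mk_ne_zero_iff] at h2
      exact (not_nonempty_iff.2 hemp) (h2.2 ⟨⟨∅, trivial⟩⟩)
    rw [Language.Formula.realize_exClosure]
    constructor
    · rintro ⟨v, hv⟩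
      let w : ℕ → N := fun n => if h : n ∈ φ.freeVarFinset then v ⟨n, h⟩ else Classical.arbitrary N
      refine ⟨w, (hφ N hN w).1 ?_⟩
      rwa [Language.Formula.Realize, Language.BoundedFormula.realize_restrictFreeVar w] at hv
      intro a
      simp [w]
    · rintro ⟨v, hv⟩
      refine ⟨fun a => v a, ?_⟩
      rw [Language.Formula.Realize, Language.BoundedFormula.realize_restrictFreeVar v]
      · exact (hφ N hN v).2 hv
      · intro a; rfl
  have h1 := (key M hM).2 ⟨fun n => ⟨v n, hv n⟩, hc⟩
  have h2 := (Language.elementarilyEquivalent_iff.1 (hM.2.symm.trans isInner_univ.2) _).1 h1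
  obtain ⟨w, hw⟩ := (key _ isInner_univ).1 h2
  exact hw (h _)

/-- Existence of a value is expressible and valid in `V`, hence valid in `M`, and the graph means
the same there. -/
theorem AbsFun.mem_inner {f : (ℕ → ZFSet.{u}) → ZFSet.{u}} (hf : AbsFun f) {M : Set ZFSet.{u}}
    (hM : IsInner M) {v : ℕ → ZFSet.{u}} (hv : ∀ n, v n ∈ M) : f v ∈ M := by
  have := hf.graph
  obtain ⟨x, hx, rfl⟩ := hM.valid (P := fun M v => ∃ x ∈ M, x = f v) (by simp) hv
  exact hx

instance absFun_var (k : ℕ) : AbsFun fun v : ℕ → ZFSet.{u} => v k :=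
  ⟨expressible_eq_var 0 (k + 1)⟩

/-- The value of an absolute function stays in `M`, so substituting it amounts to a quantifier over
`M`. -/
theorem Expressible.subst {P : Set ZFSet.{u} → (ℕ → ZFSet.{u}) → ZFSet.{u} → Prop}
    {f : (ℕ → ZFSet.{u}) → ZFSet.{u}} (hf : AbsFun f)
    (_ : Expressible fun M v => P M (fun n => v (n + 1)) (v 0)) :
    Expressible fun M v => P M v (f v) := by
  have := hf.graph
  refine Expressible.congr (P := fun M v => ∃ x ∈ M, x = f v ∧ P M v x) (by infer_instance) ?_
  intro M hM v hv
  exact ⟨fun ⟨x, _, h, h'⟩ => h ▸ h', fun h => ⟨_, hf.mem_inner hM hv, rfl, h⟩⟩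

theorem AbsFun.reindex {f : (ℕ → ZFSet.{u}) → ZFSet.{u}} (hf : AbsFun f) (ρ : ℕ → ℕ) :
    AbsFun fun v => f (fun n => v (ρ n)) :=
  ⟨hf.graph.reindex fun n => n.casesOn 0 fun n => ρ n + 1⟩

variable {f g h : (ℕ → ZFSet.{u}) → ZFSet.{u}}

instance expressible_mem [hf : AbsFun f] [hg : AbsFun g] : Expressible fun _ v => f v ∈ g v :=
  Expressible.subst (P := fun _ v x => x ∈ g v) hf <|
    Expressible.subst (P := fun _ v x => v 0 ∈ x) (hg.reindex _) (expressible_mem_var 1 0)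

instance expressible_eq [hf : AbsFun f] [hg : AbsFun g] : Expressible fun _ v => f v = g v :=
  Expressible.subst (P := fun _ v x => x = g v) hf hg.graph

/-- By transitivity of `M` the members of `f v` are all in `M`, so a bounded quantifier is not
weakened by relativization. -/
instance expressible_bex {P : Set ZFSet.{u} → (ℕ → ZFSet.{u}) → ZFSet.{u} → Prop}
    [hf : AbsFun f] [Expressible fun M v => P M (fun n => v (n + 1)) (v 0)] :
    Expressible fun M v => ∃ x ∈ f v, P M v x := by
  have := hf.reindex Nat.succ
  refine Expressible.congr (P := fun M v => ∃ x ∈ M, x ∈ f v ∧ P M v x) (by infer_instance) ?_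
  intro M hM v hv
  exact ⟨fun ⟨x, _, h⟩ => ⟨x, h⟩,
    fun ⟨x, h, h'⟩ => ⟨x, hM.1 _ (hf.mem_inner hM hv) _ h, h, h'⟩⟩

instance expressible_ball {P : Set ZFSet.{u} → (ℕ → ZFSet.{u}) → ZFSet.{u} → Prop}
    [hf : AbsFun f] [Expressible fun M v => P M (fun n => v (n + 1)) (v 0)] :
    Expressible fun M v => ∀ x ∈ f v, P M v x :=
  Expressible.congr' (P := fun M v => ¬ ∃ x ∈ f v, ¬ P M v x) (by infer_instance)
    fun M v => by push Not; rfl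

instance absFun_reindex [hf : AbsFun f] (ρ : ℕ → ℕ) : AbsFun fun v => f (fun n => v (ρ n)) :=
  hf.reindex ρ

instance expressible_subset [hf : AbsFun f] [hg : AbsFun g] :
    Expressible fun _ v => f v ⊆ g v :=
  Expressible.congr' (P := fun _ v => ∀ x ∈ f v, x ∈ g v) (by infer_instance)
    fun M v => by rfl

/-- A function is absolute when its value is characterized by an expressible relation that
has a solution in `V`. -/
theorem AbsFun.of_total {R : Set ZFSet.{u} → (ℕ → ZFSet.{u}) → ZFSet.{u} → Prop}
    (hR : Expressible fun M v => R M (fun n => v (n + 1)) (v 0))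
    (h1 : ∀ v, R Set.univ v (f v))
    (h2 : ∀ M, IsInner M → ∀ v, (∀ n, v n ∈ M) → ∀ x ∈ M, R M v x → x = f v) : AbsFun f := by
  refine ⟨hR.congr fun M hM v hv => ?_⟩
  refine ⟨h2 M hM _ (fun n => hv _) _ (hv 0), fun h => ?_⟩
  obtain ⟨x, hx, hx'⟩ := hM.valid (P := fun M v => ∃ x ∈ M, R M v x)
    (fun v => ⟨_, trivial, h1 v⟩) (fun n => hv (n + 1))
  rw [h, ← h2 M hM _ (fun n => hv _) x hx hx']
  exact hx'

/-- A function is absolute when membership in its value is expressible. -/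
theorem AbsFun.of_ext (h : Expressible fun _ v => v 0 ∈ f (fun n => v (n + 1)))
    (hb : ∀ M, IsInner M → ∀ v, (∀ n, v n ∈ M) → ∀ x ∈ f v, x ∈ M) : AbsFun f := by
  -- Variable `1` is kept free for the candidate value `y`; the arguments of `f` start at variable
  -- `2`.
  have := h.reindex fun n => n.casesOn 0 fun n => n + 2
  refine AbsFun.of_total (R := fun M v y => ∀ x ∈ M, (x ∈ y ↔ x ∈ f v)) ?_ (by simp) ?_
  · exact expressible_all (P := fun M v x => (x ∈ v 0 ↔ x ∈ f (fun n => v (n + 1))))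
  · intro M hM v hv y hy h
    ext x
    exact ⟨fun hx => (h x (hM.1 _ hy _ hx)).1 hx, fun hx => (h x (hb M hM v hv x hx)).2 hx⟩

instance absFun_empty : AbsFun fun _ => (∅ : ZFSet.{u}) :=
  AbsFun.of_ext (Expressible.congr' (P := fun _ v => ¬ v 0 = v 0) (by infer_instance) (by simp)) (by simp)

instance absFun_pair [hf : AbsFun f] [hg : AbsFun g] : AbsFun fun v => ({f v, g v} : ZFSet.{u}) :=
  AbsFun.of_ext (Expressible.congr' (P := fun _ v => v 0 = f (fun n => v (n + 1)) ∨
    v 0 = g (fun n => v (n + 1))) (by infer_instance) (by simp)) (by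
      intro M hM v hv x hx
      rcases ZFSet.mem_pair.1 hx with rfl | rfl
      exacts [hf.mem_inner hM hv, hg.mem_inner hM hv])

instance absFun_singleton [hf : AbsFun f] : AbsFun fun v => ({f v} : ZFSet.{u}) := by
  simpa only [ZFSet.pair_eq_singleton] using
    (by infer_instance : AbsFun fun v => ({f v, f v} : ZFSet.{u}))

instance absFun_opair [AbsFun f] [AbsFun g] : AbsFun fun v => ZFSet.pair (f v) (g v) :=
  (by infer_instance : AbsFun fun v => ({{f v}, {f v, g v}} : ZFSet.{u}))

instance absFun_sep {P : (ℕ → ZFSet.{u}) → ZFSet.{u} → Prop} [hf : AbsFun f]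
    [Expressible fun _ v => P (fun n => v (n + 1)) (v 0)] :
    AbsFun fun v => ZFSet.sep (P v) (f v) :=
  AbsFun.of_ext (Expressible.congr' (P := fun _ v => v 0 ∈ f (fun n => v (n + 1)) ∧
    P (fun n => v (n + 1)) (v 0)) (by infer_instance) (by simp)) (by
      intro M hM v hv x hx
      exact hM.1 _ (hf.mem_inner hM hv) _ (ZFSet.mem_sep.1 hx).1)

instance absFun_inter [AbsFun f] [AbsFun g] : AbsFun fun v => f v ∩ g v :=
  (by infer_instance : AbsFun fun v => ZFSet.sep (fun x => x ∈ g v) (f v))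

instance absFun_sdiff [AbsFun f] [AbsFun g] : AbsFun fun v => f v \ g v :=
  (by infer_instance : AbsFun fun v => ZFSet.sep (fun x => x ∉ g v) (f v))


instance absFun_sUnion [hf : AbsFun f] : AbsFun fun v => ZFSet.sUnion (f v) :=
  AbsFun.of_ext (Expressible.congr' (P := fun _ v => ∃ y ∈ f (fun n => v (n + 1)), v 0 ∈ y)
    (by infer_instance) (by simp)) (by
      intro M hM v hv x hx
      obtain ⟨z, hz, hx⟩ := ZFSet.mem_sUnion.1 hx
      exact hM.1 _ (hM.1 _ (hf.mem_inner hM hv) _ hz) _ hx)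

instance absFun_union [AbsFun f] [AbsFun g] : AbsFun fun v => f v ∪ g v :=
  (by infer_instance : AbsFun fun v => ZFSet.sUnion {f v, g v})

instance absFun_insert [AbsFun f] [AbsFun g] : AbsFun fun v => insert (f v) (g v) := by
  simpa only [ZFSet.insert_eq] using (by infer_instance : AbsFun fun v => ({f v} ∪ g v : ZFSet.{u}))

end rules

/-! ### Elementarity for expressible relations and absolute functions. -/

section transfer

variable {M : Set ZFSet.{u}} {j : ZFSet.{u} → ZFSet.{u}}

theorem IsElementary.mem_class (hj : IsElementary M j) (x : ZFSet.{u}) : j x ∈ M := by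
  obtain ⟨i, hi⟩ := hj.2
  exact hi x ▸ (i x).2

/-- The elementarity of `j`, for expressible relations. -/
theorem IsElementary.transfer (hj : IsElementary M j)
    (P : Set ZFSet.{u} → (ℕ → ZFSet.{u}) → Prop) [hP : Expressible P] (v : ℕ → ZFSet.{u}) :
    P Set.univ v ↔ P M (fun n => j (v n)) := by
  obtain ⟨φ, hφ⟩ := hP.exists_formula
  obtain ⟨i, hi⟩ := hj.2
  have h1 := hφ _ isInner_univ (fun n => ⟨v n, trivial⟩)
  have h2 := hφ _ hj.isInner (fun n => i (v n))
  have h3 := i.map_formula φ v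
  have h4 := univEquiv.toElementaryEmbedding.map_formula φ v
  rw [show (fun n => j (v n)) = fun n => (i (v n) : ZFSet.{u}) from funext fun n => (hi _).symm,
    ← h2, ← h1]
  exact h4.trans h3.symm

theorem IsElementary.map_absFun (hj : IsElementary M j) (f : (ℕ → ZFSet.{u}) → ZFSet.{u})
    [hf : AbsFun f] (v : ℕ → ZFSet.{u}) : j (f v) = f (fun n => j (v n)) := by
  have := hf.graph
  exact (hj.transfer (fun _ v => v 0 = f (fun n => v (n + 1)))
    (fun n => n.casesOn (f v) v)).1 rfl

end transfer

/-! ### Functions as sets; absoluteness of `ω` and of rank. -/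

/-- Prepending to a sequence. -/
def scons (x : ZFSet.{u}) (v : ℕ → ZFSet.{u}) : ℕ → ZFSet.{u} := fun n => n.casesOn x v

infixr:67 " ::ₛ " => scons

/-- The restriction of a function on sets to a set, as a set of pairs. -/
noncomputable def graphOn (F : ZFSet.{u} → ZFSet.{u}) (X : ZFSet.{u}) : ZFSet.{u} :=
  ZFSet.range fun x : X => ZFSet.pair x (F x)

theorem mem_graphOn {F : ZFSet.{u} → ZFSet.{u}} {X z : ZFSet.{u}} :
    z ∈ graphOn F X ↔ ∃ x ∈ X, z = ZFSet.pair x (F x) := by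
  simp [graphOn, eq_comm]

@[simp] theorem pair_mem_graphOn {F : ZFSet.{u} → ZFSet.{u}} {X a b : ZFSet.{u}} :
    ZFSet.pair a b ∈ graphOn F X ↔ a ∈ X ∧ b = F a := by
  rw [mem_graphOn]
  constructor
  · rintro ⟨x, hx, h⟩
    obtain ⟨rfl, rfl⟩ := ZFSet.pair_injective h
    exact ⟨hx, rfl⟩
  · rintro ⟨ha, rfl⟩
    exact ⟨a, ha, rfl⟩

/-- The field of a relation. -/
noncomputable def field (F : ZFSet.{u}) : ZFSet.{u} := ZFSet.sUnion (ZFSet.sUnion F)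

theorem left_mem_field {F a b : ZFSet.{u}} (h : ZFSet.pair a b ∈ F) : a ∈ field F := by
  refine ZFSet.mem_sUnion_of_mem (z := {a}) (by simp) (ZFSet.mem_sUnion_of_mem ?_ h)
  simp [ZFSet.pair]

theorem right_mem_field {F a b : ZFSet.{u}} (h : ZFSet.pair a b ∈ F) : b ∈ field F := by
  refine ZFSet.mem_sUnion_of_mem (z := {a, b}) (by simp) (ZFSet.mem_sUnion_of_mem ?_ h)
  simp [ZFSet.pair]

/-- The value of a set-theoretic function. -/
noncomputable def app (F x : ZFSet.{u}) : ZFSet.{u} :=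
  ZFSet.sUnion (ZFSet.sep (fun y => ZFSet.pair x y ∈ F) (field F))

theorem app_eq {F x y : ZFSet.{u}} (h : ZFSet.pair x y ∈ F)
    (hu : ∀ z, ZFSet.pair x z ∈ F → z = y) : app F x = y := by
  ext w
  simp only [app, ZFSet.mem_sUnion, ZFSet.mem_sep]
  constructor
  · rintro ⟨z, ⟨_, hz⟩, hw⟩
    exact hu z hz ▸ hw
  · exact fun hw => ⟨y, ⟨right_mem_field h, h⟩, hw⟩

theorem app_graphOn {F : ZFSet.{u} → ZFSet.{u}} {X x : ZFSet.{u}} (hx : x ∈ X) :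
    app (graphOn F X) x = F x :=
  app_eq (by simp [hx]) (by simp)

section

variable {f g h : (ℕ → ZFSet.{u}) → ZFSet.{u}}

instance absFun_field [AbsFun f] : AbsFun fun v => field (f v) := by
  unfold field; infer_instance

instance absFun_app [AbsFun f] [AbsFun g] : AbsFun fun v => app (f v) (g v) := by
  unfold app; infer_instance

instance expressible_isTransitive [AbsFun f] : Expressible fun _ v => (f v).IsTransitive :=
  (by infer_instance : Expressible fun _ v => ∀ x ∈ f v, x ⊆ f v)

instance expressible_isOrdinal [AbsFun f] : Expressible fun _ v => (f v).IsOrdinal := by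
  simp only [ZFSet.isOrdinal_iff_forall_mem_isTransitive]
  infer_instance

end

theorem toZFSet_omega_mem_iff {x : ZFSet.{u}} :
    x ∈ Ordinal.omega0.toZFSet ↔ ∃ n : ℕ, x = (n : Ordinal.{u}).toZFSet := by
  rw [Ordinal.mem_toZFSet_iff]
  constructor
  · rintro ⟨a, ha, rfl⟩
    obtain ⟨n, rfl⟩ := Ordinal.lt_omega0.1 ha
    exact ⟨n, rfl⟩
  · rintro ⟨n, rfl⟩
    exact ⟨n, Ordinal.natCast_lt_omega0 n, rfl⟩

/-- Foundation makes the bounded description categorical: by `∈`-induction, a set whose elements are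
all empty or successors of other elements contains only natural numbers. -/
instance absFun_omega : AbsFun fun _ => Ordinal.omega0.{u}.toZFSet := by
  refine ⟨Expressible.congr' (P := fun _ v => ∅ ∈ v 0 ∧ (∀ x ∈ v 0, insert x x ∈ v 0) ∧
    ∀ x ∈ v 0, x = ∅ ∨ ∃ y ∈ x, y ∈ v 0 ∧ x = insert y y) (by infer_instance) fun M v => ?_⟩
  constructor
  · rintro ⟨h0, hs, hi⟩
    ext x
    rw [toZFSet_omega_mem_iff]
    constructor
    · induction x using ZFSet.inductionOn with
      | h x ih =>
        intro hx
        rcases hi x hx with rfl | ⟨y, hy, hy', rfl⟩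
        · exact ⟨0, by simp⟩
        · obtain ⟨n, rfl⟩ := ih y hy hy'
          exact ⟨n + 1, by push_cast; rw [Ordinal.toZFSet_add_one]⟩
    · rintro ⟨n, rfl⟩
      induction n with
      | zero => simpa using h0
      | succ n ih => push_cast; rw [Ordinal.toZFSet_add_one]; exact hs _ ih
  · rintro h
    rw [h]
    simp only [toZFSet_omega_mem_iff]
    refine ⟨⟨0, by simp⟩, ?_, ?_⟩
    · rintro x ⟨n, rfl⟩
      exact ⟨n + 1, by push_cast; rw [Ordinal.toZFSet_add_one]⟩
    · rintro x ⟨n, rfl⟩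
      cases n with
      | zero => simp
      | succ n =>
        right
        refine ⟨(n : Ordinal).toZFSet, ?_, ⟨n, rfl⟩, ?_⟩ <;> push_cast <;>
          rw [Ordinal.toZFSet_add_one]
        exact ZFSet.mem_insert _ _

/-- The function `rank`, with values in the von Neumann ordinals. -/
noncomputable def rk (x : ZFSet.{u}) : ZFSet.{u} := x.rank.toZFSet

/-- `R` satisfies the recursive description of the rank function. -/
def IsRankFunction (R : ZFSet.{u}) : Prop :=
  ∀ a ∈ field R, ∀ b ∈ field R, ZFSet.pair a b ∈ R → b.IsTransitive ∧
    (∀ c ∈ a, ∃ d ∈ b, ZFSet.pair c d ∈ R) ∧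
    ∀ d ∈ b, ∃ c ∈ a, ∃ e ∈ field R, ZFSet.pair c e ∈ R ∧ (d = e ∨ d ∈ e)

/-- The clauses of `IsRankFunction` allow the recursion to be run on any part of the domain closed
under membership, and they force this closure; `∈`-induction then determines the value. -/
theorem IsRankFunction.eq {R : ZFSet.{u}} (hR : IsRankFunction R) (a : ZFSet.{u}) :
    ∀ b, ZFSet.pair a b ∈ R → b = rk a := by
  induction a using ZFSet.inductionOn with
  | h a ih =>
    intro b hb
    obtain ⟨ht, h1, h2⟩ := hR a (left_mem_field hb) b (right_mem_field hb) hb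
    ext d
    rw [rk, Ordinal.mem_toZFSet_iff]
    constructor
    · intro hd
      obtain ⟨c, hc, e, _, he, hde⟩ := h2 d hd
      obtain rfl := ih c hc e he
      rcases hde with rfl | hde
      · exact ⟨_, ZFSet.rank_lt_of_mem hc, rfl⟩
      · obtain ⟨δ, hδ, rfl⟩ := Ordinal.mem_toZFSet_iff.1 hde
        exact ⟨δ, hδ.trans (ZFSet.rank_lt_of_mem hc), rfl⟩
    · rintro ⟨δ, hδ, rfl⟩
      obtain ⟨c, hc, hle⟩ := ZFSet.lt_rank_iff.1 hδ
      obtain ⟨d, hd, hcd⟩ := h1 c hc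
      obtain rfl := ih c hc d hcd
      rcases hle.eq_or_lt with rfl | hlt
      · exact hd
      · exact ht _ hd (Ordinal.toZFSet_mem_toZFSet_iff.2 hlt)

theorem isRankFunction_graphOn {X : ZFSet.{u}} (hX : X.IsTransitive) :
    IsRankFunction (graphOn rk X) := by
  intro a _ b _ hab
  obtain ⟨ha, rfl⟩ := pair_mem_graphOn.1 hab
  refine ⟨(ZFSet.isOrdinal_toZFSet _).1, ?_, ?_⟩
  · intro c hc
    exact ⟨rk c, Ordinal.toZFSet_mem_toZFSet_iff.2 (ZFSet.rank_lt_of_mem hc), by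
      simp [hX a ha hc]⟩
  · intro d hd
    obtain ⟨δ, hδ, rfl⟩ := Ordinal.mem_toZFSet_iff.1 hd
    obtain ⟨c, hc, hle⟩ := ZFSet.lt_rank_iff.1 hδ
    have hcX : ZFSet.pair c (rk c) ∈ graphOn rk X := by simp [hX a ha hc]
    refine ⟨c, hc, rk c, right_mem_field hcX, hcX, ?_⟩
    rcases hle.eq_or_lt with rfl | hlt
    · exact Or.inl rfl
    · exact Or.inr (Ordinal.toZFSet_mem_toZFSet_iff.2 hlt)

/-- In `V`, the rank function on a large enough `V_β` is a set approximating the recursion. So `M`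
has an approximation too, and every approximation gives the true value. -/
instance absFun_rk {f : (ℕ → ZFSet.{u}) → ZFSet.{u}} [AbsFun f] : AbsFun fun v => rk (f v) := by
  refine AbsFun.of_total (R := fun M v y => ∃ R ∈ M, IsRankFunction R ∧ ZFSet.pair (f v) y ∈ R)
    ?_ ?_ ?_
  · unfold IsRankFunction
    infer_instance
  · intro v
    refine ⟨graphOn rk (ZFSet.vonNeumann (Order.succ (f v).rank)), trivial,
      isRankFunction_graphOn (ZFSet.isTransitive_vonNeumann _), ?_⟩
    rw [pair_mem_graphOn]
    exact ⟨ZFSet.mem_vonNeumann_succ _, rfl⟩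
  · rintro M _ v _ x _ ⟨R, _, hR, h⟩
    exact hR.eq _ _ h

/-! ### The action of `j` on ordinals, on the cumulative hierarchy and below the critical point. -/

section embedding

variable {M : Set ZFSet.{u}} {j : ZFSet.{u} → ZFSet.{u}} (hj : IsElementary M j)
include hj

namespace IsElementary

theorem mem_iff {x y : ZFSet.{u}} : j x ∈ j y ↔ x ∈ y :=
  (hj.transfer (fun _ v => v 0 ∈ v 1) (x ::ₛ fun _ => y)).symm

theorem subset_iff {x y : ZFSet.{u}} : j x ⊆ j y ↔ x ⊆ y :=
  (hj.transfer (fun _ v => v 0 ⊆ v 1) (x ::ₛ fun _ => y)).symm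

theorem map_pair (x y : ZFSet.{u}) : j (ZFSet.pair x y) = ZFSet.pair (j x) (j y) :=
  hj.map_absFun (fun v => ZFSet.pair (v 0) (v 1)) (x ::ₛ fun _ => y)

theorem map_app (x y : ZFSet.{u}) : j (app x y) = app (j x) (j y) :=
  hj.map_absFun (fun v => app (v 0) (v 1)) (x ::ₛ fun _ => y)

theorem map_inter (x y : ZFSet.{u}) : j (x ∩ y) = j x ∩ j y :=
  hj.map_absFun (fun v => v 0 ∩ v 1) (x ::ₛ fun _ => y)

theorem map_insert (x y : ZFSet.{u}) : j (insert x y) = insert (j x) (j y) :=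
  hj.map_absFun (fun v => insert (v 0) (v 1)) (x ::ₛ fun _ => y)

theorem map_empty : j ∅ = ∅ := hj.map_absFun (fun _ => ∅) (fun _ => ∅)

theorem map_omega : j Ordinal.omega0.toZFSet = Ordinal.omega0.toZFSet :=
  hj.map_absFun (fun _ => Ordinal.omega0.toZFSet) (fun _ => ∅)

theorem map_nat (n : ℕ) : j (n : Ordinal.{u}).toZFSet = (n : Ordinal.{u}).toZFSet := by
  induction n with
  | zero => simpa using hj.map_empty
  | succ n ih => push_cast; rw [Ordinal.toZFSet_add_one, hj.map_insert, ih]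

/-- The action of `j` on the ordinals. -/
theorem map_ord (α : Ordinal.{u}) : j α.toZFSet = (j α.toZFSet).rank.toZFSet := by
  have := (hj.transfer (fun _ v => (v 0).IsOrdinal) (fun _ => α.toZFSet)).1
    (ZFSet.isOrdinal_toZFSet α)
  exact this.toZFSet_rank_eq.symm

theorem rank_map (x : ZFSet.{u}) : (j x).rank.toZFSet = j x.rank.toZFSet :=
  (hj.map_absFun (fun v => rk (v 0)) (fun _ => x)).symm

theorem rank_map_eq (x : ZFSet.{u}) : (j x).rank = (j x.rank.toZFSet).rank := by
  rw [← hj.rank_map, Ordinal.rank_toZFSet]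

theorem ord_strictMono : StrictMono fun α : Ordinal.{u} => (j α.toZFSet).rank := by
  intro α β h
  have := hj.mem_iff.2 (Ordinal.toZFSet_mem_toZFSet_iff.2 h)
  rw [hj.map_ord α, hj.map_ord β] at this
  exact Ordinal.toZFSet_mem_toZFSet_iff.1 this

theorem le_ord (α : Ordinal.{u}) : α ≤ (j α.toZFSet).rank :=
  hj.ord_strictMono.le_apply

/-- The cumulative hierarchy is computed in `M` as the intersection with `M`. -/
theorem mem_map_vonNeumann {α : Ordinal.{u}} {x : ZFSet.{u}} :
    x ∈ j (ZFSet.vonNeumann α) ↔ x ∈ M ∧ x.rank < (j α.toZFSet).rank := by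
  have key := (hj.transfer (fun M v => ∀ y ∈ M, (y ∈ v 0 ↔ rk y ∈ v 1))
    (ZFSet.vonNeumann α ::ₛ fun _ => α.toZFSet)).1 (by
      intro y _
      change y ∈ ZFSet.vonNeumann α ↔ rk y ∈ α.toZFSet
      rw [rk, Ordinal.toZFSet_mem_toZFSet_iff, ZFSet.mem_vonNeumann])
  change ∀ y ∈ M, (y ∈ j (ZFSet.vonNeumann α) ↔ rk y ∈ j α.toZFSet) at key
  have h2 : ∀ y, rk y ∈ j α.toZFSet ↔ y.rank < (j α.toZFSet).rank := by
    intro y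
    rw [hj.map_ord α, rk, Ordinal.toZFSet_mem_toZFSet_iff, Ordinal.rank_toZFSet]
  constructor
  · intro hx
    have hM := hj.1 _ (hj.mem_class _) _ hx
    exact ⟨hM, (h2 x).1 ((key x hM).1 hx)⟩
  · rintro ⟨hM, h⟩
    exact (key x hM).2 ((h2 x).2 h)

variable {α : Ordinal.{u}} (hc : IsCrit j α)
include hc

theorem lt_crit : α < (j α.toZFSet).rank := by
  refine (hj.le_ord α).lt_of_ne fun h => hc.1 ?_
  rw [hj.map_ord, ← h]

theorem crit_mem : α.toZFSet ∈ j α.toZFSet := by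
  rw [hj.map_ord, Ordinal.toZFSet_mem_toZFSet_iff]
  exact hj.lt_crit hc

theorem map_eq_of_rank_lt (x : ZFSet.{u}) (hx : x.rank < α) : j x = x := by
  induction hξ : x.rank using WellFoundedLT.induction generalizing x with
  | ind ξ ih =>
    subst hξ
    have hr : (j x).rank = x.rank := by rw [hj.rank_map_eq, hc.2 _ hx, Ordinal.rank_toZFSet]
    ext y
    constructor
    · intro hy
      have hlt := hr ▸ ZFSet.rank_lt_of_mem hy
      rw [← ih y.rank hlt y (hlt.trans hx) rfl] at hy
      exact hj.mem_iff.1 hy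
    · intro hy
      have hlt := ZFSet.rank_lt_of_mem hy
      rw [← ih y.rank hlt y (hlt.trans hx) rfl]
      exact hj.mem_iff.2 hy

/-- A map into the critical point from a set of rank below the critical point is bounded. -/
theorem crit_bounded {x : ZFSet.{u}} (hx : x.rank < α) {F : ZFSet.{u} → Ordinal.{u}}
    (hF : ∀ y ∈ x, F y < α) : ∃ β < α, ∀ y ∈ x, F y < β := by
  by_contra! hcon
  let G := graphOn (fun y => (F y).toZFSet) x
  have key := (hj.transfer (fun _ v => ∀ β ∈ v 0, ∃ y ∈ v 1, β ⊆ app (v 2) y)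
    (α.toZFSet ::ₛ x ::ₛ fun _ => G)).1 (by
      intro β hβ
      obtain ⟨β, hβ', rfl⟩ := Ordinal.mem_toZFSet_iff.1 hβ
      obtain ⟨y, hy, h⟩ := hcon β hβ'
      refine ⟨y, hy, ?_⟩
      change _ ⊆ app G y
      rw [app_graphOn hy]
      exact Ordinal.toZFSet_subset_toZFSet_iff.2 h)
  -- The transferred unboundedness is read at the new point `α ∈ j(α)`. Since `j` fixes `x`, its
  -- elements and the values of `F`, some value of `F` would be at least `α`.
  obtain ⟨y, hy, h⟩ := key _ (hj.crit_mem hc)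
  change y ∈ j x at hy
  rw [hj.map_eq_of_rank_lt hc x hx] at hy
  change _ ⊆ app (j G) y at h
  rw [← hj.map_eq_of_rank_lt hc y ((ZFSet.rank_lt_of_mem hy).trans hx), ← hj.map_app,
    app_graphOn hy, hc.2 _ (hF y hy), Ordinal.toZFSet_subset_toZFSet_iff] at h
  exact (hF y hy).not_ge h

/-- The natural numbers and `ω` are definable, hence fixed by `j`. -/
theorem omega_lt_crit : Ordinal.omega0 < α := by
  by_contra! h
  rcases h.eq_or_lt with rfl | h
  · exact hc.1 hj.map_omega
  · obtain ⟨n, rfl⟩ := Ordinal.lt_omega0.1 h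
    exact hc.1 (hj.map_nat n)

theorem succ_lt_crit {ξ : Ordinal.{u}} (h : ξ < α) : Order.succ ξ < α := by
  by_contra! hle
  have h2 := (Order.succ_le_of_lt h).antisymm hle
  subst h2
  apply hc.1
  rw [Order.succ_eq_add_one, Ordinal.toZFSet_add_one, hj.map_insert, hc.2 _ h]

end IsElementary

end embedding

/-! ### Inaccessibility of critical points. -/

section critical

variable {M : Set ZFSet.{u}} {j : ZFSet.{u} → ZFSet.{u}} {α : Ordinal.{u}}

theorem IsElementary.crit_bounded_of_card (hj : IsElementary M j) (hc : IsCrit j α)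
    {x : ZFSet.{u}} (hx : x.rank < α) {ι : Type u} (hι : #ι ≤ x.card) {F : ι → Ordinal.{u}}
    (hF : ∀ i, F i < α) : ∃ β < α, ∀ i, F i < β := by
  classical
  obtain ⟨e⟩ := Cardinal.le_def _ _ |>.1 hι
  let e' : ι → ZFSet.{u} := fun i => ((equivShrink x).symm (e i) : x)
  have he' : Function.Injective e' := fun a b h =>
    e.injective ((equivShrink x).symm.injective (Subtype.ext h))
  obtain ⟨β, hβ, h⟩ := hj.crit_bounded hc hx (F := Function.extend e' F 0) (by
    intro y _
    by_cases hy : ∃ i, e' i = y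
    · obtain ⟨i, rfl⟩ := hy
      rw [he'.extend_apply]
      exact hF i
    · rw [Function.extend_apply' _ _ _ hy]
      exact (Ordinal.omega0_pos).trans (hj.omega_lt_crit hc))
  refine ⟨β, hβ, fun i => ?_⟩
  have := h (e' i) ((equivShrink x).symm (e i)).2
  rwa [he'.extend_apply] at this

theorem IsElementary.card_lt_crit (hj : IsElementary M j) (hc : IsCrit j α)
    {x : ZFSet.{u}} (hx : x.rank < α) : x.card < α.card := by
  by_contra! h
  -- The family of all ordinals below `α` is unbounded, so it cannot be indexed by a subset of `x`.
  obtain ⟨β, hβ, hb⟩ := hj.crit_bounded_of_card hc hx (ι := α.ToType) (by simpa using h)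
    (F := fun i => (Ordinal.ToType.toOrd i : Ordinal)) (fun i => (Ordinal.ToType.toOrd i).2)
  have := hb (Ordinal.ToType.mk ⟨β, hβ⟩)
  simp at this

theorem IsElementary.ord_card_crit (hj : IsElementary M j) (hc : IsCrit j α) :
    α.card.ord = α := by
  refine (Cardinal.ord_le.2 le_rfl : α.card.ord ≤ α).antisymm ?_
  by_contra! h
  have := hj.card_lt_crit hc (x := α.card.ord.toZFSet) (by rwa [Ordinal.rank_toZFSet])
  simp at this

/-- The critical point of an elementary embedding is an inaccessible cardinal. -/
theorem IsElementary.crit_isInaccessible (hj : IsElementary M j) (hc : IsCrit j α) :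
    α.card.IsInaccessible := by
  refine ⟨?_, ?_, ?_⟩
  · rw [← ord_lt_ord, hj.ord_card_crit hc, ord_aleph0]
    exact hj.omega_lt_crit hc
  · rw [hj.ord_card_crit hc]
    by_contra! h
    obtain ⟨s, hs, hsc⟩ := Order.exists_cof_eq (α := α.ToType)
    rw [Ordinal.cof_toType] at hsc
    have hlt : α.cof.ord < α := by rw [← hj.ord_card_crit hc, ord_lt_ord, hj.ord_card_crit hc]; exact h
    obtain ⟨β, hβ, hb⟩ := hj.crit_bounded_of_card hc (x := α.cof.ord.toZFSet)
      (by rwa [Ordinal.rank_toZFSet]) (ι := s) (by simp [hsc])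
      (F := fun i => (Ordinal.ToType.toOrd i.1 : Ordinal)) (fun i => (Ordinal.ToType.toOrd i.1).2)
    obtain ⟨t, ht, hle⟩ := hs (Ordinal.ToType.mk ⟨β, hβ⟩)
    have := hb ⟨t, ht⟩
    have h2 := Ordinal.ToType.mk.symm.monotone hle
    rw [OrderIso.symm_apply_apply] at h2
    exact (lt_of_le_of_lt (Subtype.coe_le_coe.2 h2) this).false
  · intro x hx
    have hx' : x.ord < α := by rw [← hj.ord_card_crit hc, ord_lt_ord]; exact hx
    -- The power set has rank one more than `x.ord`, still below the limit ordinal `α`.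
    have := hj.card_lt_crit hc (x := x.ord.toZFSet.powerset) (by
      rw [ZFSet.rank_powerset, Ordinal.rank_toZFSet]
      exact hj.succ_lt_crit hc hx')
    simpa using this

end critical

/-! ### Comparison of `H_ν` with the cumulative hierarchy. -/

section hereditary

variable {ν ν' κ : Cardinal.{u}} {x y : ZFSet.{u}}

theorem mem_H_iff : x ∈ H ν ↔ x.card < ν ∧ ∀ y ∈ x, y ∈ H ν :=
  ZFSet.hereditarily_iff

theorem H_mono (h : ν ≤ ν') : H ν ⊆ H ν' := by
  intro x
  induction x using ZFSet.inductionOn with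
  | h x ih =>
    intro hx
    rw [mem_H_iff] at hx ⊢
    exact ⟨hx.1.trans_le h, fun y hy => ih y hy (hx.2 y hy)⟩

theorem pair_mem_H (hν : ℵ₀ ≤ ν) : ZFSet.pair x y ∈ H ν ↔ x ∈ H ν ∧ y ∈ H ν := by
  have h2 : ∀ a b : ZFSet.{u}, ({a, b} : ZFSet.{u}) ∈ H ν ↔ a ∈ H ν ∧ b ∈ H ν := by
    intro a b
    rw [mem_H_iff]
    constructor
    · rintro ⟨_, h⟩
      exact ⟨h a (by simp), h b (by simp)⟩
    · rintro ⟨ha, hb⟩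
      refine ⟨lt_of_le_of_lt ZFSet.card_insert_le ?_, by simp [ha, hb]⟩
      rw [ZFSet.card_singleton]
      exact lt_of_lt_of_le (by exact_mod_cast natCast_lt_aleph0 (n := 2)) hν
  have h1 : ∀ a : ZFSet.{u}, ({a} : ZFSet.{u}) ∈ H ν ↔ a ∈ H ν := by
    intro a
    rw [← ZFSet.pair_eq_singleton, h2, and_self]
  rw [ZFSet.pair, h2, h1, h2]
  tauto

theorem toZFSet_mem_H {ξ : Ordinal.{u}} (h : ξ < ν.ord) : ξ.toZFSet ∈ H ν := by
  induction ξ using WellFoundedLT.induction with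
  | ind ξ ih =>
    rw [mem_H_iff]
    refine ⟨by rw [Ordinal.card_toZFSet]; exact lt_ord.1 h, fun y hy => ?_⟩
    obtain ⟨η, hη, rfl⟩ := Ordinal.mem_toZFSet_iff.1 hy
    exact ih η hη (hη.trans h)

theorem mem_H_of_card_vonNeumann_lt {o : Ordinal.{u}}
    (h : (ZFSet.vonNeumann o).card < ν) (hx : x ⊆ ZFSet.vonNeumann o) : x ∈ H ν := by
  induction x using ZFSet.inductionOn with
  | h x ih =>
    rw [mem_H_iff]
    refine ⟨(ZFSet.card_mono hx).trans_lt h, fun y hy => ih y hy ?_⟩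
    exact ZFSet.isTransitive_vonNeumann o _ (hx hy)

theorem card_vonNeumann_lt (hκ : κ.IsInaccessible) {o : Ordinal.{u}} (ho : o < κ.ord) :
    (ZFSet.vonNeumann o).card < κ := by
  rw [ZFSet.card_vonNeumann]
  exact (preBeth_strictMono ho).trans_eq hκ.preBeth_ord

theorem vonNeumann_subset_H (hκ : κ.IsInaccessible) :
    (ZFSet.vonNeumann κ.ord : Set ZFSet.{u}) ⊆ H κ := by
  intro x hx
  exact mem_H_of_card_vonNeumann_lt
    (card_vonNeumann_lt hκ (ZFSet.mem_vonNeumann.1 hx)) (ZFSet.subset_vonNeumann_self x)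

/-- By `∈`-induction: regularity bounds fewer than `κ` ranks below `κ`. -/
theorem rank_lt_of_mem_H (hκ : κ.IsRegular) (hx : x ∈ H κ) : x.rank < κ.ord := by
  induction x using ZFSet.inductionOn with
  | h x ih =>
    rw [mem_H_iff] at hx
    have h := Ordinal.iSup_add_one_lt_of_lt_cof (α := Shrink.{u} x) (a := κ.ord)
      (f := fun i => ((equivShrink x).symm i : ZFSet.{u}).rank)
      (hx.1.trans_le hκ.2) (fun i => ih _ ((equivShrink x).symm i).2
        (hx.2 _ ((equivShrink x).symm i).2))
    refine lt_of_le_of_lt (ZFSet.rank_le_iff.2 fun y hy => ?_) h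
    rw [← Order.add_one_le_iff]
    have := Ordinal.le_iSup (fun i : Shrink.{u} x => ((equivShrink x).symm i : ZFSet.{u}).rank + 1)
      (equivShrink x ⟨y, hy⟩)
    simpa using this

end hereditary

/-! ### Inaccessibility of `κ` from critical points below it. -/

section inaccessible

variable {κ : Cardinal.{u}}

/-- Singularity is packaged as a function on all ordinals, to which closure and boundedness at
critical points apply directly. -/
theorem exists_short_cofinal (h0 : 0 < κ.ord) (h : κ.ord.cof < κ) :
    ∃ c < κ, ∃ G : Ordinal.{u} → Ordinal.{u}, (∀ ξ, G ξ < κ.ord) ∧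
      ∀ β < κ.ord, ∃ ξ < c.ord, β ≤ G ξ := by
  classical
  obtain ⟨s, hs, hsc⟩ := Order.exists_cof_eq (α := κ.ord.ToType)
  rw [Ordinal.cof_toType] at hsc
  have : #s = #κ.ord.cof.ord.ToType := by simp [hsc]
  obtain ⟨e⟩ := Cardinal.eq.1 this
  let G : Ordinal.{u} → Ordinal.{u} := fun ξ => if hξ : ξ ∈ Set.Iio κ.ord.cof.ord then
    (Ordinal.ToType.toOrd (e.symm (Ordinal.ToType.mk ⟨ξ, hξ⟩)).1 : Ordinal) else 0
  have hG : ∀ a : κ.ord.cof.ord.ToType,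
      G (Ordinal.ToType.toOrd a) = (Ordinal.ToType.toOrd (e.symm a).1 : Ordinal) := by
    intro a
    refine (dif_pos (Ordinal.ToType.toOrd a).2).trans ?_
    exact congrArg (fun b => ((Ordinal.ToType.toOrd (e.symm b).1 : Set.Iio _) : Ordinal))
      (Ordinal.ToType.mk.apply_symm_apply a)
  refine ⟨_, h, G, ?_, ?_⟩
  · intro ξ
    dsimp only [G]
    split_ifs with hξ
    · exact (Ordinal.ToType.toOrd (e.symm (Ordinal.ToType.mk ⟨ξ, hξ⟩)).1).2
    · exact h0
  · intro β hβ
    obtain ⟨t, ht, hle⟩ := hs (Ordinal.ToType.mk ⟨β, hβ⟩)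
    refine ⟨(Ordinal.ToType.toOrd (e ⟨t, ht⟩) : Ordinal), (Ordinal.ToType.toOrd (e ⟨t, ht⟩)).2, ?_⟩
    have h2 := Ordinal.ToType.mk.symm.monotone hle
    rw [OrderIso.symm_apply_apply] at h2
    rw [hG, e.symm_apply_apply]
    exact Subtype.coe_le_coe.2 h2

/-- `α` is the critical point of some elementary embedding. -/
def IsCritical (α : Ordinal.{u}) : Prop :=
  ∃ (M : Set ZFSet.{u}) (j : ZFSet.{u} → ZFSet.{u}), IsElementary M j ∧ IsCrit j α

theorem IsStrong.isCritical {α : Ordinal.{u}} {X : ZFSet.{u}} (h : IsStrong α κ X) :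
    IsCritical α :=
  let ⟨M, j, hj, hc, _⟩ := h
  ⟨M, j, hj, hc⟩

theorem IsEmbeddingPoint.isCritical {α : Ordinal.{u}} {f : ZFSet.{u}} (h : IsEmbeddingPoint f α) :
    IsCritical α :=
  let ⟨_, M, j, hj, hc, _⟩ := h
  ⟨M, j, hj, hc⟩

theorem IsCritical.ord_card {α : Ordinal.{u}} (h : IsCritical α) : α.card.ord = α :=
  let ⟨_, _, hj, hc⟩ := h
  hj.ord_card_crit hc

theorem IsCritical.isInaccessible {α : Ordinal.{u}} (h : IsCritical α) : α.card.IsInaccessible :=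
  let ⟨_, _, hj, hc⟩ := h
  hj.crit_isInaccessible hc

theorem IsCritical.omega_lt {α : Ordinal.{u}} (h : IsCritical α) : Ordinal.omega0 < α :=
  let ⟨_, _, hj, hc⟩ := h
  hj.omega_lt_crit hc

/-- Critical points unbounded below `κ` are strong limits, so `κ` is one; only regularity has to be
assumed. -/
theorem isInaccessible_of_critical (h1 : ∀ β < κ.ord, ∃ α < κ.ord, β < α ∧ IsCritical α)
    (h0 : 0 < κ.ord) (h2 : κ ≤ κ.ord.cof) : κ.IsInaccessible := by
  refine ⟨?_, h2, ?_⟩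
  · obtain ⟨α, hα, -, hc⟩ := h1 0 h0
    rw [← ord_lt_ord, ord_aleph0]
    exact hc.omega_lt.trans hα
  · intro x hx
    obtain ⟨α, hα, hxα, hc⟩ := h1 x.ord (ord_lt_ord.2 hx)
    rw [← hc.ord_card, ord_lt_ord] at hxα hα
    exact (hc.isInaccessible.isStrongPrelimit hxα).trans hα

end inaccessible

/-! ### Embedding points of ordinal functions, and inaccessibility from condition (2). -/

section condition_two

variable {κ : Cardinal.{u}}

/-- The set-theoretic function on `κ` given by a function on ordinals. -/
noncomputable def ordGraph (κ : Cardinal.{u}) (F : Ordinal.{u} → Ordinal.{u}) : ZFSet.{u} :=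
  graphOn (fun x => (F x.rank).toZFSet) κ.ord.toZFSet

theorem pair_mem_ordGraph {F : Ordinal.{u} → Ordinal.{u}} {ξ : Ordinal.{u}} {y : ZFSet.{u}} :
    ZFSet.pair ξ.toZFSet y ∈ ordGraph κ F ↔ ξ < κ.ord ∧ y = (F ξ).toZFSet := by
  simp [ordGraph]

theorem isFunc_graphOn {F : ZFSet.{u} → ZFSet.{u}} {X Y : ZFSet.{u}} (h : ∀ x ∈ X, F x ∈ Y) :
    ZFSet.IsFunc X Y (graphOn F X) := by
  constructor
  · intro z hz
    obtain ⟨x, hx, rfl⟩ := mem_graphOn.1 hz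
    exact ZFSet.pair_mem_prod.2 ⟨hx, h x hx⟩
  · intro x hx
    exact ⟨F x, by simp [hx], by simp⟩

theorem isFunc_ordGraph {F : Ordinal.{u} → Ordinal.{u}} (h : ∀ ξ < κ.ord, F ξ < κ.ord) :
    ZFSet.IsFunc κ.ord.toZFSet κ.ord.toZFSet (ordGraph κ F) := by
  refine isFunc_graphOn fun x hx => ?_
  obtain ⟨ξ, hξ, rfl⟩ := Ordinal.mem_toZFSet_iff.1 hx
  simpa using h ξ hξ

theorem isClosurePoint_ordGraph {F : Ordinal.{u} → Ordinal.{u}} {α : Ordinal.{u}}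
    (hα : α < κ.ord) : IsClosurePoint (ordGraph κ F) α ↔ ∀ ξ < α, F ξ < α := by
  constructor
  · intro h ξ hξ
    exact h ξ _ hξ (pair_mem_ordGraph.2 ⟨hξ.trans hα, rfl⟩)
  · intro h ξ γ hξ hp
    obtain rfl := Ordinal.toZFSet_injective (pair_mem_ordGraph.1 hp).2
    exact h ξ hξ

/-- Every function on `κ` has an embedding point below `κ`. -/
def HasEmbeddingPoints (κ : Cardinal.{u}) : Prop :=
  ∀ f : ZFSet.{u}, ZFSet.IsFunc κ.ord.toZFSet κ.ord.toZFSet f → ∃ α < κ.ord, IsEmbeddingPoint f α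

theorem HasEmbeddingPoints.exists_critical (h : HasEmbeddingPoints κ)
    {F : Ordinal.{u} → Ordinal.{u}} (hF : ∀ ξ < κ.ord, F ξ < κ.ord) :
    ∃ α < κ.ord, IsCritical α ∧ ∀ ξ < α, F ξ < α := by
  obtain ⟨α, hα, h⟩ := h _ (isFunc_ordGraph hF)
  exact ⟨α, hα, h.isCritical, (isClosurePoint_ordGraph hα).1 h.1⟩

theorem HasEmbeddingPoints.isInaccessible (h : HasEmbeddingPoints κ) : κ.IsInaccessible := by
  have h0 : 0 < κ.ord := by
    obtain ⟨α, hα, _⟩ := h.exists_critical (F := id) (fun _ => id)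
    exact zero_le.trans_lt hα
  refine isInaccessible_of_critical ?_ h0 ?_
  · intro β hβ
    obtain ⟨α, hα, hc, hcl⟩ := h.exists_critical (F := fun _ => β) (fun _ _ => hβ)
    exact ⟨α, hα, hcl 0 (Ordinal.omega0_pos.trans hc.omega_lt), hc⟩
  · by_contra! hcof
    obtain ⟨c, hcκ, G, hG, hGc⟩ := exists_short_cofinal h0 hcof
    -- The constant part of the maximum forces `c < α` through closure at `0`; closure at the
    -- arguments below `c` then keeps the cofinal values of `G` below `α`.
    obtain ⟨α, hα, hc, hcl⟩ := h.exists_critical (F := fun ξ => max c.ord (G ξ))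
      (fun ξ _ => max_lt (ord_lt_ord.2 hcκ) (hG ξ))
    obtain ⟨ξ, hξ, hle⟩ := hGc α hα
    have h1 := hcl 0 (Ordinal.omega0_pos.trans hc.omega_lt)
    have h2 := hcl ξ (hξ.trans ((le_max_left _ _).trans_lt h1))
    exact (hle.trans (le_max_right _ _)).not_gt h2

end condition_two

/-! ### The Woodin filter. -/

section filter

variable {κ : Cardinal.{u}} {f f' : ZFSet.{u}} {α : Ordinal.{u}}

theorem exists_pair_of_isFunc {x : ZFSet.{u}} {ξ : Ordinal.{u}}
    (hf : ZFSet.IsFunc x κ.ord.toZFSet f) (hξ : ξ.toZFSet ∈ x) :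
    ∃ η < κ.ord, ZFSet.pair ξ.toZFSet η.toZFSet ∈ f := by
  obtain ⟨w, hw, -⟩ := hf.2 _ hξ
  obtain ⟨η, hη, rfl⟩ := Ordinal.mem_toZFSet_iff.1 (ZFSet.pair_mem_prod.1 (hf.1 hw)).2
  exact ⟨η, hη, hw⟩

/-- Passing to a pointwise smaller function preserves embedding points. -/
theorem IsEmbeddingPoint.of_le (hf : ZFSet.IsFunc κ.ord.toZFSet κ.ord.toZFSet f)
    (hf' : ZFSet.IsFunc κ.ord.toZFSet κ.ord.toZFSet f') (h : IsEmbeddingPoint f' α)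
    (hle : ∀ ξ η η' : Ordinal.{u}, ZFSet.pair ξ.toZFSet η.toZFSet ∈ f →
      ZFSet.pair ξ.toZFSet η'.toZFSet ∈ f' → η ≤ η') : IsEmbeddingPoint f α := by
  obtain ⟨hcl, M, j, hj, hc, η', hη', hM⟩ := h
  constructor
  · intro ξ η hξ hη
    have hξκ := (ZFSet.pair_mem_prod.1 (hf.1 hη)).1
    obtain ⟨η₁, -, h1⟩ := exists_pair_of_isFunc hf' hξκ
    exact (hle _ _ _ hη h1).trans_lt (hcl _ _ hξ h1)
  · refine ⟨M, j, hj, hc, ?_⟩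
    -- Pointwise domination transfers to `j(f)(α) ≤ j(f')(α)`, and a smaller level of the hierarchy
    -- is still included in `M`.
    have key := (hj.transfer (fun _ v => ∀ x ∈ field (v 0), ∀ y' ∈ field (v 0),
      ZFSet.pair x y' ∈ v 0 → ∃ y ∈ v 2, ZFSet.pair x y ∈ v 1 ∧ y ⊆ y')
      (f' ::ₛ f ::ₛ fun _ => κ.ord.toZFSet)).1 (by
        intro x _ y' _ hxy
        change ∃ y ∈ κ.ord.toZFSet, ZFSet.pair x y ∈ f ∧ y ⊆ y'
        obtain ⟨hx, hy⟩ := ZFSet.pair_mem_prod.1 (hf'.1 hxy)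
        obtain ⟨ξ, -, rfl⟩ := Ordinal.mem_toZFSet_iff.1 hx
        obtain ⟨η', -, rfl⟩ := Ordinal.mem_toZFSet_iff.1 hy
        obtain ⟨η, hη, h1⟩ := exists_pair_of_isFunc hf hx
        exact ⟨_, Ordinal.toZFSet_mem_toZFSet_iff.2 hη, h1,
          Ordinal.toZFSet_subset_toZFSet_iff.2 (hle _ _ _ h1 hxy)⟩)
    obtain ⟨y, hy, hp, hs⟩ := key _ (left_mem_field hη') _ (right_mem_field hη') hη'
    change y ∈ j κ.ord.toZFSet at hy
    rw [hj.map_ord] at hy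
    obtain ⟨η, -, rfl⟩ := Ordinal.mem_toZFSet_iff.1 hy
    exact ⟨η, hp, (ZFSet.coe_subset_coe.2 (ZFSet.vonNeumann_subset_of_le
      (Ordinal.toZFSet_subset_toZFSet_iff.1 hs))).trans hM⟩

theorem exists_upper_bound (hf : ZFSet.IsFunc κ.ord.toZFSet κ.ord.toZFSet f)
    (hf' : ZFSet.IsFunc κ.ord.toZFSet κ.ord.toZFSet f') :
    ∃ g, ZFSet.IsFunc κ.ord.toZFSet κ.ord.toZFSet g ∧ ∀ α, IsEmbeddingPoint g α →
      IsEmbeddingPoint f α ∧ IsEmbeddingPoint f' α := by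
  have hval : ∀ g, ZFSet.IsFunc κ.ord.toZFSet κ.ord.toZFSet g → ∃ G : Ordinal.{u} → Ordinal.{u},
      (∀ ξ < κ.ord, G ξ < κ.ord) ∧
        ∀ ξ η : Ordinal.{u}, ZFSet.pair ξ.toZFSet η.toZFSet ∈ g → η = G ξ := by
    intro g hg
    have : ∀ ξ : Ordinal.{u}, ∃ η, ξ < κ.ord → η < κ.ord ∧ ZFSet.pair ξ.toZFSet η.toZFSet ∈ g := by
      intro ξ
      by_cases hξ : ξ < κ.ord
      · obtain ⟨η, h⟩ := exists_pair_of_isFunc hg (Ordinal.toZFSet_mem_toZFSet_iff.2 hξ)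
        exact ⟨η, fun _ => h⟩
      · exact ⟨0, fun h => (hξ h).elim⟩
    choose G hG using this
    refine ⟨G, fun ξ hξ => (hG ξ hξ).1, fun ξ η h => ?_⟩
    have hξ := (ZFSet.pair_mem_prod.1 (hg.1 h)).1
    exact Ordinal.toZFSet_injective
      ((hg.2 _ hξ).unique h (hG ξ (Ordinal.toZFSet_mem_toZFSet_iff.1 hξ)).2)
  obtain ⟨F, hF, hFf⟩ := hval f hf
  obtain ⟨F', hF', hFf'⟩ := hval f' hf'
  have hg := isFunc_ordGraph (κ := κ) (F := fun ξ => max (F ξ) (F' ξ))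
    fun ξ hξ => max_lt (hF ξ hξ) (hF' ξ hξ)
  refine ⟨_, hg, fun α hα => ⟨hα.of_le hf hg ?_, hα.of_le hf' hg ?_⟩⟩
  · intro ξ η η' h h'
    rw [hFf _ _ h, Ordinal.toZFSet_injective (pair_mem_ordGraph.1 h').2]
    exact le_max_left _ _
  · intro ξ η η' h h'
    rw [hFf' _ _ h, Ordinal.toZFSet_injective (pair_mem_ordGraph.1 h').2]
    exact le_max_right _ _

theorem hasEmbeddingPoints_iff_filter :
    HasEmbeddingPoints κ ↔ ∃ F : Filter (Set.Iio κ.ord),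
      F.sets = {X | ¬ IsWoodinIn κ Xᶜ} ∧ F.NeBot := by
  constructor
  · intro h
    refine ⟨⟨{X | ¬ IsWoodinIn κ Xᶜ}, ?_, ?_, ?_⟩, rfl, ⟨fun hbot => ?_⟩⟩
    · intro hX
      obtain ⟨α, hα, -⟩ := hX _ (isFunc_ordGraph (F := id) fun _ => id)
      simp at hα
    · intro X Y hX hXY hY
      refine hX fun f hf => ?_
      obtain ⟨α, hα, h⟩ := hY f hf
      exact ⟨α, fun hαX => hα (hXY hαX), h⟩
    · intro X Y hX hY hXY
      simp only [IsWoodinIn, Set.mem_ofPred_eq, not_forall] at hX hY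
      obtain ⟨f, hf, hX⟩ := hX
      obtain ⟨f', hf', hY⟩ := hY
      obtain ⟨g, hg, hgf⟩ := exists_upper_bound hf hf'
      obtain ⟨α, hα, h⟩ := hXY g hg
      rw [Set.compl_inter] at hα
      rcases hα with hα | hα
      · exact hX ⟨α, hα, (hgf _ h).1⟩
      · exact hY ⟨α, hα, (hgf _ h).2⟩
    · have : (∅ : Set (Set.Iio κ.ord)) ∈ (⊥ : Filter (Set.Iio κ.ord)) := Filter.mem_bot
      rw [← hbot] at this
      refine this fun f hf => ?_
      obtain ⟨α, hα, h⟩ := h f hf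
      exact ⟨⟨α, hα⟩, by simp, h⟩
  · rintro ⟨F, hF, hne⟩ f hf
    have : (∅ : Set (Set.Iio κ.ord)) ∉ F.sets := F.empty_notMem
    rw [hF, Set.mem_ofPred_eq, not_not, Set.compl_empty] at this
    obtain ⟨α, -, h⟩ := this f hf
    exact ⟨α, α.2, h⟩

end filter

/-! ### From stationarily many strong ordinals to a Woodin cardinal. -/

section stationary

variable {κ : Cardinal.{u}}

theorem zero_lt_ord_of_stationary {s : Set (Set.Iio κ.ord)} (h : IsStationary s) : 0 < κ.ord :=
  let ⟨α, _⟩ := h.nonempty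
  zero_le.trans_lt α.2

theorem isInaccessible_of_stationary {s : Set (Set.Iio κ.ord)} (h : IsStationary s)
    (hs : ∀ α ∈ s, IsCritical (α : Ordinal)) : κ.IsInaccessible := by
  have h0 := zero_lt_ord_of_stationary h
  have hlim : ∀ ξ < κ.ord, ξ + 1 < κ.ord := by
    obtain ⟨α, hα⟩ := h.nonempty
    have : ℵ₀ ≤ κ := by
      rw [← ord_le_ord, ord_aleph0]
      exact ((hs α hα).omega_lt.trans α.2).le
    exact fun ξ hξ => (isSuccLimit_ord this).add_one_lt hξ
  refine isInaccessible_of_critical ?_ h0 ?_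
  · intro β hβ
    obtain ⟨α, hα, hαβ⟩ := h (t := {ξ | β < (ξ : Ordinal)}) (by
      refine ⟨?_, ?_⟩
      · intro d hd ⟨x, hx⟩ _ a ha
        exact (show β < (x : Ordinal) from hd hx).trans_le (ha.1 hx)
      · intro x
        have hm := max_lt x.2 hβ
        exact ⟨⟨max (x : Ordinal) β + 1, hlim _ hm⟩, (le_max_right (x : Ordinal) β).trans_lt (lt_add_one _),
          (le_max_left (x : Ordinal) β).trans (lt_add_one _).le⟩)
    exact ⟨α, α.2, hαβ, hs α hα⟩
  · by_contra! hcof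
    obtain ⟨c, hcκ, G, hG, hGc⟩ := exists_short_cofinal h0 hcof
    -- The club consists of the points above `c` in which the values of the short map `G` are
    -- cofinal. A critical point in it contradicts `crit_bounded`.
    obtain ⟨α, hα, hcα, hGα⟩ := h (t := {ξ | c.ord < (ξ : Ordinal) ∧
        ∀ η < (ξ : Ordinal), ∃ ζ < c.ord, η ≤ G ζ ∧ G ζ < ξ}) (by
      refine ⟨?_, ?_⟩
      · intro d hd ⟨x, hx⟩ _ a ha
        refine ⟨(hd hx).1.trans_le (ha.1 hx), fun η hη => ?_⟩
        have : ∃ y ∈ d, η < (y : Ordinal) := by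
          by_contra! hc
          exact hη.not_ge (Subtype.coe_le_coe.2 (ha.2 (show (⟨η, hη.trans a.2⟩ : Set.Iio κ.ord) ∈
            upperBounds d from fun y hy => hc y hy)))
        obtain ⟨y, hy, hηy⟩ := this
        obtain ⟨ζ, hζ, h1, h2⟩ := (hd hy).2 η hηy
        exact ⟨ζ, hζ, h1, h2.trans_le (ha.1 hy)⟩
      · intro x
        -- A successor `G ζ + 1` above `c` is in the club, because the single value `G ζ` dominates
        -- everything below it.
        obtain ⟨ζ, hζ, hle⟩ := hGc _ (max_lt x.2 (ord_lt_ord.2 hcκ))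
        refine ⟨⟨G ζ + 1, hlim _ (hG ζ)⟩, ⟨((le_max_right _ _).trans hle).trans_lt (lt_add_one _),
          fun η hη => ⟨ζ, hζ, Order.lt_add_one_iff.1 hη, lt_add_one _⟩⟩, ?_⟩
        exact ((le_max_left _ _).trans hle).trans (lt_add_one _).le)
    obtain ⟨M, j, hj, hc⟩ := hs α hα
    classical
    -- Values of `G` not below `α` are replaced by `0`, so that the map goes into `α`; the remaining
    -- values are still cofinal there.
    obtain ⟨β, hβ, hb⟩ := hj.crit_bounded hc (x := c.ord.toZFSet)
      (by rwa [Ordinal.rank_toZFSet]) (F := fun y => if G y.rank < α then G y.rank else 0) (by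
        intro y _
        split_ifs with h
        · exact h
        · exact Ordinal.omega0_pos.trans (hj.omega_lt_crit hc))
    obtain ⟨ζ, hζ, h1, h2⟩ := hGα β hβ
    have := hb ζ.toZFSet (Ordinal.toZFSet_mem_toZFSet_iff.2 hζ)
    rw [Ordinal.rank_toZFSet, if_pos h2] at this
    exact h1.not_gt this

/-- For every `A ⊆ V_κ`, stationarily many ordinals below `κ` are strong for `A` up to `κ`. -/
def HasStationaryStrong (κ : Cardinal.{u}) : Prop :=
  ∀ A : ZFSet.{u}, A ⊆ ZFSet.vonNeumann κ.ord →
    IsStationary {α : Set.Iio κ.ord | ∀ γ : Cardinal.{u}, γ < κ → IsStrong α γ A}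

theorem HasStationaryStrong.isWoodin (h : HasStationaryStrong κ) : IsWoodin κ := by
  have hpos : 0 < κ := by
    rw [← ord_lt_ord, ord_zero]
    exact zero_lt_ord_of_stationary (h ∅ (ZFSet.empty_subset _))
  have hin : κ.IsInaccessible := isInaccessible_of_stationary (h ∅ (ZFSet.empty_subset _))
    fun α hα => (hα 0 hpos).isCritical
  refine ⟨hin, fun X hX => ?_⟩
  obtain ⟨α, hα⟩ := (h X fun x hx =>
    ZFSet.mem_vonNeumann.2 (rank_lt_of_mem_H hin.isRegular (hX hx))).nonempty
  have hord := (hα 0 hpos).isCritical.ord_card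
  refine ⟨(α : Ordinal).card, ?_, ?_⟩
  · rw [← ord_lt_ord, hord]
    exact α.2
  · rw [hord]
    exact hα

end stationary

/-! ### Strength for two predicates at once, and stationarity. -/

section coding

variable {κ ν : Cardinal.{u}}

/-- The disjoint union of two sets. -/
noncomputable def code (X Y : ZFSet.{u}) : ZFSet.{u} :=
  ZFSet.prod {∅} X ∪ ZFSet.prod {{∅}} Y

theorem empty_ne_singleton_empty : (∅ : ZFSet.{u}) ≠ {∅} := fun h => by
  have : (∅ : ZFSet.{u}) ∈ ({∅} : ZFSet.{u}) := ZFSet.mem_singleton.2 rfl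
  exact ZFSet.notMem_empty _ (h.symm ▸ this)

theorem pair_empty_mem_code {X Y x : ZFSet.{u}} : ZFSet.pair ∅ x ∈ code X Y ↔ x ∈ X := by
  rw [code, ZFSet.mem_union, ZFSet.pair_mem_prod, ZFSet.pair_mem_prod, ZFSet.mem_singleton,
    ZFSet.mem_singleton]
  simp [empty_ne_singleton_empty]

theorem pair_singleton_mem_code {X Y x : ZFSet.{u}} : ZFSet.pair {∅} x ∈ code X Y ↔ x ∈ Y := by
  rw [code, ZFSet.mem_union, ZFSet.pair_mem_prod, ZFSet.pair_mem_prod, ZFSet.mem_singleton,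
    ZFSet.mem_singleton]
  simp [empty_ne_singleton_empty.symm]

/-- As `t` is fixed, the section of `j Z` at `t` is `j X`. The class `H ν` is closed under pairing
with `t`, so agreement of `Z` and `j Z` passes to the sections. -/
theorem IsElementary.inter_H_of_code {M : Set ZFSet.{u}} {j : ZFSet.{u} → ZFSet.{u}}
    (hj : IsElementary M j) {Z X t : ZFSet.{u}} (ht : j t = t) (htH : t ∈ H ν) (hν : ℵ₀ ≤ ν)
    (hZ : ∀ x, ZFSet.pair t x ∈ Z ↔ x ∈ X)
    (h : (j Z : Set ZFSet.{u}) ∩ H ν = (Z : Set ZFSet.{u}) ∩ H ν) :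
    (j X : Set ZFSet.{u}) ∩ H ν = (X : Set ZFSet.{u}) ∩ H ν := by
  have key := (hj.transfer (fun M v => ∀ x ∈ M, (ZFSet.pair (v 2) x ∈ v 0 ↔ x ∈ v 1))
    (Z ::ₛ X ::ₛ fun _ => t)).1 fun x _ => hZ x
  change ∀ x ∈ M, (ZFSet.pair (j t) x ∈ j Z ↔ x ∈ j X) at key
  rw [ht] at key
  have hpair : ∀ x ∈ H ν, (ZFSet.pair t x ∈ j Z ↔ ZFSet.pair t x ∈ Z) := by
    intro x hx
    have h1 : ZFSet.pair t x ∈ H ν := (pair_mem_H hν).2 ⟨htH, hx⟩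
    have := Set.ext_iff.1 h (ZFSet.pair t x)
    simpa [h1] using this
  ext x
  simp only [Set.mem_inter_iff, SetLike.mem_coe, and_congr_left_iff]
  intro hx
  constructor
  · intro hxX
    have hM := hj.1 _ (hj.mem_class _) _ hxX
    exact (hZ x).1 ((hpair x hx).1 ((key x hM).2 hxX))
  · intro hxX
    have h1 := (hpair x hx).2 ((hZ x).2 hxX)
    have h2 := hj.1 _ (hj.1 _ (hj.mem_class _) _ h1) {t, x} (by simp [ZFSet.pair])
    exact (key x (hj.1 _ h2 x (by simp))).1 h1

theorem IsWoodin.exists_strong_pair (h : IsWoodin κ) {X Y : ZFSet.{u}}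
    (hX : X ⊆ ZFSet.vonNeumann κ.ord) (hY : Y ⊆ ZFSet.vonNeumann κ.ord) :
    ∃ μ < κ, ∀ ν < κ, ∃ (M : Set ZFSet.{u}) (j : ZFSet.{u} → ZFSet.{u}), IsElementary M j ∧
      IsCrit j μ.ord ∧ ν.ord.toZFSet ⊆ j μ.ord.toZFSet ∧
      (j X : Set ZFSet.{u}) ∩ H ν = (X : Set ZFSet.{u}) ∩ H ν ∧
      (j Y : Set ZFSet.{u}) ∩ H ν = (Y : Set ZFSet.{u}) ∩ H ν := by
  have h0 : ∀ ν : Cardinal.{u}, ℵ₀ ≤ ν → (∅ : ZFSet.{u}) ∈ H ν := fun ν hν => by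
    rw [mem_H_iff]
    simpa using aleph0_pos.trans_le hν
  have h1 : ∀ ν : Cardinal.{u}, ℵ₀ ≤ ν → ({∅} : ZFSet.{u}) ∈ H ν := fun ν hν => by
    rw [mem_H_iff, ZFSet.card_singleton]
    exact ⟨one_lt_aleph0.trans_le hν, by simpa using h0 ν hν⟩
  obtain ⟨μ, hμ, hs⟩ := h.2 (code X Y) (by
    intro z hz
    have hXH := fun x hx => vonNeumann_subset_H h.1 (hX (x := x) hx)
    have hYH := fun x hx => vonNeumann_subset_H h.1 (hY (x := x) hx)
    have hκ := h.1.aleph0_lt.le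
    simp only [code, SetLike.mem_coe, ZFSet.mem_union, ZFSet.mem_prod, ZFSet.mem_singleton] at hz
    rcases hz with ⟨_, rfl, b, hb, rfl⟩ | ⟨_, rfl, b, hb, rfl⟩
    · exact (pair_mem_H hκ).2 ⟨h0 κ hκ, hXH b hb⟩
    · exact (pair_mem_H hκ).2 ⟨h1 κ hκ, hYH b hb⟩)
  refine ⟨μ, hμ, fun ν hν => ?_⟩
  -- Decoding needs closure of `H` under pairs, so the degree is first made infinite.
  obtain ⟨M, j, hj, hc, hle, hcode⟩ := hs (max ν ℵ₀) (max_lt hν h.1.aleph0_lt)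
  have hinf : ℵ₀ ≤ max ν ℵ₀ := le_max_right _ _
  have hmono : H ν ⊆ H (max ν ℵ₀) := H_mono (le_max_left _ _)
  have hres : ∀ A B : Set ZFSet.{u}, A ∩ H (max ν ℵ₀) = B ∩ H (max ν ℵ₀) →
      A ∩ H ν = B ∩ H ν := by
    intro A B hAB
    rw [← Set.inter_eq_right.2 hmono, ← Set.inter_assoc, hAB, Set.inter_assoc]
  refine ⟨M, j, hj, hc, ?_, ?_, ?_⟩
  · refine fun x hx => hle ?_
    exact Ordinal.toZFSet_subset_toZFSet_iff.2 (ord_le_ord.2 (le_max_left _ _)) hx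
  · exact hres _ _ (hj.inter_H_of_code (t := ∅) hj.map_empty (h0 _ hinf) hinf
      (fun x => pair_empty_mem_code) hcode)
  · refine hres _ _ (hj.inter_H_of_code (t := {∅}) ?_ (h1 _ hinf) hinf
      (fun x => pair_singleton_mem_code) hcode)
    exact hj.map_absFun (fun _ => {∅}) (fun _ => ∅)

theorem IsWoodin.hasStationaryStrong (h : IsWoodin κ) : HasStationaryStrong κ := by
  intro A hA C hC
  let Y := ZFSet.sep (fun x => ∃ ξ ∈ C, x = (ξ : Ordinal).toZFSet) κ.ord.toZFSet
  have hYmem : ∀ ξ : Set.Iio κ.ord, (ξ : Ordinal).toZFSet ∈ Y ↔ ξ ∈ C := by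
    intro ξ
    simp only [Y, ZFSet.mem_sep, Ordinal.toZFSet_mem_toZFSet_iff]
    constructor
    · rintro ⟨-, η, hη, he⟩
      rwa [Subtype.ext (Ordinal.toZFSet_injective he)]
    · exact fun hξ => ⟨ξ.2, ξ, hξ, rfl⟩
  obtain ⟨μ, hμ, hs⟩ := h.exists_strong_pair hA (Y := Y)
    (ZFSet.sep_subset.trans κ.ord.toZFSet_subset_vonNeumann)
  have hμ' : μ.ord < κ.ord := ord_lt_ord.2 hμ
  refine ⟨⟨μ.ord, hμ'⟩, fun γ hγ => ?_, ?_⟩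
  · obtain ⟨M, j, hj, hc, hle, hA', -⟩ := hs γ hγ
    exact ⟨M, j, hj, hc, hle, hA'⟩
  · obtain ⟨M₀, j₀, hj₀, hc₀, -⟩ := hs 0 h.1.pos
    -- Suppose `C` misses `[β, μ)` and choose `ξ ∈ C` above it, with a degree larger than `ξ`. By
    -- elementarity `j(Y)` misses `[β, j(μ))`, but agreement on `H` puts `ξ < j(μ)` into `j(Y)`.
    have hgap : ∀ β < μ.ord, ∃ ξ ∈ C, β ≤ (ξ : Ordinal) ∧ (ξ : Ordinal) < μ.ord := by
      by_contra! hcon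
      obtain ⟨β, hβ, hcon⟩ := hcon
      obtain ⟨ξ, hξ, hle⟩ := hC.isCofinal ⟨μ.ord, hμ'⟩
      have hle : μ.ord ≤ (ξ : Ordinal) := hle
      have hξν : (ξ : Ordinal) < (Order.succ (ξ : Ordinal).card).ord := lt_ord.2 (Order.lt_succ _)
      obtain ⟨M, j, hj, hc, hνj, -, hY⟩ := hs (Order.succ (ξ : Ordinal).card)
        (h.1.isSuccLimit.succ_lt (lt_ord.1 ξ.2))
      have key := (hj.transfer (fun _ v => ∀ x ∈ v 0, v 1 ⊆ x → x ∉ v 2)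
        (μ.ord.toZFSet ::ₛ β.toZFSet ::ₛ fun _ => Y)).1 (by
          intro x hx hβx
          obtain ⟨η, hη, rfl⟩ := Ordinal.mem_toZFSet_iff.1 hx
          change η.toZFSet ∉ Y
          intro hηY
          exact (hcon _ ((hYmem ⟨η, hη.trans hμ'⟩).1 hηY)
            (Ordinal.toZFSet_subset_toZFSet_iff.1 hβx)).not_gt hη)
      refine key (ξ : Ordinal).toZFSet (hνj (Ordinal.toZFSet_mem_toZFSet_iff.2 hξν)) ?_ ?_
      · change j β.toZFSet ⊆ _
        rw [hc.2 β hβ]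
        exact Ordinal.toZFSet_subset_toZFSet_iff.2 (hβ.le.trans hle)
      · have : (ξ : Ordinal).toZFSet ∈ (Y : Set ZFSet.{u}) ∩ H _ :=
          ⟨(hYmem ξ).2 hξ, toZFSet_mem_H hξν⟩
        rw [← hY] at this
        exact this.1
    refine hC.isLUB_mem (t := C ∩ Set.Iio ⟨μ.ord, hμ'⟩) Set.inter_subset_left ?_ ⟨?_, ?_⟩
    · obtain ⟨ξ, hξ, -, hlt⟩ := hgap 0 (Ordinal.omega0_pos.trans (hj₀.omega_lt_crit hc₀))
      exact ⟨ξ, hξ, hlt⟩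
    · exact fun ξ hξ => hξ.2.le
    · intro b hb
      by_contra! hlt
      obtain ⟨ξ, hξ, hle, hlt'⟩ := hgap _ (hj₀.succ_lt_crit hc₀ (ξ := b) hlt)
      exact (Order.succ_le_iff.1 hle).not_ge (hb ⟨hξ, hlt'⟩)

end coding

/-! ### Limit ultrapowers: collapse and the theorem of Łoś. -/

/-- A directed system of ultrafilters together with its limit ultrapower `W` of the universe:
`rep b F` is the class of the function `F` with respect to the ultrafilter `E b`. -/
structure UltraSystem (B W : Type (u + 1)) where
  /-- The ultrafilters of the system. -/
  E : B → Ultrafilter ZFSet.{u}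
  /-- The class of a function. -/
  rep : B → (ZFSet.{u} → ZFSet.{u}) → W
  /-- The membership relation of the ultrapower. -/
  r : W → W → Prop
  eq_iff : ∀ b F G, rep b F = rep b G ↔ ∀ᶠ t in E b, F t = G t
  mem_iff : ∀ b F G, r (rep b F) (rep b G) ↔ ∀ᶠ t in E b, F t ∈ G t
  surj : ∀ w, ∃ b F, rep b F = w
  directed : ∀ b c, ∃ e q s, (∀ F, rep b F = rep e (F ∘ q)) ∧ ∀ G, rep c G = rep e (G ∘ s)

namespace UltraSystem

variable {B W : Type (u + 1)} (S : UltraSystem.{u} B W)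

theorem exists_common (x y : W) : ∃ e F G, S.rep e F = x ∧ S.rep e G = y := by
  obtain ⟨b, F, rfl⟩ := S.surj x
  obtain ⟨c, G, rfl⟩ := S.surj y
  obtain ⟨e, q, s, hq, hs⟩ := S.directed b c
  exact ⟨e, _, _, (hq F).symm, (hs G).symm⟩

/-- Testing `hq` on a two-valued indicator function shows that `E b` is the image of `E e` under
`q`. -/
theorem eventually_iff {b e : B} {q : ZFSet.{u} → ZFSet.{u}}
    (hq : ∀ F, S.rep b F = S.rep e (F ∘ q)) (P : ZFSet.{u} → Prop) :
    (∀ᶠ t in S.E b, P t) ↔ ∀ᶠ t in S.E e, P (q t) := by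
  classical
  have h := S.eq_iff b (fun t => if P t then ∅ else {∅}) (fun _ => ∅)
  rw [hq, hq, S.eq_iff] at h
  have h0 : ∀ t, ((if P t then (∅ : ZFSet.{u}) else {∅}) = ∅) ↔ P t := by
    intro t
    split_ifs with hP
    · simp [hP]
    · simp [hP, empty_ne_singleton_empty.symm]
  simp only [Function.comp_apply, h0] at h
  exact h.symm

theorem rep_const (b c : B) (x : ZFSet.{u}) : S.rep b (fun _ => x) = S.rep c (fun _ => x) := by
  obtain ⟨e, q, s, hq, hs⟩ := S.directed b c
  rw [hq, hs]
  rfl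

/-- If two representatives differ almost everywhere, a function choosing elements of their symmetric
difference represents an object that distinguishes their classes. -/
theorem ext {x y : W} (h : ∀ z, S.r z x ↔ S.r z y) : x = y := by
  obtain ⟨e, F, G, rfl, rfl⟩ := S.exists_common x y
  rw [S.eq_iff]
  by_contra hne
  rw [← Ultrafilter.eventually_not] at hne
  have : ∀ t, ∃ w, F t ≠ G t → ¬ (w ∈ F t ↔ w ∈ G t) := by
    intro t
    by_cases ht : F t = G t
    · exact ⟨∅, fun h => (h ht).elim⟩
    · obtain ⟨w, hw⟩ := not_forall.1 (mt ZFSet.ext ht)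
      exact ⟨w, fun _ => hw⟩
  choose w hw using this
  have h1 := h (S.rep e w)
  rw [S.mem_iff, S.mem_iff] at h1
  have h2 : ∀ᶠ t in S.E e, ¬ (w t ∈ F t ↔ w t ∈ G t) := hne.mono fun t ht => hw t ht
  by_cases h3 : ∀ᶠ t in S.E e, w t ∈ F t
  · obtain ⟨t, ht⟩ := (h3.and ((h1.1 h3).and h2)).exists
    tauto
  · have h4 := mt h1.2 h3
    rw [← Ultrafilter.eventually_not] at h3 h4
    obtain ⟨t, ht⟩ := (h3.and (h4.and h2)).exists
    tauto

/-- An isomorphism of the ultrapower with a transitive class. -/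
structure IsCollapse (S : UltraSystem.{u} B W) (π : W → ZFSet.{u}) : Prop where
  injective : Function.Injective π
  mem_iff : ∀ x y, π x ∈ π y ↔ S.r x y
  transitive : IsTransitiveClass (Set.range π)

theorem exists_collapse (hwf : WellFounded S.r) (hsmall : ∀ x, Small.{u} {y // S.r y x}) :
    ∃ π, S.IsCollapse π := by
  let π : W → ZFSet.{u} := hwf.fix fun x ih =>
    ZFSet.range fun y : {y // S.r y x} => ih y.1 y.2
  have hπ : ∀ x, π x = ZFSet.range fun y : {y // S.r y x} => π y.1 := fun x => hwf.fix_eq _ x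
  have hmem : ∀ w x, w ∈ π x ↔ ∃ y, S.r y x ∧ π y = w := by
    intro w x
    rw [hπ, ZFSet.mem_range]
    simp
  have hinj : ∀ x y, π x = π y → x = y := by
    intro x
    induction x using hwf.induction with
    | _ x ih =>
      intro y hxy
      refine S.ext fun z => ⟨fun hz => ?_, fun hz => ?_⟩
      · have h1 := (hmem (π z) x).2 ⟨z, hz, rfl⟩
        rw [hxy, hmem] at h1
        obtain ⟨z', hz', he⟩ := h1
        exact ih z hz z' he.symm ▸ hz'
      · have h1 := (hmem (π z) y).2 ⟨z, hz, rfl⟩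
        rw [← hxy, hmem] at h1
        obtain ⟨z', hz', he⟩ := h1
        exact ih z' hz' z he ▸ hz'
  refine ⟨π, fun x y h => hinj x y h, fun x y => ?_, ?_⟩
  · rw [hmem]
    exact ⟨fun ⟨z, hz, he⟩ => hinj z x he ▸ hz, fun h => ⟨x, h, rfl⟩⟩
  · rintro _ ⟨x, rfl⟩ w hw
    obtain ⟨y, -, rfl⟩ := (hmem w x).1 hw
    exact ⟨y, rfl⟩

/-- A member with index `c` is represented, at an index common with `b`, by a function from a set on
which the ultrafilter concentrates into the union of the values of `F`. For each `c` these functions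
form a set. -/
theorem small_mem [Small.{u} B] (hT : ∀ b, ∃ T : ZFSet.{u}, ∀ᶠ t in S.E b, t ∈ T) (x : W) :
    Small.{u} {y // S.r y x} := by
  classical
  obtain ⟨b, F, rfl⟩ := S.surj x
  choose e q s hq hs using fun c => S.directed b c
  choose T hT using hT
  let V : B → ZFSet.{u} := fun c => insert ∅ (ZFSet.sUnion
    (ZFSet.range fun t : T (e c) => F (q c t)))
  let toW : (Σ c : B, (T (e c) → V c)) → W := fun p =>
    S.rep (e p.1) fun t => if h : t ∈ T (e p.1) then p.2 ⟨t, h⟩ else ∅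
  have hsub : {y | S.r y (S.rep b F)} ⊆ Set.range toW := by
    intro y hy
    obtain ⟨c, G, rfl⟩ := S.surj y
    have hy : S.r (S.rep c G) (S.rep b F) := hy
    rw [hq c F, hs c G, S.mem_iff] at hy
    let g : T (e c) → V c := fun t => if h : G (s c t) ∈ F (q c t) then ⟨G (s c t), by
      refine ZFSet.mem_insert_of_mem _ (ZFSet.mem_sUnion_of_mem h ?_)
      rw [ZFSet.mem_range]
      exact ⟨t, rfl⟩⟩ else ⟨∅, ZFSet.mem_insert _ _⟩
    refine ⟨⟨c, g⟩, ?_⟩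
    rw [hs c G, S.eq_iff]
    filter_upwards [hy, hT (e c)] with t ht htT
    have ht : G (s c t) ∈ F (q c t) := ht
    simp only [htT, dite_true, g, ht, Function.comp_apply]
  have : Small.{u} (Set.range toW) := small_range _
  exact small_subset hsub

variable {S} {π : W → ZFSet.{u}}

/-- The term of a variable is its value. -/
theorem exists_eq_var {α : Type*} {n : ℕ} (t : setLanguage.Term (α ⊕ Fin n)) :
    ∃ i, t = Language.Term.var i := by
  cases t with
  | var i => exact ⟨i, rfl⟩
  | func f ts => exact Empty.elim f

/-- The theorem of Łoś. -/
theorem realize_iff (hπ : S.IsCollapse π) {α : Type} {n : ℕ}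
    (φ : setLanguage.BoundedFormula α n) : ∀ (b : B) (F : α → ZFSet.{u} → ZFSet.{u})
    (G : Fin n → ZFSet.{u} → ZFSet.{u}),
    φ.Realize (M := Set.range π) (fun i => ⟨π (S.rep b (F i)), _, rfl⟩)
      (fun i => ⟨π (S.rep b (G i)), _, rfl⟩) ↔
    ∀ᶠ t in S.E b, φ.Realize (M := ZFSet.{u}) (fun i => F i t) (fun i => G i t) := by
  induction φ with
  | falsum =>
    intro b F G
    exact ⟨fun h => h.elim, fun h => (h.exists).elim fun _ h => h⟩
  | equal t₁ t₂ =>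
    intro b F G
    obtain ⟨i₁, rfl⟩ := exists_eq_var t₁
    obtain ⟨i₂, rfl⟩ := exists_eq_var t₂
    have key := fun F₁ F₂ => (hπ.injective.eq_iff (a := S.rep b F₁) (b := S.rep b F₂)).trans
      (S.eq_iff b F₁ F₂)
    simp only [Language.BoundedFormula.Realize, Language.Term.realize_var]
    rcases i₁ with i₁ | i₁ <;> rcases i₂ with i₂ | i₂ <;>
      exact Subtype.ext_iff.trans (key _ _)
  | rel R ts =>
    intro b F G
    cases R
    obtain ⟨i₁, h₁⟩ := exists_eq_var (ts 0)
    obtain ⟨i₂, h₂⟩ := exists_eq_var (ts 1)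
    have key := fun F₁ F₂ => (hπ.mem_iff (S.rep b F₁) (S.rep b F₂)).trans (S.mem_iff b F₁ F₂)
    simp only [Language.BoundedFormula.Realize, Language.Structure.RelMap, h₁, h₂,
      Language.Term.realize_var]
    rcases i₁ with i₁ | i₁ <;> rcases i₂ with i₂ | i₂ <;> exact key _ _
  | imp φ ψ ih₁ ih₂ =>
    intro b F G
    simp only [Language.BoundedFormula.realize_imp, ih₁, ih₂, Ultrafilter.eventually_imp]
  | @all n φ ih =>
    intro b F G
    have hsnoc : ∀ {X : Type (u + 1)} (k : (ZFSet.{u} → ZFSet.{u}) → X)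
        (G : Fin n → ZFSet.{u} → ZFSet.{u}) (g : ZFSet.{u} → ZFSet.{u}),
        (Fin.snoc (fun i => k (G i)) (k g) : Fin (n + 1) → X) =
          fun i => k ((Fin.snoc G g : Fin (n + 1) → ZFSet.{u} → ZFSet.{u}) i) := by
      intro X k G g
      funext i
      refine Fin.lastCases ?_ (fun i => ?_) i <;> simp
    simp only [Language.BoundedFormula.realize_all]
    constructor
    · intro h
      by_contra hne
      rw [← Ultrafilter.eventually_not] at hne
      -- Where the universal statement fails, a function of counterexamples is chosen; its class
      -- contradicts the statement in the ultrapower.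
      have : ∀ t, ∃ y, (¬ ∀ a, φ.Realize (fun i => F i t) (Fin.snoc (fun i => G i t) a)) →
          ¬ φ.Realize (fun i => F i t) (Fin.snoc (fun i => G i t) y) := by
        intro t
        by_cases ht : ∀ a, φ.Realize (fun i => F i t) (Fin.snoc (fun i => G i t) a)
        · exact ⟨∅, fun h => (h ht).elim⟩
        · obtain ⟨y, hy⟩ := not_forall.1 ht
          exact ⟨y, fun _ => hy⟩
      choose g hg using this
      have h1 := h ⟨π (S.rep b g), _, rfl⟩
      rw [hsnoc (fun F => (⟨π (S.rep b F), _, rfl⟩ : Set.range π)) G g, ih] at h1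
      obtain ⟨t, ht, ht'⟩ := (h1.and hne).exists
      refine hg t ht' ?_
      rwa [hsnoc (fun F => F t) G g]
    · rintro h ⟨_, w, rfl⟩
      obtain ⟨c, g, rfl⟩ := S.surj w
      -- An arbitrary element may have another index, so all parameters are moved to a common one.
      obtain ⟨e, q, s, hq, hs⟩ := S.directed b c
      simp only [hq, hs]
      rw [S.eventually_iff hq] at h
      rw [hsnoc (fun F => (⟨π (S.rep e F), _, rfl⟩ : Set.range π)) (fun i => G i ∘ q) (g ∘ s), ih]
      filter_upwards [h] with t ht
      have := ht (g (s t))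
      rwa [← hsnoc (fun F => F t) (fun i => G i ∘ q) (g ∘ s)]

/-- The canonical map of the universe into the collapse of the ultrapower is elementary. -/
theorem IsCollapse.isElementary (hπ : S.IsCollapse π) (b : B) :
    IsElementary (Set.range π) fun x => π (S.rep b fun _ => x) := by
  refine ⟨hπ.transitive, ⟨fun x => ⟨π (S.rep b fun _ => x), _, rfl⟩, fun n φ x => ?_⟩,
    fun x => rfl⟩
  have h := realize_iff hπ φ b (fun i _ => x i) (fun i _ => Fin.elim0 i)
  rw [Filter.eventually_const] at h
  rw [Language.Formula.Realize, Language.Formula.Realize]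
  convert h using 2
  rfl

end UltraSystem

/-! ### Positions in finite sets of ordinals, computed with set parameters. -/

section finite_sets

/-- The number of elements of a finite set, as a von Neumann ordinal. -/
noncomputable def size (t : ZFSet.{u}) : ZFSet.{u} :=
  (((t : Set ZFSet.{u}).ncard : ℕ) : Ordinal.{u}).toZFSet

theorem size_inj {s t : ZFSet.{u}} :
    size s = size t ↔ (s : Set ZFSet.{u}).ncard = (t : Set ZFSet.{u}).ncard := by
  rw [size, size, Ordinal.toZFSet_injective.eq_iff, Nat.cast_inj]

theorem card_eq_ncard {t : ZFSet.{u}} (ht : (t : Set ZFSet.{u}).Finite) :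
    t.card = ((t : Set ZFSet.{u}).ncard : ℕ) := by
  have h1 : Cardinal.lift.{u + 1} t.card = #(t : Set ZFSet.{u}) := ZFSet.cardinalMk_coe_sort.symm
  rw [← Cardinal.lift_inj.{u, u + 1}, h1, ← Set.cast_ncard ht, Cardinal.lift_natCast]

theorem card_eq_card_iff {s t : ZFSet.{u}} (hs : (s : Set ZFSet.{u}).Finite)
    (ht : (t : Set ZFSet.{u}).Finite) : s.card = t.card ↔ size s = size t := by
  rw [card_eq_ncard hs, card_eq_ncard ht, size_inj, Nat.cast_inj]

theorem mem_finSubsets {o : Ordinal.{u}} {s : ZFSet.{u}} :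
    s ∈ finSubsets o ↔ s ⊆ o.toZFSet ∧ (s : Set ZFSet.{u}).Finite := by
  simp [finSubsets]

theorem size_insert {s y : ZFSet.{u}} (hs : (s : Set ZFSet.{u}).Finite) (hy : y ∉ s) :
    size (insert y s) = insert (size s) (size s) := by
  rw [size, ZFSet.coe_insert, Set.ncard_insert_of_notMem (by simpa using hy) hs, Nat.cast_add_one,
    Ordinal.toZFSet_add_one]
  rfl

theorem size_inter_injOn {D : ZFSet.{u}} (hD : (D : Set ZFSet.{u}).Finite)
    (hord : ∀ x ∈ D, x.IsOrdinal) {x y : ZFSet.{u}} (hx : x ∈ D) (hy : y ∈ D)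
    (h : size (D ∩ x) = size (D ∩ y)) : x = y := by
  have key : ∀ x y, x ∈ D → y ∈ D → x ∈ y → size (D ∩ x) ≠ size (D ∩ y) := by
    intro x y hx hy hxy he
    rw [size_inj] at he
    refine (Set.ncard_lt_ncard ⟨?_, fun hsub => ?_⟩ (hD.subset (by simp))).ne he
    · intro z hz
      simp only [ZFSet.coe_inter, Set.mem_inter_iff, SetLike.mem_coe] at hz ⊢
      exact ⟨hz.1, (hord y hy).mem_trans hz.2 hxy⟩
    · have : x ∈ (↑(D ∩ x) : Set ZFSet.{u}) := hsub (by simp [hx, hxy])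
      exact ZFSet.mem_irrefl x (by simpa [hx] using this)
  rcases (hord x hx).mem_trichotomous (hord y hy) with hxy | hxy | hxy
  · exact (key x y hx hy hxy h).elim
  · exact hxy
  · exact (key y x hy hx hxy h.symm).elim

/-- The projection of `t` to the positions in `N`, computed with the cardinality function `C`. -/
noncomputable def select (C N t : ZFSet.{u}) : ZFSet.{u} :=
  ZFSet.sep (fun y => app C (t ∩ y) ∈ N) t

instance absFun_select {f g h : (ℕ → ZFSet.{u}) → ZFSet.{u}} [AbsFun f] [AbsFun g] [AbsFun h] :
    AbsFun fun v => select (f v) (g v) (h v) := by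
  unfold select; infer_instance

/-- The set of the positions in `D` of the elements of `A`. -/
noncomputable def positions (D A : ZFSet.{u}) : ZFSet.{u} :=
  ZFSet.range fun x : A => size (D ∩ x)

theorem mem_positions {D A z : ZFSet.{u}} : z ∈ positions D A ↔ ∃ x ∈ A, size (D ∩ x) = z := by
  simp [positions]

/-- Positions are natural numbers, so this set lies below the critical point and is fixed by `j`. -/
theorem rank_positions_le (D A : ZFSet.{u}) : (positions D A).rank ≤ Ordinal.omega0 := by
  refine ZFSet.rank_le_iff.2 fun y hy => ?_
  obtain ⟨x, -, rfl⟩ := mem_positions.1 hy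
  rw [size, Ordinal.rank_toZFSet]
  exact Ordinal.natCast_lt_omega0 _

/-- The cardinality function on the finite subsets of `μ`. -/
noncomputable def sizeGraph (μ : Ordinal.{u}) : ZFSet.{u} := graphOn size (finSubsets μ)

theorem inter_mem_finSubsets {μ : Ordinal.{u}} {t : ZFSet.{u}} (ht : t ∈ finSubsets μ)
    (y : ZFSet.{u}) : t ∩ y ∈ finSubsets μ := by
  rw [mem_finSubsets] at ht ⊢
  exact ⟨fun z hz => ht.1 (ZFSet.mem_inter.1 hz).1, ht.2.subset (by simp)⟩

/-- Cardinality is replaced by the set parameter `sizeGraph μ`, which makes the projection absolute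
and lets `j` act on it. -/
theorem proj_eq_select {μ : Ordinal.{u}} {D A t : ZFSet.{u}} (hD : (D : Set ZFSet.{u}).Finite)
    (ht : t ∈ finSubsets μ) : proj D A t = select (sizeGraph μ) (positions D A) t := by
  ext y
  simp only [proj, select, ZFSet.mem_sep, and_congr_right_iff]
  intro _
  rw [sizeGraph, app_graphOn (inter_mem_finSubsets ht y), mem_positions]
  refine exists_congr fun x => and_congr_right fun _ => ?_
  exact card_eq_card_iff (hD.subset (by simp)) (mem_finSubsets.1 (inter_mem_finSubsets ht y)).2

end finite_sets

/-! ### Ultrapowers by derived extenders. -/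

section derived

variable {M : Set ZFSet.{u}} {j : ZFSet.{u} → ZFSet.{u}} {μ lam : Ordinal.{u}}

/-- `D` arises from `∅` by finitely many insertions. The empty case and the single insertion step
are transferred, and the induction is carried out outside `M`. -/
theorem IsElementary.finite_mem_map (hj : IsElementary M j) (D : ZFSet.{u})
    (hD : D ⊆ j μ.toZFSet) (hfin : (D : Set ZFSet.{u}).Finite) :
    D ∈ j (finSubsets μ) ∧ app (j (sizeGraph μ)) D = size D := by
  have h0 : size (∅ : ZFSet.{u}) = ∅ := by simp [size]
  have hbase := (hj.transfer (fun _ v => ∅ ∈ v 0 ∧ app (v 1) ∅ = ∅)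
    (finSubsets μ ::ₛ fun _ => sizeGraph μ)).1
    ⟨empty_mem_finSubsets μ, (app_graphOn (empty_mem_finSubsets μ)).trans h0⟩
  have hstep := (hj.transfer (fun _ v => ∀ t ∈ v 0, ∀ y ∈ v 2, y ∉ t → insert y t ∈ v 0 ∧
      app (v 1) (insert y t) = insert (app (v 1) t) (app (v 1) t))
    (finSubsets μ ::ₛ sizeGraph μ ::ₛ fun _ => μ.toZFSet)).1 (by
      intro t ht y hy hyt
      change t ∈ finSubsets μ at ht
      change y ∈ μ.toZFSet at hy
      change insert y t ∈ finSubsets μ ∧ app (sizeGraph μ) (insert y t) =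
        insert (app (sizeGraph μ) t) (app (sizeGraph μ) t)
      have hins : insert y t ∈ finSubsets μ := by
        rw [mem_finSubsets] at ht ⊢
        refine ⟨fun z hz => ?_, by rw [ZFSet.coe_insert]; exact ht.2.insert y⟩
        rcases ZFSet.mem_insert_iff.1 hz with rfl | hz
        exacts [hy, ht.1 hz]
      refine ⟨hins, ?_⟩
      rw [sizeGraph, app_graphOn hins, app_graphOn ht, size_insert (mem_finSubsets.1 ht).2 hyt])
  induction hn : (D : Set ZFSet.{u}).ncard generalizing D with
  | zero =>
    rw [Set.ncard_eq_zero hfin] at hn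
    obtain rfl : D = ∅ := SetLike.coe_injective (by simpa using hn)
    rw [h0]
    exact hbase
  | succ n ih =>
    obtain ⟨y, hy⟩ : (D : Set ZFSet.{u}).Nonempty := by
      rw [← Set.ncard_pos hfin, hn]
      exact Nat.succ_pos n
    have hy : y ∈ D := hy
    have hins : insert y (D \ {y}) = D := by
      ext z
      simp only [ZFSet.mem_insert_iff, ZFSet.mem_sdiff, ZFSet.mem_singleton]
      constructor
      · rintro (rfl | h)
        exacts [hy, h.1]
      · intro hz
        tauto
    have hfin' : (↑(D \ {y}) : Set ZFSet.{u}).Finite := hfin.subset (by simp)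
    have hnot : y ∉ D \ {y} := by simp
    obtain ⟨h1, h2⟩ := ih (D \ {y}) (fun z hz => hD (ZFSet.mem_sdiff.1 hz).1) hfin' (by
      have h3 : (D : Set ZFSet.{u}).ncard = (↑(D \ {y}) : Set ZFSet.{u}).ncard + 1 := by
        rw [← Set.ncard_insert_of_notMem (a := y) (by simp) hfin', ← ZFSet.coe_insert, hins]
      omega)
    have := hstep _ h1 y (hD hy) hnot
    rw [hins] at this
    refine ⟨this.1, this.2.trans ?_⟩
    conv_rhs => rw [← hins]
    rw [size_insert hfin' hnot, ← h2]
    rfl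

theorem IsElementary.map_size (hj : IsElementary M j) (D : ZFSet.{u}) : j (size D) = size D :=
  hj.map_nat _

theorem IsElementary.mem_map_finSubsetsLike (hj : IsElementary M j) {D : ZFSet.{u}}
    (hD : D ⊆ j μ.toZFSet) (hfin : (D : Set ZFSet.{u}).Finite) : D ∈ j (finSubsetsLike μ D) := by
  have h : finSubsetsLike μ D =
      ZFSet.sep (fun s => app (sizeGraph μ) s = size D) (finSubsets μ) := by
    ext s
    simp only [finSubsetsLike, ZFSet.mem_sep, and_congr_right_iff]
    intro hs
    rw [sizeGraph, app_graphOn hs, card_eq_card_iff (mem_finSubsets.1 hs).2 hfin]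
  have h' : j (ZFSet.sep (fun s => app (sizeGraph μ) s = size D) (finSubsets μ)) =
      ZFSet.sep (fun s => app (j (sizeGraph μ)) s = j (size D)) (j (finSubsets μ)) :=
    hj.map_absFun (fun v => ZFSet.sep (fun s => app (v 0) s = v 1) (v 2))
      (sizeGraph μ ::ₛ size D ::ₛ fun _ => finSubsets μ)
  rw [h, h']
  have := hj.finite_mem_map D hD hfin
  exact ZFSet.mem_sep.2 ⟨this.1, this.2.trans (hj.map_size D).symm⟩

theorem IsElementary.select_map (hj : IsElementary M j) {D A : ZFSet.{u}}
    (hD : D ⊆ j μ.toZFSet) (hfin : (D : Set ZFSet.{u}).Finite) (hA : A ⊆ D) :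
    select (j (sizeGraph μ)) (positions D A) D = A := by
  have hord : ∀ x ∈ D, x.IsOrdinal := by
    intro x hx
    have := hD hx
    rw [hj.map_ord] at this
    exact (ZFSet.isOrdinal_toZFSet _).mem this
  ext y
  simp only [select, ZFSet.mem_sep, mem_positions]
  constructor
  · rintro ⟨hy, x, hx, he⟩
    rw [(hj.finite_mem_map (D ∩ y) (fun z hz => hD (ZFSet.mem_inter.1 hz).1)
      (hfin.subset (by simp))).2] at he
    rwa [← size_inter_injOn hfin hord (hA hx) hy he]
  · intro hy
    refine ⟨hA hy, y, hy, ?_⟩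
    rw [(hj.finite_mem_map (D ∩ y) (fun z hz => hD (ZFSet.mem_inter.1 hz).1)
      (hfin.subset (by simp))).2]

/-- The factor map from the ultrapower by the derived extender into the target model. -/
noncomputable def factor (j : ZFSet.{u} → ZFSet.{u}) (μ : Ordinal.{u}) {lam : Ordinal.{u}}
    (a : UltRep lam) : ZFSet.{u} :=
  app (j (graphOn a.2 (finSubsets μ))) a.1.1

theorem inMeasure_derived {D X : ZFSet.{u}} :
    InMeasure (derivedExtender j μ lam) D X ↔
      D ∈ finSubsets lam ∧ X ⊆ finSubsets μ ∧ D ∈ j X := by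
  simp only [InMeasure, derivedExtender, ZFSet.mem_sep, ZFSet.pair_mem_prod]
  constructor
  · rintro ⟨U, ⟨⟨hD, -⟩, A, he⟩, hX⟩
    obtain ⟨rfl, rfl⟩ := ZFSet.pair_injective he
    simp only [derivedMeasure, ZFSet.mem_sep, ZFSet.mem_powerset] at hX
    exact ⟨hD, hX⟩
  · rintro ⟨hD, hX⟩
    refine ⟨derivedMeasure j μ D, ⟨⟨hD, ?_⟩, D, rfl⟩, ?_⟩
    · exact ZFSet.mem_powerset.2 ZFSet.sep_subset
    · simpa [derivedMeasure] using hX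

theorem union_mem_finSubsets {A B : ZFSet.{u}} (hA : A ∈ finSubsets lam)
    (hB : B ∈ finSubsets lam) : A ∪ B ∈ finSubsets lam := by
  rw [mem_finSubsets] at *
  refine ⟨fun z hz => ?_, by rw [ZFSet.coe_union]; exact hA.2.union hB.2⟩
  rcases ZFSet.mem_union.1 hz with hz | hz
  exacts [hA.1 hz, hB.1 hz]

/-- Membership of `D` in the `j`-image of the set of good `t` is the relation evaluated at `t = D`.
There the projections to the positions of the two supports return the supports themselves, which
gives the values of the factor map. -/
theorem IsElementary.measure_iff (hj : IsElementary M j) (hc : IsCrit j μ)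
    (hlam : lam.toZFSet ⊆ j μ.toZFSet) (a b : UltRep lam) (R : ZFSet.{u} → ZFSet.{u} → Prop)
    [hR : Expressible fun _ v => ∀ t ∈ v 0, (t ∈ v 1 ↔
      R (app (v 2) (select (v 6) (v 4) t)) (app (v 3) (select (v 6) (v 5) t)))] :
    InMeasure (derivedExtender j μ lam) (a.1.1 ∪ b.1.1)
      (ZFSet.sep (fun t => R (a.2 (proj (a.1.1 ∪ b.1.1) a.1.1 t))
        (b.2 (proj (a.1.1 ∪ b.1.1) b.1.1 t))) (finSubsetsLike μ (a.1.1 ∪ b.1.1))) ↔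
    R (factor j μ a) (factor j μ b) := by
  obtain ⟨⟨A, hA⟩, f⟩ := a
  obtain ⟨⟨B, hB⟩, g⟩ := b
  dsimp only [factor]
  set D := A ∪ B with hDdef
  have hDmem : D ∈ finSubsets lam := union_mem_finSubsets hA hB
  have hDj : D ⊆ j μ.toZFSet := (mem_finSubsets.1 hDmem).1.trans hlam
  have hfin := (mem_finSubsets.1 hDmem).2
  set X := ZFSet.sep (fun t => R (f (proj D A t)) (g (proj D B t))) (finSubsetsLike μ D) with hX
  have hXT : X ⊆ finSubsets μ := ZFSet.sep_subset.trans ZFSet.sep_subset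
  have hsel : ∀ N, ∀ t ∈ finSubsets μ, select (sizeGraph μ) N t ∈ finSubsets μ := by
    intro N t ht
    rw [mem_finSubsets] at ht ⊢
    exact ⟨fun z hz => ht.1 (ZFSet.sep_subset hz), ht.2.subset (fun z hz => ZFSet.sep_subset hz)⟩
  have key := (hj.transfer (fun _ v => ∀ t ∈ v 0, (t ∈ v 1 ↔
      R (app (v 2) (select (v 6) (v 4) t)) (app (v 3) (select (v 6) (v 5) t))))
    (finSubsetsLike μ D ::ₛ X ::ₛ graphOn f (finSubsets μ) ::ₛ graphOn g (finSubsets μ) ::ₛ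
      positions D A ::ₛ positions D B ::ₛ fun _ => sizeGraph μ)).1 (by
    intro t ht
    change t ∈ finSubsetsLike μ D at ht
    change t ∈ X ↔ R (app (graphOn f (finSubsets μ)) (select (sizeGraph μ) (positions D A) t))
      (app (graphOn g (finSubsets μ)) (select (sizeGraph μ) (positions D B) t))
    have htT := ZFSet.sep_subset ht
    rw [app_graphOn (hsel _ t htT), app_graphOn (hsel _ t htT), ← proj_eq_select hfin htT,
      ← proj_eq_select hfin htT, hX, ZFSet.mem_sep]
    exact and_iff_right ht)
  have key := key D (hj.mem_map_finSubsetsLike hDj hfin)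
  change D ∈ j X ↔ R (app (j (graphOn f (finSubsets μ)))
      (select (j (sizeGraph μ)) (j (positions D A)) D)) (app (j (graphOn g (finSubsets μ)))
      (select (j (sizeGraph μ)) (j (positions D B)) D)) at key
  have hpos : ∀ A, j (positions D A) = positions D A := fun A =>
    hj.map_eq_of_rank_lt hc _ ((rank_positions_le D A).trans_lt (hj.omega_lt_crit hc))
  rw [hpos, hpos, hj.select_map hDj hfin (fun z hz => by simp [hDdef, hz]),
    hj.select_map hDj hfin (fun z hz => by simp [hDdef, hz])] at key
  rw [inMeasure_derived, ← key]
  exact ⟨fun h => h.2.2, fun h => ⟨hDmem, hXT, h⟩⟩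

theorem IsElementary.ultEq_iff (hj : IsElementary M j) (hc : IsCrit j μ)
    (hlam : lam.toZFSet ⊆ j μ.toZFSet) (a b : UltRep lam) :
    UltEq (derivedExtender j μ lam) μ a b ↔ factor j μ a = factor j μ b :=
  hj.measure_iff hc hlam a b (· = ·)

theorem IsElementary.ultMem_iff (hj : IsElementary M j) (hc : IsCrit j μ)
    (hlam : lam.toZFSet ⊆ j μ.toZFSet) (a b : UltRep lam) :
    UltMem (derivedExtender j μ lam) μ a b ↔ factor j μ a ∈ factor j μ b :=
  hj.measure_iff hc hlam a b (· ∈ ·)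

theorem IsElementary.mk_eq_iff (hj : IsElementary M j) (hc : IsCrit j μ)
    (hlam : lam.toZFSet ⊆ j μ.toZFSet) (a b : UltRep lam) :
    (Quot.mk _ a : Ult (derivedExtender j μ lam) μ lam) = Quot.mk _ b ↔
      factor j μ a = factor j μ b := by
  rw [Quot.eq, Equivalence.eqvGen_iff, hj.ultEq_iff hc hlam]
  refine ⟨fun a => ?_, fun {a b} h => ?_, fun {a b c} h h' => ?_⟩
  · rw [hj.ultEq_iff hc hlam]
  · rw [hj.ultEq_iff hc hlam] at *
    exact h.symm
  · rw [hj.ultEq_iff hc hlam] at *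
    exact h.trans h'

theorem IsElementary.ult_mem_mk_iff (hj : IsElementary M j) (hc : IsCrit j μ)
    (hlam : lam.toZFSet ⊆ j μ.toZFSet) (a b : UltRep lam) :
    Ult.Mem (Quot.mk _ a : Ult (derivedExtender j μ lam) μ lam) (Quot.mk _ b) ↔
      factor j μ a ∈ factor j μ b := by
  constructor
  · rintro ⟨a', b', ha, hb, h⟩
    rw [hj.mk_eq_iff hc hlam] at ha hb
    rw [← ha, ← hb]
    exact (hj.ultMem_iff hc hlam _ _).1 h
  · exact fun h => ⟨a, b, rfl, rfl, (hj.ultMem_iff hc hlam _ _).2 h⟩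

/-- The ultrafilter on `T` generated by a point of `j T`. -/
noncomputable def IsElementary.ultrafilter (hj : IsElementary M j) (T : ZFSet.{u}) (a : ZFSet.{u})
    (ha : a ∈ j T) : Ultrafilter ZFSet.{u} :=
  Ultrafilter.ofComplNotMemIff
    { sets := {S | a ∈ j (ZFSet.sep (· ∈ S) T)}
      univ_sets := by
        have : ZFSet.sep (· ∈ Set.univ) T = T := by ext; simp
        change a ∈ j (ZFSet.sep (· ∈ Set.univ) T)
        rwa [this]
      sets_of_superset := fun {S S'} hS hsub => by
        have : ZFSet.sep (· ∈ S) T ⊆ ZFSet.sep (· ∈ S') T := fun z hz => by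
          rw [ZFSet.mem_sep] at *
          exact ⟨hz.1, hsub hz.2⟩
        exact hj.subset_iff.2 this hS
      inter_sets := fun {S S'} hS hS' => by
        have : ZFSet.sep (· ∈ S ∩ S') T = ZFSet.sep (· ∈ S) T ∩ ZFSet.sep (· ∈ S') T := by
          ext; simp; tauto
        simp only [Set.mem_ofPred_eq] at *
        rw [this, hj.map_inter]
        exact ZFSet.mem_inter.2 ⟨hS, hS'⟩ } (by
    intro S
    have : ZFSet.sep (· ∈ Sᶜ) T = T \ ZFSet.sep (· ∈ S) T := by ext; simp; tauto
    change a ∉ j (ZFSet.sep (· ∈ Sᶜ) T) ↔ a ∈ j (ZFSet.sep (· ∈ S) T)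
    have h' : j (T \ ZFSet.sep (· ∈ S) T) = j T \ j (ZFSet.sep (· ∈ S) T) :=
      hj.map_absFun (fun v => v 0 \ v 1) (T ::ₛ fun _ => ZFSet.sep (· ∈ S) T)
    rw [this, h', ZFSet.mem_sdiff]
    tauto)

theorem IsElementary.eventually_ultrafilter (hj : IsElementary M j) {T a : ZFSet.{u}}
    (ha : a ∈ j T) (P : ZFSet.{u} → Prop) :
    (∀ᶠ t in hj.ultrafilter T a ha, P t) ↔ a ∈ j (ZFSet.sep P T) :=
  Iff.rfl

/-- Enlarging the support and composing with the projection does not change the class; this is the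
directedness of the system. -/
theorem IsElementary.factor_comp (hj : IsElementary M j) (hc : IsCrit j μ)
    (hlam : lam.toZFSet ⊆ j μ.toZFSet) {A D : ZFSet.{u}} (hA : A ∈ finSubsets lam)
    (hD : D ∈ finSubsets lam) (hAD : A ⊆ D) (F : ZFSet.{u} → ZFSet.{u}) :
    factor j μ (⟨⟨A, hA⟩, F⟩ : UltRep lam) = factor j μ ⟨⟨D, hD⟩, F ∘ proj D A⟩ := by
  have hDj : D ⊆ j μ.toZFSet := (mem_finSubsets.1 hD).1.trans hlam
  have hfin := (mem_finSubsets.1 hD).2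
  have key := (hj.transfer (fun _ v => ∀ t ∈ v 0, app (v 1) t = app (v 2) (select (v 3) (v 4) t))
    (finSubsets μ ::ₛ graphOn (F ∘ proj D A) (finSubsets μ) ::ₛ graphOn F (finSubsets μ) ::ₛ
      sizeGraph μ ::ₛ fun _ => positions D A)).1 (by
    intro t ht
    change t ∈ finSubsets μ at ht
    change app (graphOn (F ∘ proj D A) (finSubsets μ)) t =
      app (graphOn F (finSubsets μ)) (select (sizeGraph μ) (positions D A) t)
    rw [app_graphOn ht, ← proj_eq_select hfin ht, app_graphOn]
    · rfl
    · rw [mem_finSubsets] at ht ⊢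
      exact ⟨fun z hz => ht.1 (ZFSet.sep_subset hz),
        ht.2.subset (fun z hz => ZFSet.sep_subset hz)⟩)
  have key := key D (hj.finite_mem_map D hDj hfin).1
  change app (j (graphOn (F ∘ proj D A) (finSubsets μ))) D = app (j (graphOn F (finSubsets μ)))
    (select (j (sizeGraph μ)) (j (positions D A)) D) at key
  rw [hj.map_eq_of_rank_lt hc _ ((rank_positions_le D A).trans_lt (hj.omega_lt_crit hc)),
    hj.select_map hDj hfin hAD] at key
  exact key.symm

/-- The ultrapower by a derived extender, as the limit ultrapower by its measures. -/
noncomputable def IsElementary.derivedSystem (hj : IsElementary M j) (hc : IsCrit j μ)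
    (hlam : lam.toZFSet ⊆ j μ.toZFSet) :
    UltraSystem.{u} {A : ZFSet.{u} // A ∈ finSubsets lam} (Ult (derivedExtender j μ lam) μ lam) where
  E A := hj.ultrafilter (finSubsets μ) A.1
    (hj.finite_mem_map A.1 ((mem_finSubsets.1 A.2).1.trans hlam) (mem_finSubsets.1 A.2).2).1
  rep A F := Quot.mk _ (A, F)
  r := Ult.Mem
  eq_iff A F G := by
    have hA := (hj.finite_mem_map A.1 ((mem_finSubsets.1 A.2).1.trans hlam)
      (mem_finSubsets.1 A.2).2).1
    refine (hj.mk_eq_iff hc hlam _ _).trans (Iff.trans ?_ (hj.eventually_ultrafilter hA _).symm)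
    refine ((hj.transfer (fun _ v => ∀ t ∈ v 0, (t ∈ v 1 ↔ app (v 2) t = app (v 3) t))
      (finSubsets μ ::ₛ ZFSet.sep (fun t => F t = G t) (finSubsets μ) ::ₛ
        graphOn F (finSubsets μ) ::ₛ fun _ => graphOn G (finSubsets μ))).1 ?_ A.1 hA).symm
    intro t ht
    change t ∈ finSubsets μ at ht
    change t ∈ ZFSet.sep (fun t => F t = G t) (finSubsets μ) ↔
      app (graphOn F (finSubsets μ)) t = app (graphOn G (finSubsets μ)) t
    rw [app_graphOn ht, app_graphOn ht, ZFSet.mem_sep, and_iff_right ht]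
  mem_iff A F G := by
    have hA := (hj.finite_mem_map A.1 ((mem_finSubsets.1 A.2).1.trans hlam)
      (mem_finSubsets.1 A.2).2).1
    refine (hj.ult_mem_mk_iff hc hlam _ _).trans
      (Iff.trans ?_ (hj.eventually_ultrafilter hA _).symm)
    refine ((hj.transfer (fun _ v => ∀ t ∈ v 0, (t ∈ v 1 ↔ app (v 2) t ∈ app (v 3) t))
      (finSubsets μ ::ₛ ZFSet.sep (fun t => F t ∈ G t) (finSubsets μ) ::ₛ
        graphOn F (finSubsets μ) ::ₛ fun _ => graphOn G (finSubsets μ))).1 ?_ A.1 hA).symm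
    intro t ht
    change t ∈ finSubsets μ at ht
    change t ∈ ZFSet.sep (fun t => F t ∈ G t) (finSubsets μ) ↔
      app (graphOn F (finSubsets μ)) t ∈ app (graphOn G (finSubsets μ)) t
    rw [app_graphOn ht, app_graphOn ht, ZFSet.mem_sep, and_iff_right ht]
  surj w := by
    obtain ⟨⟨A, F⟩, rfl⟩ := Quot.exists_rep w
    exact ⟨A, F, rfl⟩
  directed A B := by
    refine ⟨⟨A.1 ∪ B.1, union_mem_finSubsets A.2 B.2⟩, proj (A.1 ∪ B.1) A.1, proj (A.1 ∪ B.1) B.1,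
      fun F => ?_, fun G => ?_⟩
    · exact (hj.mk_eq_iff hc hlam _ _).2
        (hj.factor_comp hc hlam A.2 _ (fun z hz => by simp [hz]) F)
    · exact (hj.mk_eq_iff hc hlam _ _).2
        (hj.factor_comp hc hlam B.2 _ (fun z hz => by simp [hz]) G)

/-- Extender points are embedding points. -/
theorem IsExtenderPoint.isEmbeddingPoint {κ : Cardinal.{u}} {f : ZFSet.{u}} {α : Ordinal.{u}}
    (h : IsExtenderPoint κ f α) : IsEmbeddingPoint f α := by
  obtain ⟨hcl, E, μ, lam, -, ⟨M, j, hj, hc, hle, hlam, rfl⟩, π, hπ, hcrit, η, hη, -, hV⟩ := h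
  have hπ' : (hj.derivedSystem hc hlam).IsCollapse π := ⟨hπ.1, hπ.2, hπ.3⟩
  exact ⟨hcl, _, _, hπ'.isElementary ⟨∅, empty_mem_finSubsets lam⟩, hcrit, η, hη, hV⟩

end derived

/-! ### The factor map and its range. -/

section factor_map

variable {M : Set ZFSet.{u}} {j : ZFSet.{u} → ZFSet.{u}} {μ lam : Ordinal.{u}}

/-- The factor map on the ultrapower by a derived extender. -/
noncomputable def IsElementary.factorMap (hj : IsElementary M j) (hc : IsCrit j μ)
    (hlam : lam.toZFSet ⊆ j μ.toZFSet) (w : Ult (derivedExtender j μ lam) μ lam) : ZFSet.{u} :=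
  Quot.lift (factor j μ) (fun _ _ h => (hj.ultEq_iff hc hlam _ _).1 h) w

variable (hj : IsElementary M j) (hc : IsCrit j μ) (hlam : lam.toZFSet ⊆ j μ.toZFSet)
include hj hc hlam

theorem IsElementary.factorMap_injective : Function.Injective (hj.factorMap hc hlam) := by
  intro x y h
  obtain ⟨a, rfl⟩ := Quot.exists_rep x
  obtain ⟨b, rfl⟩ := Quot.exists_rep y
  exact (hj.mk_eq_iff hc hlam a b).2 h

theorem IsElementary.factorMap_mem_iff (x y : Ult (derivedExtender j μ lam) μ lam) :
    hj.factorMap hc hlam x ∈ hj.factorMap hc hlam y ↔ Ult.Mem x y := by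
  obtain ⟨a, rfl⟩ := Quot.exists_rep x
  obtain ⟨b, rfl⟩ := Quot.exists_rep y
  exact (hj.ult_mem_mk_iff hc hlam a b).symm

/-- The factor map embeds the ultrapower into the true membership relation, which makes it
well-founded and set-like. -/
theorem IsElementary.exists_isCollapse :
    ∃ π : Ult (derivedExtender j μ lam) μ lam → ZFSet.{u}, IsCollapse π := by
  obtain ⟨π, hπ⟩ := (hj.derivedSystem hc hlam).exists_collapse
    (Subrelation.wf (fun {x y} h => (hj.factorMap_mem_iff hc hlam x y).2 h)
      (InvImage.wf (hj.factorMap hc hlam) ZFSet.mem_wf))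
    (fun x => small_of_injective (β := ↥(hj.factorMap hc hlam x))
      (f := fun y => ⟨hj.factorMap hc hlam y.1, (hj.factorMap_mem_iff hc hlam y.1 x).2 y.2⟩)
      fun y z h => Subtype.ext (hj.factorMap_injective hc hlam (congrArg Subtype.val h)))
  exact ⟨π, hπ.1, hπ.2, hπ.3⟩

/-- On a set that lies hereditarily in the range, the inverse of the factor map followed by the
collapse is the identity, by `∈`-induction. -/
theorem IsElementary.collapse_eq {π : Ult (derivedExtender j μ lam) μ lam → ZFSet.{u}}
    (hπ : IsCollapse π) {x : ZFSet.{u}}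
    (hx : x.Hereditarily (· ∈ Set.range (hj.factorMap hc hlam))) :
    ∃ w, hj.factorMap hc hlam w = x ∧ π w = x := by
  induction x using ZFSet.inductionOn with
  | h x ih =>
    obtain ⟨w, rfl⟩ := hx.self
    refine ⟨w, rfl, ?_⟩
    ext z
    constructor
    · intro hz
      obtain ⟨w', rfl⟩ := hπ.transitive _ ⟨w, rfl⟩ z hz
      have hmem := (hj.factorMap_mem_iff hc hlam _ _).2 ((hπ.mem_iff _ _).1 hz)
      obtain ⟨w'', h1, h2⟩ := ih _ hmem (hx.mem hmem)
      rwa [← hj.factorMap_injective hc hlam h1, h2]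
    · intro hz
      obtain ⟨w', rfl, h2⟩ := ih _ hz (hx.mem hz)
      rw [← h2]
      exact (hπ.mem_iff _ _).2 ((hj.factorMap_mem_iff hc hlam _ _).1 hz)

omit hc in
theorem IsElementary.factor_absFun (f : (ℕ → ZFSet.{u}) → ZFSet.{u}) [hf : AbsFun f]
    {A : ZFSet.{u}} (hA : A ∈ finSubsets lam) (p : ZFSet.{u}) :
    factor j μ (⟨⟨A, hA⟩, fun t => f (t ::ₛ fun _ => p)⟩ : UltRep lam) =
      f (A ::ₛ fun _ => j p) := by
  -- The parameter is variable `2` in the formula and becomes variable `3` under the bounded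
  -- quantifier over `t`.
  have hf' : AbsFun fun v => f (v 0 ::ₛ fun _ => v 3) := by
    have h := hf.reindex fun n => n.casesOn 0 fun _ => 3
    have he : ∀ v : ℕ → ZFSet.{u}, (fun n => v (n.casesOn 0 fun _ => 3)) =
        (v 0 ::ₛ fun _ => v 3) := fun v => funext fun n => by cases n <;> rfl
    simp only [he] at h
    exact h
  have hex : Expressible fun _ v => ∀ t ∈ v 0, app (v 1) t = f (t ::ₛ fun _ => v 2) :=
    @expressible_ball (fun v => v 0) (fun _ v t => app (v 1) t = f (t ::ₛ fun _ => v 2)) _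
      (expressible_eq (f := fun v => app (v 2) (v 0)) (g := fun v => f (v 0 ::ₛ fun _ => v 3)))
  refine (hj.transfer (fun _ v => ∀ t ∈ v 0, app (v 1) t = f (t ::ₛ fun _ => v 2)) (hP := hex)
    (finSubsets μ ::ₛ graphOn (fun t => f (t ::ₛ fun _ => p)) (finSubsets μ) ::ₛ fun _ => p)).1
    (fun t ht => ?_) A ?_
  · change t ∈ finSubsets μ at ht
    change app (graphOn (fun t => f (t ::ₛ fun _ => p)) (finSubsets μ)) t = f (t ::ₛ fun _ => p)
    rw [app_graphOn ht]
  · exact (hj.finite_mem_map A ((mem_finSubsets.1 hA).1.trans hlam) (mem_finSubsets.1 hA).2).1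

theorem IsElementary.factorMap_const (Y : ZFSet.{u}) :
    hj.factorMap hc hlam (Ult.const _ μ lam Y) = j Y :=
  hj.factor_absFun hlam (fun v => v 1) (empty_mem_finSubsets lam) Y

omit hj hc hlam in
theorem singleton_mem_finSubsets {ξ : Ordinal.{u}} (hξ : ξ < lam) :
    ({ξ.toZFSet} : ZFSet.{u}) ∈ finSubsets lam := by
  rw [mem_finSubsets]
  refine ⟨fun z hz => ?_, by simp⟩
  rw [ZFSet.mem_singleton] at hz
  rw [hz, Ordinal.toZFSet_mem_toZFSet_iff]
  exact hξ

theorem IsElementary.ord_mem_range_factorMap {ξ : Ordinal.{u}} (hξ : ξ < lam) :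
    ξ.toZFSet ∈ Set.range (hj.factorMap hc hlam) := by
  refine ⟨Quot.mk _ (⟨_, singleton_mem_finSubsets hξ⟩, fun t => ZFSet.sUnion t), ?_⟩
  refine (hj.factor_absFun hlam (fun v => ZFSet.sUnion (v 0)) (singleton_mem_finSubsets hξ)
    ∅).trans ?_
  exact ZFSet.sUnion_singleton

/-- With support `{ξ}`, the function `t ↦ Y(⋃ t)` represents `j(Y)(ξ)`. This is how sets enumerated
by `Y` enter the range. -/
theorem IsElementary.app_mem_range_factorMap {ξ : Ordinal.{u}} (hξ : ξ < lam) (Y : ZFSet.{u}) :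
    app (j Y) ξ.toZFSet ∈ Set.range (hj.factorMap hc hlam) := by
  refine ⟨Quot.mk _ (⟨_, singleton_mem_finSubsets hξ⟩, fun t => app Y (ZFSet.sUnion t)), ?_⟩
  refine (hj.factor_absFun hlam (fun v => app (v 1) (ZFSet.sUnion (v 0)))
    (singleton_mem_finSubsets hξ) Y).trans ?_
  change app (j Y) (ZFSet.sUnion {ξ.toZFSet}) = _
  rw [ZFSet.sUnion_singleton]

theorem IsElementary.upair_mem_range_factorMap {x y : ZFSet.{u}}
    (hx : x ∈ Set.range (hj.factorMap hc hlam)) (hy : y ∈ Set.range (hj.factorMap hc hlam)) :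
    ({x, y} : ZFSet.{u}) ∈ Set.range (hj.factorMap hc hlam) := by
  obtain ⟨w, rfl⟩ := hx
  obtain ⟨w', rfl⟩ := hy
  obtain ⟨A, F, G, rfl, rfl⟩ := (hj.derivedSystem hc hlam).exists_common w w'
  refine ⟨Quot.mk _ (A, fun t => {F t, G t}), ?_⟩
  refine (hj.transfer (fun _ v => ∀ t ∈ v 0, app (v 1) t = {app (v 2) t, app (v 3) t})
    (finSubsets μ ::ₛ graphOn (fun t => {F t, G t}) (finSubsets μ) ::ₛ
      graphOn F (finSubsets μ) ::ₛ fun _ => graphOn G (finSubsets μ))).1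
    (fun t ht => ?_) A.1 ?_
  · change t ∈ finSubsets μ at ht
    change app (graphOn (fun t => {F t, G t}) (finSubsets μ)) t =
      {app (graphOn F (finSubsets μ)) t, app (graphOn G (finSubsets μ)) t}
    rw [app_graphOn ht, app_graphOn ht, app_graphOn ht]
  · exact (hj.finite_mem_map A.1 ((mem_finSubsets.1 A.2).1.trans hlam)
      (mem_finSubsets.1 A.2).2).1

theorem IsElementary.hereditarily_upair {x y : ZFSet.{u}}
    (hx : x.Hereditarily (· ∈ Set.range (hj.factorMap hc hlam)))
    (hy : y.Hereditarily (· ∈ Set.range (hj.factorMap hc hlam))) :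
    ({x, y} : ZFSet.{u}).Hereditarily (· ∈ Set.range (hj.factorMap hc hlam)) := by
  rw [ZFSet.hereditarily_iff]
  refine ⟨hj.upair_mem_range_factorMap hc hlam hx.self hy.self, fun z hz => ?_⟩
  rcases ZFSet.mem_pair.1 hz with rfl | rfl
  exacts [hx, hy]

theorem IsElementary.hereditarily_pair {x y : ZFSet.{u}}
    (hx : x.Hereditarily (· ∈ Set.range (hj.factorMap hc hlam)))
    (hy : y.Hereditarily (· ∈ Set.range (hj.factorMap hc hlam))) :
    (ZFSet.pair x y).Hereditarily (· ∈ Set.range (hj.factorMap hc hlam)) := by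
  refine hj.hereditarily_upair hc hlam ?_ (hj.hereditarily_upair hc hlam hx hy)
  simpa using hj.hereditarily_upair hc hlam hx hx

theorem IsElementary.hereditarily_ord {ξ : Ordinal.{u}} (hξ : ξ < lam) :
    ξ.toZFSet.Hereditarily (· ∈ Set.range (hj.factorMap hc hlam)) := by
  induction ξ using WellFoundedLT.induction with
  | ind ξ ih =>
    rw [ZFSet.hereditarily_iff]
    refine ⟨hj.ord_mem_range_factorMap hc hlam hξ, fun y hy => ?_⟩
    obtain ⟨ζ, hζ, rfl⟩ := Ordinal.mem_toZFSet_iff.1 hy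
    exact ih ζ hζ (hζ.trans hξ)

end factor_map

/-! ### From a Woodin cardinal to extenders in `V_κ`. -/

theorem pair_mem_vonNeumann {o : Ordinal.{u}} (ho : ∀ ξ < o, ξ + 1 < o) {x y : ZFSet.{u}} :
    ZFSet.pair x y ∈ ZFSet.vonNeumann o ↔
      x ∈ ZFSet.vonNeumann o ∧ y ∈ ZFSet.vonNeumann o := by
  have h2 : ∀ a b : ZFSet.{u}, ({a, b} : ZFSet.{u}).rank < o ↔ a.rank < o ∧ b.rank < o := by
    intro a b
    refine ⟨fun h => ⟨(ZFSet.rank_lt_of_mem (by simp)).trans h,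
      (ZFSet.rank_lt_of_mem (by simp)).trans h⟩, fun h => ?_⟩
    refine lt_of_le_of_lt ?_ (ho _ (max_lt h.1 h.2))
    refine ZFSet.rank_le_iff.2 fun z hz => Order.lt_add_one_iff.2 ?_
    rcases ZFSet.mem_pair.1 hz with rfl | rfl
    exacts [le_max_left _ _, le_max_right _ _]
  simp only [ZFSet.mem_vonNeumann, ZFSet.pair]
  rw [h2, h2, ← ZFSet.pair_eq_singleton, h2]
  tauto

theorem exists_injective_ord (x : ZFSet.{u}) : ∃ o : ZFSet.{u} → Ordinal.{u},
    (∀ y ∈ x, o y < x.card.ord) ∧ ∀ y ∈ x, ∀ z ∈ x, o y = o z → y = z := by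
  classical
  obtain ⟨e⟩ : Nonempty (Shrink.{u} x ↪ x.card.ord.ToType) := by
    rw [← Cardinal.le_def, Cardinal.mk_ord_toType]
    exact le_rfl
  refine ⟨fun y => if h : y ∈ x then
    (Ordinal.ToType.toOrd (e (equivShrink x ⟨y, h⟩)) : Ordinal) else 0, ?_, ?_⟩
  · intro y hy
    simp only [hy, dite_true]
    exact (Ordinal.ToType.toOrd (e (equivShrink x ⟨y, hy⟩))).2
  · intro y hy z hz h
    simp only [hy, hz, dite_true] at h
    have := (equivShrink x).injective (e.injective (Ordinal.ToType.mk.symm.injective (Subtype.ext h)))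
    exact congrArg Subtype.val this

theorem derivedExtender_mem_vonNeumann {j : ZFSet.{u} → ZFSet.{u}} {μ lam o : Ordinal.{u}}
    (ho : ∀ ξ < o, ξ + 1 < o) (hμ : μ < o) (hlam : lam < o) :
    derivedExtender j μ lam ∈ ZFSet.vonNeumann o := by
  have hfin : ∀ ξ : Ordinal.{u}, (finSubsets ξ).rank ≤ ξ + 1 := fun ξ => by
    refine (ZFSet.rank_mono ZFSet.sep_subset).trans ?_
    rw [ZFSet.rank_powerset, Ordinal.rank_toZFSet]
    exact le_rfl
  rw [ZFSet.mem_vonNeumann]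
  refine (ZFSet.rank_mono ZFSet.sep_subset).trans_lt ?_
  refine (ZFSet.rank_mono (y := ((finSubsets lam ∪ (finSubsets μ).powerset.powerset).powerset).powerset)
    ?_).trans_lt ?_
  · rw [ZFSet.prod, ZFSet.pairSep]
    exact ZFSet.sep_subset
  · simp only [ZFSet.rank_powerset, ZFSet.rank_union]
    refine ho _ (ho _ (max_lt ?_ (ho _ (ho _ ?_))))
    exacts [(hfin _).trans_lt (ho _ hlam), (hfin _).trans_lt (ho _ hμ)]

section functional

/-- A single-valued relation. -/
def IsFunctional (F : ZFSet.{u}) : Prop :=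
  ∀ a b c, ZFSet.pair a b ∈ F → ZFSet.pair a c ∈ F → b = c

theorem IsElementary.map_functional {M : Set ZFSet.{u}} {j : ZFSet.{u} → ZFSet.{u}}
    (hj : IsElementary M j) {F : ZFSet.{u}} (hF : IsFunctional F) : IsFunctional (j F) := by
  have key := (hj.transfer (fun _ v => ∀ a ∈ field (v 0), ∀ b ∈ field (v 0), ∀ c ∈ field (v 0),
    ZFSet.pair a b ∈ v 0 → ZFSet.pair a c ∈ v 0 → b = c) (fun _ => F)).1
    (fun a _ b _ c _ => hF a b c)
  intro a b c h h'
  exact key a (left_mem_field h) b (right_mem_field h) c (right_mem_field h') h h'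

theorem IsFunctional.app_eq {F x y : ZFSet.{u}} (hF : IsFunctional F) (h : ZFSet.pair x y ∈ F) :
    app F x = y :=
  WoodinCard.app_eq h fun z hz => hF x z y hz h

theorem isFunctional_of_isFunc {x y f : ZFSet.{u}} (hf : ZFSet.IsFunc x y f) : IsFunctional f := by
  intro a b c h h'
  exact (hf.2 a (ZFSet.pair_mem_prod.1 (hf.1 h)).1).unique h h'

end functional

theorem IsWoodin.hasExtenderPoints {κ : Cardinal.{u}} (h : IsWoodin κ) (f : ZFSet.{u})
    (hf : ZFSet.IsFunc κ.ord.toZFSet κ.ord.toZFSet f) :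
    ∃ α < κ.ord, IsExtenderPoint κ f α := by
  have hlim : ∀ ξ < κ.ord, ξ + 1 < κ.ord := fun ξ hξ =>
    (isSuccLimit_ord h.1.aleph0_lt.le).add_one_lt hξ
  have hfun := isFunctional_of_isFunc hf
  have hfmem : ∀ {a b}, ZFSet.pair a b ∈ f → a ∈ κ.ord.toZFSet ∧ b ∈ κ.ord.toZFSet :=
    fun hab => ZFSet.pair_mem_prod.1 (hf.1 hab)
  obtain ⟨o, ho, hoinj⟩ := exists_injective_ord (ZFSet.vonNeumann κ.ord)
  rw [ZFSet.card_vonNeumann, h.1.preBeth_ord] at ho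
  -- `Y` maps an ordinal code to the coded set, so that elements of `V_κ` can be recovered from
  -- ordinals inside the ultrapower.
  let Y : ZFSet.{u} := ZFSet.range fun x : ZFSet.vonNeumann κ.ord =>
    ZFSet.pair (o x).toZFSet x
  have hYmem : ∀ a b, ZFSet.pair a b ∈ Y ↔ b ∈ ZFSet.vonNeumann κ.ord ∧ a = (o b).toZFSet := by
    intro a b
    simp only [Y, ZFSet.mem_range, ZFSet.pair_inj, Subtype.exists]
    constructor
    · rintro ⟨x, hx, rfl, rfl⟩
      exact ⟨hx, rfl⟩
    · rintro ⟨hb, rfl⟩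
      exact ⟨b, hb, rfl, rfl⟩
  have hYfun : IsFunctional Y := by
    intro a b c hb hc
    rw [hYmem] at hb hc
    exact hoinj b hb.1 c hc.1 (Ordinal.toZFSet_injective (hb.2.symm.trans hc.2))
  obtain ⟨μ, hμ, hs⟩ := h.exists_strong_pair (X := f) (Y := Y) (by
      intro z hz
      obtain ⟨a, ha, b, hb, rfl⟩ := ZFSet.mem_prod.1 (hf.1 hz)
      exact (pair_mem_vonNeumann hlim).2
        ⟨κ.ord.toZFSet_subset_vonNeumann ha, κ.ord.toZFSet_subset_vonNeumann hb⟩) (by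
      intro z hz
      obtain ⟨x, rfl⟩ := ZFSet.mem_range.1 hz
      exact (pair_mem_vonNeumann hlim).2
        ⟨κ.ord.toZFSet_subset_vonNeumann (Ordinal.toZFSet_mem_toZFSet_iff.2 (ho _ x.2)), x.2⟩)
  have hμ' : μ.ord < κ.ord := ord_lt_ord.2 hμ
  refine ⟨μ.ord, hμ', ?_, ?_⟩
  · intro β γ hβ hβγ
    -- Let `f(β) = γ ≥ μ` with `β < μ`, and take an embedding of degree above `γ`. Agreement gives
    -- `j(f)(β) = γ`, elementarity gives `j(f)(β) = j(γ)`; but `γ < j(μ) ≤ j(γ)`.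
    by_contra! hle
    have hγ : γ < κ.ord := Ordinal.toZFSet_mem_toZFSet_iff.1 (hfmem hβγ).2
    have hγν : γ < (Order.succ (max γ.card ℵ₀)).ord :=
      lt_ord.2 ((le_max_left _ _).trans_lt (Order.lt_succ _))
    obtain ⟨M, j, hj, hc, hν, hX, -⟩ := hs (Order.succ (max γ.card ℵ₀))
      (h.1.isSuccLimit.succ_lt (max_lt (lt_ord.1 hγ) h.1.aleph0_lt))
    have h1 : ZFSet.pair β.toZFSet γ.toZFSet ∈ (f : Set ZFSet.{u}) ∩ H _ :=
      ⟨hβγ, (pair_mem_H ((le_max_right _ _).trans (Order.le_succ _))).2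
        ⟨toZFSet_mem_H ((hβ.trans_le hle).trans hγν), toZFSet_mem_H hγν⟩⟩
    rw [← hX] at h1
    have h2 := hj.mem_iff.2 hβγ
    rw [hj.map_pair, hc.2 β hβ] at h2
    have h3 := hj.map_functional hfun _ _ _ h2 h1.1
    have h4 := hν (Ordinal.toZFSet_mem_toZFSet_iff.2 hγν)
    have h5 := hj.subset_iff.2 (Ordinal.toZFSet_subset_toZFSet_iff.2 hle) h4
    rw [h3] at h5
    exact ZFSet.mem_irrefl _ h5
  obtain ⟨η, hη, hμη⟩ := exists_pair_of_isFunc hf (Ordinal.toZFSet_mem_toZFSet_iff.2 hμ')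
  -- By regularity of `κ`, the codes of the fewer than `κ` elements of `V_η` are bounded.
  obtain ⟨σ, hσ, hoσ⟩ : ∃ σ < κ.ord, ∀ x ∈ ZFSet.vonNeumann η, o x < σ := by
    let s : ZFSet.{u} := ZFSet.range fun x : ZFSet.vonNeumann η => (o x).toZFSet
    refine ⟨s.rank, rank_lt_of_mem_H h.1.isRegular (mem_H_iff.2 ⟨?_, ?_⟩), fun x hx => ?_⟩
    · have h1 := ZFSet.lift_card_range_le
        (f := fun x : ZFSet.vonNeumann η => (o x).toZFSet)
      rw [ZFSet.cardinalMk_coe_sort, Cardinal.lift_lift, Cardinal.lift_le] at h1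
      exact h1.trans_lt (card_vonNeumann_lt h.1 hη)
    · intro y hy
      obtain ⟨x, rfl⟩ := ZFSet.mem_range.1 hy
      exact toZFSet_mem_H (ho _ (ZFSet.vonNeumann_subset_of_le hη.le x.2))
    · rw [← Ordinal.rank_toZFSet (o x)]
      exact ZFSet.rank_lt_of_mem (ZFSet.mem_range.2 ⟨⟨x, hx⟩, rfl⟩)
  -- With length `θ⁺`, the ordinals `μ`, `η` and all codes of elements of `V_η` are below the
  -- length, and these elements belong to `H_{θ⁺}`.
  let θ := max (max (ZFSet.vonNeumann η).card ℵ₀) (max σ.card (max μ η.card))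
  have hθ : θ < κ := max_lt (max_lt (card_vonNeumann_lt h.1 hη) h.1.aleph0_lt)
    (max_lt (lt_ord.1 hσ) (max_lt hμ (lt_ord.1 hη)))
  have hθσ : σ.card ≤ θ := (le_max_left _ _).trans (le_max_right _ _)
  have hθμ : μ ≤ θ := (le_max_left _ _).trans ((le_max_right _ _).trans (le_max_right _ _))
  have hθη : η.card ≤ θ := (le_max_right _ _).trans ((le_max_right _ _).trans (le_max_right _ _))
  have hθV : (ZFSet.vonNeumann η).card ≤ θ := (le_max_left _ _).trans (le_max_left _ _)
  have hθω : ℵ₀ ≤ θ := (le_max_right _ _).trans (le_max_left _ _)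
  have hν : Order.succ θ < κ := h.1.isSuccLimit.succ_lt hθ
  obtain ⟨M, j, hj, hc, hlam, hX, hY⟩ := hs _ hν
  have hωH : ℵ₀ ≤ Order.succ θ := hθω.trans (Order.le_succ _)
  have hμlam : μ.ord < (Order.succ θ).ord := ord_lt_ord.2 (hθμ.trans_lt (Order.lt_succ _))
  have hηlam : η < (Order.succ θ).ord := lt_ord.2 (hθη.trans_lt (Order.lt_succ _))
  have hσlam : σ < (Order.succ θ).ord := lt_ord.2 (hθσ.trans_lt (Order.lt_succ _))
  obtain ⟨π, hπ⟩ := hj.exists_isCollapse hc hlam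
  refine ⟨_, μ.ord, _, derivedExtender_mem_vonNeumann hlim hμ' (ord_lt_ord.2 hν),
    ⟨M, j, hj, hc, hμlam.le, hlam, rfl⟩, π, hπ, ⟨?_, ?_⟩, η, ?_, hμη, ?_⟩
  -- If `μ` were fixed by the ultrapower embedding, its constant class would be the preimage of `μ`
  -- under the factor map, so `j` would fix `μ`.
  · intro he
    obtain ⟨w, hw, hw'⟩ := hj.collapse_eq hc hlam hπ (hj.hereditarily_ord hc hlam hμlam)
    have hw2 := hπ.injective (hw'.trans he.symm)
    rw [hw2, hj.factorMap_const] at hw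
    exact hc.1 hw
  · intro β hβ
    obtain ⟨w, hw, hw'⟩ := hj.collapse_eq hc hlam hπ
      (hj.hereditarily_ord hc hlam (hβ.trans hμlam))
    rw [← hc.2 β hβ, ← hj.factorMap_const hc hlam] at hw
    change π (Ult.const _ _ _ _) = _
    rw [← hj.factorMap_injective hc hlam hw]
    exact hw'
  · obtain ⟨w, hw, hw'⟩ := hj.collapse_eq hc hlam hπ (hj.hereditarily_pair hc hlam
      (hj.hereditarily_ord hc hlam hμlam) (hj.hereditarily_ord hc hlam hηlam))
    have h1 : ZFSet.pair μ.ord.toZFSet η.toZFSet ∈ (f : Set ZFSet.{u}) ∩ H (Order.succ θ) :=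
      ⟨hμη, (pair_mem_H hωH).2 ⟨toZFSet_mem_H hμlam, toZFSet_mem_H hηlam⟩⟩
    rw [← hX] at h1
    have h2 := h1.1
    rw [SetLike.mem_coe, ← hw, ← hj.factorMap_const hc hlam, hj.factorMap_mem_iff] at h2
    rw [← hw']
    exact (hπ.mem_iff _ _).2 h2
  · have hV : ∀ x ∈ ZFSet.vonNeumann η,
        x.Hereditarily (· ∈ Set.range (hj.factorMap hc hlam)) := by
      intro x
      induction x using ZFSet.inductionOn with
      | h x ih =>
        intro hx
        rw [ZFSet.hereditarily_iff]
        refine ⟨?_, fun y hy => ih y hy ((ZFSet.isTransitive_vonNeumann η).mem_trans hy hx)⟩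
        -- Agreement of `Y` and `j Y` on `H` puts this pair into `j Y`, so `x` is the value of `j Y`
        -- at the ordinal `o x`.
        have h1 : ZFSet.pair (o x).toZFSet x ∈ (Y : Set ZFSet.{u}) ∩ H (Order.succ θ) :=
          ⟨(hYmem _ _).2 ⟨ZFSet.vonNeumann_subset_of_le hη.le hx, rfl⟩, (pair_mem_H hωH).2
            ⟨toZFSet_mem_H ((hoσ x hx).trans hσlam),
              mem_H_of_card_vonNeumann_lt (hθV.trans_lt (Order.lt_succ _))
                ((ZFSet.isTransitive_vonNeumann η) x hx)⟩⟩
        rw [← hY] at h1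
        rw [← (hj.map_functional hYfun).app_eq h1.1]
        exact hj.app_mem_range_factorMap hc hlam ((hoσ x hx).trans hσlam) Y
    intro x hx
    obtain ⟨w, -, hw⟩ := hj.collapse_eq hc hlam hπ (hV x hx)
    exact ⟨w, hw⟩

/-! ### First-order witnesses of strength. -/

section strong_system

/-- The map `n ↦ app t n` preserves the relations between the terms of the sequence `s`. -/
def PreservesRelations (s t : ZFSet.{u}) : Prop :=
  ∀ m ∈ Ordinal.omega0.{u}.toZFSet, ∀ n ∈ Ordinal.omega0.{u}.toZFSet,
    (app s m = app s n → app t m = app t n) ∧ (app s m ∈ app s n → app t m ∈ app t n) ∧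
    ∀ k ∈ Ordinal.omega0.{u}.toZFSet, app s k = ZFSet.pair (app s m) (app s n) →
      app t k = ZFSet.pair (app t m) (app t n)

instance expressible_preservesRelations {f g : (ℕ → ZFSet.{u}) → ZFSet.{u}} [AbsFun f] [AbsFun g] :
    Expressible fun _ v => PreservesRelations (f v) (g v) := by
  unfold PreservesRelations; infer_instance

/-- The set of the pairs `(s, x) ∈ T` such that some `w ∈ x` satisfies `(s, w) ∈ h`. -/
noncomputable def regressive (T h : ZFSet.{u}) : ZFSet.{u} :=
  ZFSet.sep (fun z => ∃ s ∈ T, ∃ x ∈ T, z = ZFSet.pair s x ∧ ∃ w ∈ x, ZFSet.pair s w ∈ h) T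

instance absFun_regressive {f g : (ℕ → ZFSet.{u}) → ZFSet.{u}} [AbsFun f] [AbsFun g] :
    AbsFun fun v => regressive (f v) (g v) := by
  unfold regressive; infer_instance

/-- A system of ultrafilters on `T` indexed by the elements of `B`, coded by the set `E` of the
pairs `(y, b)` such that `y` belongs to the ultrafilter of `b`, whose ultrapower witnesses, in the
sense of the class `M`, that `ξ` is strong for `X` up to `B`. -/
structure StrongSystem (M : Set ZFSet.{u}) (T B E X ξ : ZFSet.{u}) : Prop where
  pair_left : ∀ x ∈ T, ∀ y ∈ T, ZFSet.pair x y ∈ T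
  pair_right : ∀ x ∈ B, ∀ y ∈ B, ZFSet.pair x y ∈ B
  subset : T ⊆ B
  univ_mem : ∀ b ∈ B, ZFSet.pair T b ∈ E
  inter_mem : ∀ b ∈ B, ∀ y ∈ M, ∀ z ∈ M, ZFSet.pair y b ∈ E → ZFSet.pair z b ∈ E →
    ZFSet.pair (y ∩ z) b ∈ E
  mono : ∀ b ∈ B, ∀ y ∈ M, ∀ z ∈ M, z ⊆ T → y ⊆ z → ZFSet.pair y b ∈ E → ZFSet.pair z b ∈ E
  compl : ∀ b ∈ B, ∀ y ∈ M, y ⊆ T → (ZFSet.pair (T \ y) b ∉ E ↔ ZFSet.pair y b ∈ E)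
  coherent : ∀ s ∈ M, ∀ y ∈ M, (∀ n ∈ Ordinal.omega0.{u}.toZFSet, app s n ∈ B ∧
      ZFSet.pair (app y n) (app s n) ∈ E) → ∃ t ∈ M,
    (∀ n ∈ Ordinal.omega0.{u}.toZFSet, app t n ∈ app y n) ∧ PreservesRelations s t
  normal : ∀ h ∈ M, h ⊆ T → ∀ c ∈ B, ∀ b ∈ B, ZFSet.pair (regressive T h) (ZFSet.pair c b) ∈ E →
    ∃ b' ∈ b, ZFSet.pair h (ZFSet.pair c b') ∈ E
  fixed : ∀ x ∈ T, ZFSet.pair {x} x ∈ E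
  agree : ∀ b ∈ B, (ZFSet.pair (X ∩ T) b ∈ E ↔ b ∈ X)
  ord_mem : ∀ b ∈ B, b.IsOrdinal → ZFSet.pair ξ b ∈ E

/-- The conjunction exhibits the definition as a formula relativized to `M`, from which the
instances derive expressibility. -/
theorem strongSystem_iff {M : Set ZFSet.{u}} {T B E X ξ : ZFSet.{u}} : StrongSystem M T B E X ξ ↔
    (∀ x ∈ T, ∀ y ∈ T, ZFSet.pair x y ∈ T) ∧
    (∀ x ∈ B, ∀ y ∈ B, ZFSet.pair x y ∈ B) ∧
    T ⊆ B ∧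
    (∀ b ∈ B, ZFSet.pair T b ∈ E) ∧
    (∀ b ∈ B, ∀ y ∈ M, ∀ z ∈ M, ZFSet.pair y b ∈ E → ZFSet.pair z b ∈ E →
      ZFSet.pair (y ∩ z) b ∈ E) ∧
    (∀ b ∈ B, ∀ y ∈ M, ∀ z ∈ M, z ⊆ T → y ⊆ z → ZFSet.pair y b ∈ E → ZFSet.pair z b ∈ E) ∧
    (∀ b ∈ B, ∀ y ∈ M, y ⊆ T → (ZFSet.pair (T \ y) b ∉ E ↔ ZFSet.pair y b ∈ E)) ∧
    (∀ s ∈ M, ∀ y ∈ M, (∀ n ∈ Ordinal.omega0.{u}.toZFSet, app s n ∈ B ∧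
      ZFSet.pair (app y n) (app s n) ∈ E) → ∃ t ∈ M,
      (∀ n ∈ Ordinal.omega0.{u}.toZFSet, app t n ∈ app y n) ∧ PreservesRelations s t) ∧
    (∀ h ∈ M, h ⊆ T → ∀ c ∈ B, ∀ b ∈ B, ZFSet.pair (regressive T h) (ZFSet.pair c b) ∈ E →
      ∃ b' ∈ b, ZFSet.pair h (ZFSet.pair c b') ∈ E) ∧
    (∀ x ∈ T, ZFSet.pair {x} x ∈ E) ∧
    (∀ b ∈ B, (ZFSet.pair (X ∩ T) b ∈ E ↔ b ∈ X)) ∧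
    ∀ b ∈ B, b.IsOrdinal → ZFSet.pair ξ b ∈ E :=
  ⟨fun ⟨h1, h2, h3, h4, h5, h6, h7, h8, h9, h10, h11, h12⟩ =>
    ⟨h1, h2, h3, h4, h5, h6, h7, h8, h9, h10, h11, h12⟩,
    fun ⟨h1, h2, h3, h4, h5, h6, h7, h8, h9, h10, h11, h12⟩ =>
    ⟨h1, h2, h3, h4, h5, h6, h7, h8, h9, h10, h11, h12⟩⟩

instance expressible_strongSystem {f₁ f₂ f₃ f₄ f₅ : (ℕ → ZFSet.{u}) → ZFSet.{u}} [AbsFun f₁]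
    [AbsFun f₂] [AbsFun f₃] [AbsFun f₄] [AbsFun f₅] :
    Expressible fun M v => StrongSystem M (f₁ v) (f₂ v) (f₃ v) (f₄ v) (f₅ v) := by
  simp only [strongSystem_iff]
  repeat' refine @expressible_and _ _ ?_ ?_
  all_goals infer_instance

end strong_system

/-! ### The limit ultrapower by a strong system. -/

section ultrapower

/-- The first component of a pair. -/
noncomputable def fst (z : ZFSet.{u}) : ZFSet.{u} :=
  Classical.epsilon fun x => ∃ y, z = ZFSet.pair x y

/-- The second component of a pair. -/
noncomputable def snd (z : ZFSet.{u}) : ZFSet.{u} :=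
  Classical.epsilon fun y => ∃ x, z = ZFSet.pair x y

@[simp] theorem fst_pair (x y : ZFSet.{u}) : fst (ZFSet.pair x y) = x := by
  obtain ⟨z, hz⟩ := Classical.epsilon_spec (p := fun a => ∃ b, ZFSet.pair x y = ZFSet.pair a b)
    ⟨x, y, rfl⟩
  exact (ZFSet.pair_injective hz).1.symm

@[simp] theorem snd_pair (x y : ZFSet.{u}) : snd (ZFSet.pair x y) = y := by
  obtain ⟨z, hz⟩ := Classical.epsilon_spec (p := fun b => ∃ a, ZFSet.pair x y = ZFSet.pair a b)
    ⟨y, x, rfl⟩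
  exact (ZFSet.pair_injective hz).2.symm

variable {T B E X ξ : ZFSet.{u}}

/-- `τ` preserves membership and pairs on `D`. -/
def Coherent (τ : ZFSet.{u} → ZFSet.{u}) (D : Set ZFSet.{u}) : Prop :=
  ∀ p ∈ D, ∀ q ∈ D, (p ∈ q → τ p ∈ τ q) ∧
    ∀ r ∈ D, r = ZFSet.pair p q → τ r = ZFSet.pair (τ p) (τ q)

namespace StrongSystem

variable (hE : StrongSystem Set.univ T B E X ξ)

/-- The ultrafilter of an index. -/
noncomputable def ultrafilter (b : {b // b ∈ B}) : Ultrafilter ZFSet.{u} :=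
  Ultrafilter.ofComplNotMemIff
    { sets := {S | ZFSet.pair (ZFSet.sep (· ∈ S) T) b.1 ∈ E}
      univ_sets := by
        have : ZFSet.sep (· ∈ Set.univ) T = T := by ext; simp
        change ZFSet.pair (ZFSet.sep (· ∈ Set.univ) T) b.1 ∈ E
        rw [this]
        exact hE.univ_mem b.1 b.2
      sets_of_superset := fun {S S'} hS hsub => by
        refine hE.mono b.1 b.2 _ trivial _ trivial ZFSet.sep_subset (fun z hz => ?_) hS
        rw [ZFSet.mem_sep] at *
        exact ⟨hz.1, hsub hz.2⟩
      inter_sets := fun {S S'} hS hS' => by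
        have : ZFSet.sep (· ∈ S ∩ S') T = ZFSet.sep (· ∈ S) T ∩ ZFSet.sep (· ∈ S') T := by
          ext; simp; tauto
        simp only [Set.mem_ofPred_eq] at *
        rw [this]
        exact hE.inter_mem b.1 b.2 _ trivial _ trivial hS hS' } (by
    intro S
    have : ZFSet.sep (· ∈ Sᶜ) T = T \ ZFSet.sep (· ∈ S) T := by ext; simp; tauto
    change ZFSet.pair (ZFSet.sep (· ∈ Sᶜ) T) b.1 ∉ E ↔ ZFSet.pair (ZFSet.sep (· ∈ S) T) b.1 ∈ E
    rw [this]
    exact hE.compl b.1 b.2 _ trivial ZFSet.sep_subset)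

theorem eventually_iff (b : {b // b ∈ B}) (P : ZFSet.{u} → Prop) :
    (∀ᶠ t in hE.ultrafilter b, P t) ↔ ZFSet.pair (ZFSet.sep P T) b.1 ∈ E :=
  Iff.rfl

/-- The pair of two indices. -/
noncomputable def pr (b c : {b // b ∈ B}) : {b // b ∈ B} :=
  ⟨ZFSet.pair b.1 c.1, hE.pair_right _ b.2 _ c.2⟩

include hE in
-- The field `coherent` combines countable completeness with compatibility of the ultrafilters.
-- Applied to an enumeration of `C`, it selects one point in each large set, respecting equality,
-- membership and pairs of indices.
theorem exists_coherent (C : Set ({b // b ∈ B} × (ZFSet.{u} → Prop))) (hC : C.Countable)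
    (h : ∀ p ∈ C, ∀ᶠ t in hE.ultrafilter p.1, p.2 t) :
    ∃ τ, Coherent τ ((fun p => p.1.1) '' C) ∧ ∀ p ∈ C, p.2 (τ p.1.1) := by
  rcases C.eq_empty_or_nonempty with rfl | hne
  · exact ⟨id, by simp [Coherent], by simp⟩
  obtain ⟨c, rfl⟩ := hC.exists_eq_range hne
  let num : ℕ → ZFSet.{u} := fun n => (n : Ordinal.{u}).toZFSet
  have hnum : Function.Injective num := fun m n h => by
    simpa using Ordinal.toZFSet_injective h
  have hω : ∀ n, num n ∈ Ordinal.omega0.{u}.toZFSet := fun n => toZFSet_omega_mem_iff.2 ⟨n, rfl⟩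
  obtain ⟨S, hS⟩ : ∃ S : (ℕ → ZFSet.{u}) → ZFSet.{u}, ∀ F n, app (S F) (num n) = F n :=
    ⟨fun F => graphOn (fun x => F (Function.invFun num x)) Ordinal.omega0.{u}.toZFSet,
      fun F n => by rw [app_graphOn (hω n), Function.leftInverse_invFun hnum n]⟩
  obtain ⟨t, -, ht, hrel⟩ := hE.coherent (S fun n => (c n).1.1) trivial
    (S fun n => ZFSet.sep (c n).2 T) trivial (by
      intro x hx
      obtain ⟨n, hn : x = num n⟩ := toZFSet_omega_mem_iff.1 hx
      rw [hn, hS, hS]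
      exact ⟨(c n).1.2, h _ ⟨n, rfl⟩⟩)
  -- An index may be enumerated repeatedly; preservation of equality makes the chosen position
  -- irrelevant.
  let τ : ZFSet.{u} → ZFSet.{u} := fun b => app t (num (Classical.epsilon fun n => (c n).1.1 = b))
  have hrel' : ∀ m n, (((c m).1.1 = (c n).1.1) → app t (num m) = app t (num n)) ∧
      ((c m).1.1 ∈ (c n).1.1 → app t (num m) ∈ app t (num n)) ∧
      ∀ k, (c k).1.1 = ZFSet.pair (c m).1.1 (c n).1.1 →
        app t (num k) = ZFSet.pair (app t (num m)) (app t (num n)) := by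
    intro m n
    obtain ⟨h1, h2, h3⟩ := hrel _ (hω m) _ (hω n)
    simp only [hS] at h1 h2 h3
    refine ⟨h1, h2, fun k hk => h3 _ (hω k) ?_⟩
    rwa [hS]
  have hτ : ∀ n, τ (c n).1.1 = app t (num n) := fun n =>
    (hrel' _ _).1 (Classical.epsilon_spec (p := fun m => (c m).1.1 = (c n).1.1) ⟨n, rfl⟩)
  refine ⟨τ, ?_, ?_⟩
  · rintro _ ⟨_, ⟨m, rfl⟩, rfl⟩ _ ⟨_, ⟨n, rfl⟩, rfl⟩
    rw [hτ, hτ]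
    refine ⟨(hrel' m n).2.1, ?_⟩
    rintro _ ⟨_, ⟨k, rfl⟩, rfl⟩ hk
    rw [hτ]
    exact (hrel' m n).2.2 k hk
  · rintro _ ⟨n, rfl⟩
    rw [hτ]
    have := ht _ (hω n)
    rw [hS] at this
    exact (ZFSet.mem_sep.1 this).2

/-- Otherwise the complement could be added to the countably many large sets, and a coherent
selection from all of them would refute `hP`. Facts about several ultrafilters thus reduce to
computations with one coherent map. -/
theorem eventually_of_coherent (b : {b // b ∈ B}) (P : ZFSet.{u} → Prop)
    (C : Set ({b // b ∈ B} × (ZFSet.{u} → Prop))) (hC : C.Countable)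
    (h : ∀ p ∈ C, ∀ᶠ t in hE.ultrafilter p.1, p.2 t)
    (hP : ∀ τ, Coherent τ (insert b.1 ((fun p => p.1.1) '' C)) → (∀ p ∈ C, p.2 (τ p.1.1)) →
      P (τ b.1)) : ∀ᶠ t in hE.ultrafilter b, P t := by
  by_contra hne
  rw [← Ultrafilter.eventually_not] at hne
  obtain ⟨τ, hτ, hτP⟩ := hE.exists_coherent (insert (b, fun t => ¬ P t) C) (hC.insert _) (by
    rintro p (rfl | hp)
    exacts [hne, h p hp])
  rw [Set.image_insert_eq] at hτ
  exact hτP _ (Set.mem_insert _ _) (hP τ hτ fun p hp => hτP p (Set.mem_insert_of_mem _ hp))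

/-- The relation `R` holds between the values of two functions, at two indices. -/
def Holds (R : ZFSet.{u} → ZFSet.{u} → Prop) (a b : {b // b ∈ B} × (ZFSet.{u} → ZFSet.{u})) :
    Prop :=
  ∀ᶠ t in hE.ultrafilter (hE.pr a.1 b.1), R (a.2 (fst t)) (b.2 (snd t))

theorem holds_diag (R : ZFSet.{u} → ZFSet.{u} → Prop) (b : {b // b ∈ B})
    (F G : ZFSet.{u} → ZFSet.{u}) :
    hE.Holds R (b, F) (b, G) ↔ ∀ᶠ t in hE.ultrafilter b, R (F t) (G t) := by
  constructor
  · intro h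
    refine hE.eventually_of_coherent _ _
      {(hE.pr b b, fun t => R (F (fst t)) (G (snd t)))} (by simp)
      (fun p hp => Set.mem_singleton_iff.1 hp ▸ h) ?_
    intro τ hτ h
    have h1 := (hτ b.1 (by simp) b.1 (by simp)).2 (hE.pr b b).1 (by simp) rfl
    simpa [h1] using h
  · intro h
    refine hE.eventually_of_coherent _ _ {(b, fun t => R (F t) (G t))} (by simp) (by simpa using h)
      ?_
    intro τ hτ h
    have h1 := (hτ b.1 (by simp) b.1 (by simp)).2 (hE.pr b b).1 (by simp) rfl
    simpa [h1] using h

/-- A coherent map turns the three relations at pairs of indices into relations between the values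
at the four single indices, where substitution is immediate. -/
theorem Holds.congr {R : ZFSet.{u} → ZFSet.{u} → Prop}
    {a a' b b' : {b // b ∈ B} × (ZFSet.{u} → ZFSet.{u})} (h : hE.Holds R a b)
    (ha : hE.Holds (· = ·) a a') (hb : hE.Holds (· = ·) b b') : hE.Holds R a' b' := by
  refine hE.eventually_of_coherent _ _
    {(a.1, fun _ => True), (a'.1, fun _ => True), (b.1, fun _ => True), (b'.1, fun _ => True),
      (hE.pr a.1 b.1, fun t => R (a.2 (fst t)) (b.2 (snd t))),
      (hE.pr a.1 a'.1, fun t => a.2 (fst t) = a'.2 (snd t)),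
      (hE.pr b.1 b'.1, fun t => b.2 (fst t) = b'.2 (snd t))} (Set.toFinite _).countable ?_ ?_
  · simp only [Set.mem_insert_iff, Set.mem_singleton_iff, forall_eq_or_imp, forall_eq,
      Filter.eventually_true, true_and]
    exact ⟨h, ha, hb⟩
  · intro τ hτ hp
    simp only [Set.mem_insert_iff, Set.mem_singleton_iff, forall_eq_or_imp, forall_eq,
      true_and] at hp
    simp only [Set.image_insert_eq, Set.image_singleton] at hτ
    obtain ⟨h1, h2, h3⟩ := hp
    have e1 := (hτ a.1.1 (by simp) b.1.1 (by simp)).2 (hE.pr a.1 b.1).1 (by simp) rfl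
    have e2 := (hτ a.1.1 (by simp) a'.1.1 (by simp)).2 (hE.pr a.1 a'.1).1 (by simp) rfl
    have e3 := (hτ b.1.1 (by simp) b'.1.1 (by simp)).2 (hE.pr b.1 b'.1).1 (by simp) rfl
    have e4 := (hτ a'.1.1 (by simp) b'.1.1 (by simp)).2 (hE.pr a'.1 b'.1).1 (by simp) rfl
    simp only [e1, e2, e3, fst_pair, snd_pair] at h1 h2 h3
    simp only [e4, fst_pair, snd_pair]
    rwa [← h2, ← h3]

theorem Holds.symm {a b : {b // b ∈ B} × (ZFSet.{u} → ZFSet.{u})} (h : hE.Holds (· = ·) a b) :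
    hE.Holds (· = ·) b a := by
  have hr : ∀ a : {b // b ∈ B} × (ZFSet.{u} → ZFSet.{u}), hE.Holds (· = ·) a a := fun a =>
    (hE.holds_diag _ _ _ _).2 (by simp)
  exact (hr a).congr hE h (hr a)

/-- The identification of the representatives. -/
def setoid : Setoid ({b // b ∈ B} × (ZFSet.{u} → ZFSet.{u})) where
  r := hE.Holds (· = ·)
  iseqv := {
    refl := fun a => (hE.holds_diag _ _ _ _).2 (by simp)
    symm := fun h => h.symm hE
    trans := fun h h' => h.congr hE ((hE.holds_diag _ _ _ _).2 (by simp)) h' }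

/-- The limit ultrapower of the system. -/
noncomputable def system : UltraSystem.{u} {b // b ∈ B} (Quotient hE.setoid) where
  E := hE.ultrafilter
  rep b F := Quotient.mk hE.setoid (b, F)
  r := Quotient.lift₂ (hE.Holds (· ∈ ·)) fun _ _ _ _ ha hb =>
    propext ⟨fun h => h.congr hE ha hb, fun h => h.congr hE (ha.symm hE) (hb.symm hE)⟩
  eq_iff b F G := Quotient.eq.trans (hE.holds_diag _ b F G)
  mem_iff b F G := hE.holds_diag _ b F G
  surj w := by
    obtain ⟨⟨b, F⟩, rfl⟩ := Quotient.exists_rep w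
    exact ⟨b, F, rfl⟩
  directed b c := by
    refine ⟨hE.pr b c, fst, snd, fun F => Quotient.sound ?_, fun G => Quotient.sound ?_⟩
    · refine hE.eventually_of_coherent (hE.pr b (hE.pr b c)) _
        {(b, fun _ => True), (c, fun _ => True), (hE.pr b c, fun _ => True)}
        (Set.toFinite _).countable (by simp) ?_
      intro τ hτ _
      simp only [Set.image_insert_eq, Set.image_singleton] at hτ
      have e1 := (hτ b.1 (by simp) c.1 (by simp)).2 (hE.pr b c).1 (by simp) rfl
      have e2 := (hτ b.1 (by simp) (hE.pr b c).1 (by simp)).2 (hE.pr b (hE.pr b c)).1 (by simp) rfl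
      simp [e2, e1]
    · refine hE.eventually_of_coherent (hE.pr c (hE.pr b c)) _
        {(b, fun _ => True), (c, fun _ => True), (hE.pr b c, fun _ => True)}
        (Set.toFinite _).countable (by simp) ?_
      intro τ hτ _
      simp only [Set.image_insert_eq, Set.image_singleton] at hτ
      have e1 := (hτ b.1 (by simp) c.1 (by simp)).2 (hE.pr b c).1 (by simp) rfl
      have e2 := (hτ c.1 (by simp) (hE.pr b c).1 (by simp)).2 (hE.pr c (hE.pr b c)).1 (by simp) rfl
      simp [e2, e1]

/-- A coherent selection for all links of a descending chain would produce a descending `∈`-sequence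
of sets. -/
theorem wellFounded : WellFounded hE.system.r := by
  rw [wellFounded_iff_isEmpty_descending_chain]
  refine ⟨fun ⟨w, hw⟩ => ?_⟩
  choose a ha using fun n => Quotient.exists_rep (w n)
  have hw : ∀ n, hE.Holds (· ∈ ·) (a (n + 1)) (a n) := fun n => by
    have := hw n
    rw [← ha, ← ha] at this
    exact this
  obtain ⟨τ, hτ, hτP⟩ := hE.exists_coherent
    (Set.range (fun n => ((a n).1, fun _ => True)) ∪ Set.range (fun n =>
      (hE.pr (a (n + 1)).1 (a n).1, fun t => (a (n + 1)).2 (fst t) ∈ (a n).2 (snd t))))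
    ((Set.countable_range _).union (Set.countable_range _)) (by
      rintro _ (⟨n, rfl⟩ | ⟨n, rfl⟩)
      exacts [Filter.Eventually.of_forall fun _ => trivial, hw n])
  have hdesc : ∀ n, (a (n + 1)).2 (τ (a (n + 1)).1.1) ∈ (a n).2 (τ (a n).1.1) := by
    intro n
    have h1 := hτP _ (Or.inr ⟨n, rfl⟩)
    have e1 := (hτ (a (n + 1)).1.1 ⟨_, Or.inl ⟨n + 1, rfl⟩, rfl⟩ (a n).1.1
      ⟨_, Or.inl ⟨n, rfl⟩, rfl⟩).2 (hE.pr (a (n + 1)).1 (a n).1).1 ⟨_, Or.inr ⟨n, rfl⟩, rfl⟩ rfl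
    simpa [e1] using h1
  exact (wellFounded_iff_isEmpty_descending_chain.1 ZFSet.mem_wf).false
    ⟨fun n => (a n).2 (τ (a n).1.1), hdesc⟩

theorem exists_isCollapse : ∃ π, hE.system.IsCollapse π := by
  have : Small.{u} {b // b ∈ B} := inferInstanceAs (Small.{u} B)
  refine hE.system.exists_collapse hE.wellFounded (hE.system.small_mem fun b => ⟨T, ?_⟩)
  refine (hE.eventually_iff b _).2 ?_
  have : ZFSet.sep (· ∈ T) T = T := by ext; simp
  rw [this]
  exact hE.univ_mem b.1 b.2

theorem eventually_pair (b c : {b // b ∈ B}) :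
    ∀ᶠ t in hE.ultrafilter (hE.pr b c), ∃ x y, t = ZFSet.pair x y := by
  refine hE.eventually_of_coherent _ _ {(b, fun _ => True), (c, fun _ => True)}
    (Set.toFinite _).countable (by simp) ?_
  intro τ hτ _
  simp only [Set.image_insert_eq, Set.image_singleton] at hτ
  exact ⟨_, _, (hτ b.1 (by simp) c.1 (by simp)).2 (hE.pr b c).1 (by simp) rfl⟩

/-- The indices are represented by the identity. -/
theorem collapse_rep_id (hT : T.IsTransitive) (hB : B.IsTransitive)
    {π : Quotient hE.setoid → ZFSet.{u}} (hπ : hE.system.IsCollapse π) (b : ZFSet.{u})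
    (hb : b ∈ B) : π (hE.system.rep ⟨b, hb⟩ id) = b := by
  induction b using ZFSet.inductionOn with
  | h b ih =>
    ext z
    constructor
    · intro hz
      obtain ⟨w, rfl⟩ := hπ.transitive _ ⟨_, rfl⟩ z hz
      obtain ⟨⟨⟨c, hc⟩, G⟩, rfl⟩ := Quotient.exists_rep w
      have hz : hE.Holds (· ∈ ·) (⟨c, hc⟩, G) (⟨b, hb⟩, id) := (hπ.mem_iff _ _).1 hz
      -- `h` codes the graph of `G` inside `T`. As `G(x) ∈ y` for almost all pairs `(x, y)`,
      -- normality makes the class of `G` that of the identity at some `b' ∈ b`.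
      let h : ZFSet.{u} := ZFSet.sep (fun t => G (fst t) = id (snd t)) T
      have h1 : ∀ᶠ t in hE.ultrafilter (hE.pr ⟨c, hc⟩ ⟨b, hb⟩), t ∈ regressive T h := by
        have hTev : ∀ᶠ t in hE.ultrafilter (hE.pr ⟨c, hc⟩ ⟨b, hb⟩), t ∈ T := by
          refine (hE.eventually_iff _ _).2 ?_
          have : ZFSet.sep (· ∈ T) T = T := by ext; simp
          rw [this]
          exact hE.univ_mem _ (hE.pr _ _).2
        filter_upwards [hTev, hE.eventually_pair ⟨c, hc⟩ ⟨b, hb⟩, hz] with t ht hp hz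
        obtain ⟨x, y, rfl⟩ := hp
        simp only [fst_pair, snd_pair, id] at hz
        have hxy : ({x, y} : ZFSet.{u}) ∈ T := hT.mem_trans (by simp [ZFSet.pair]) ht
        have hx : x ∈ T := hT.mem_trans (by simp) hxy
        have hy : y ∈ T := hT.mem_trans (by simp) hxy
        refine ZFSet.mem_sep.2 ⟨ht, x, hx, y, hy, rfl, G x, hz, ZFSet.mem_sep.2
          ⟨hE.pair_left _ hx _ (hT.mem_trans hz hy), by simp⟩⟩
      rw [hE.eventually_iff] at h1
      have h2 : ZFSet.sep (· ∈ regressive T h) T = regressive T h := by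
        ext z
        simp only [ZFSet.mem_sep, and_iff_right_iff_imp]
        exact fun hz => ZFSet.sep_subset hz
      rw [h2] at h1
      obtain ⟨b', hb', h3⟩ := hE.normal h trivial ZFSet.sep_subset c hc b hb h1
      have hb'B := hB.mem_trans hb' hb
      have h4 : hE.system.rep ⟨c, hc⟩ G = hE.system.rep ⟨b', hb'B⟩ id := Quotient.sound h3
      change π (hE.system.rep ⟨c, hc⟩ G) ∈ b
      rw [h4, ih b' hb' hb'B]
      exact hb'
    · intro hz
      have hzB := hB.mem_trans hz hb
      rw [← ih z hz hzB]
      refine (hπ.mem_iff _ _).2 ?_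
      refine hE.eventually_of_coherent (hE.pr ⟨z, hzB⟩ ⟨b, hb⟩) _
        {(⟨z, hzB⟩, fun _ => True), (⟨b, hb⟩, fun _ => True)}
        (Set.toFinite _).countable (by simp) ?_
      intro τ hτ _
      simp only [Set.image_insert_eq, Set.image_singleton] at hτ
      have e1 := hτ z (by simp) b (by simp)
      have e2 := e1.2 (hE.pr ⟨z, hzB⟩ ⟨b, hb⟩).1 (by simp) rfl
      simpa [e2] using e1.1 hz

/-- The ultrapower of the universe by a strong system witnesses strongness. -/
theorem isStrong {ξ : Ordinal.{u}} {ν : Cardinal.{u}}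
    (hE : StrongSystem Set.univ T B E X ξ.toZFSet) (hT : T.IsTransitive) (hB : B.IsTransitive)
    (hξT : ξ.toZFSet ⊆ T) (hξ : ξ.toZFSet ∈ B) (hH : H ν ⊆ (B : Set ZFSet.{u})) :
    IsStrong ξ ν X := by
  obtain ⟨π, hπ⟩ := hE.exists_isCollapse
  have hid := hE.collapse_rep_id hT hB hπ
  have hconst : ∀ b c Y, π (hE.system.rep b fun _ => Y) = π (hE.system.rep c fun _ => Y) :=
    fun b c Y => congrArg π (hE.system.rep_const b c Y)
  -- Since the identity at index `b` represents `b`, the ultrafilter at `b` is the one generated by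
  -- `b` through the new embedding.
  have hmem : ∀ b (hb : b ∈ B) Y, b ∈ π (hE.system.rep ⟨ξ.toZFSet, hξ⟩ fun _ => Y) ↔
      ZFSet.pair (ZFSet.sep (· ∈ Y) T) b ∈ E := by
    intro b hb Y
    have h1 := hπ.mem_iff (hE.system.rep ⟨b, hb⟩ id) (hE.system.rep ⟨b, hb⟩ fun _ => Y)
    rw [hid b hb, hE.system.mem_iff] at h1
    rw [hconst _ ⟨b, hb⟩]
    exact h1.trans (hE.eventually_iff ⟨b, hb⟩ _)
  have hord : ∀ b ∈ B, b.IsOrdinal → b ∈ π (hE.system.rep ⟨ξ.toZFSet, hξ⟩ fun _ => ξ.toZFSet) := by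
    intro b hb hbo
    rw [hmem b hb]
    have : ZFSet.sep (· ∈ ξ.toZFSet) T = ξ.toZFSet := by
      ext z
      simp only [ZFSet.mem_sep, and_iff_right_iff_imp]
      exact fun hz => hξT hz
    rw [this]
    exact hE.ord_mem b hb hbo
  refine ⟨_, _, hπ.isElementary ⟨ξ.toZFSet, hξ⟩, ⟨?_, ?_⟩, ?_, ?_⟩
  · intro he
    have h1 := hord _ hξ (ZFSet.isOrdinal_toZFSet ξ)
    have he : π (hE.system.rep ⟨ξ.toZFSet, hξ⟩ fun _ => ξ.toZFSet) = ξ.toZFSet := he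
    rw [he] at h1
    exact ZFSet.mem_irrefl _ h1
  · intro β hβ
    have hβT : β.toZFSet ∈ T := hξT (Ordinal.toZFSet_mem_toZFSet_iff.2 hβ)
    refine (hconst _ ⟨β.toZFSet, hE.subset hβT⟩ _).trans ?_
    conv_rhs => rw [← hid _ (hE.subset hβT)]
    refine congrArg π ((hE.system.eq_iff _ _ _).2 ?_)
    refine (hE.eventually_iff _ _).2 ?_
    -- The ultrafilter at an element of `T` is principal, so the constant function and the identity
    -- have the same class.
    have : ZFSet.sep (fun t => β.toZFSet = id t) T = {β.toZFSet} := by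
      ext z
      simp only [ZFSet.mem_sep, ZFSet.mem_singleton, id]
      exact ⟨fun h => h.2.symm, fun h => ⟨h ▸ hβT, h.symm⟩⟩
    rw [this]
    exact hE.fixed _ hβT
  · intro x hx
    obtain ⟨ζ, hζ, rfl⟩ := Ordinal.mem_toZFSet_iff.1 hx
    exact hord _ (hH (toZFSet_mem_H hζ)) (ZFSet.isOrdinal_toZFSet ζ)
  · ext b
    simp only [Set.mem_inter_iff, SetLike.mem_coe, and_congr_left_iff]
    intro hb
    rw [hmem b (hH hb), ← hE.agree b (hH hb)]
    have : ZFSet.sep (· ∈ X) T = X ∩ T := by ext; simp; tauto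
    rw [this]

end StrongSystem

end ultrapower

/-! ### The strong system of an embedding, and the proof of (2) → (1). -/

variable {M : Set ZFSet.{u}} {j : ZFSet.{u} → ZFSet.{u}} {α γ : Ordinal.{u}}

/-- The ultrafilters on `V_α` that the elements of `V_γ` generate. -/
noncomputable def pointSystem (j : ZFSet.{u} → ZFSet.{u}) (α γ : Ordinal.{u}) : ZFSet.{u} :=
  ZFSet.sep (fun z => ∃ y b, z = ZFSet.pair y b ∧ y ⊆ ZFSet.vonNeumann α ∧ b ∈ j y)
    (ZFSet.vonNeumann γ)

theorem pair_mem_pointSystem (hγ : ∀ ζ < γ, ζ + 1 < γ) (hαγ : α < γ) {y b : ZFSet.{u}} :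
    ZFSet.pair y b ∈ pointSystem j α γ ↔
      y ⊆ ZFSet.vonNeumann α ∧ b ∈ ZFSet.vonNeumann γ ∧ b ∈ j y := by
  rw [pointSystem, ZFSet.mem_sep, pair_mem_vonNeumann hγ]
  constructor
  · rintro ⟨⟨-, hb⟩, y', b', he, hy, hb'⟩
    obtain ⟨rfl, rfl⟩ := ZFSet.pair_injective he
    exact ⟨hy, hb, hb'⟩
  · rintro ⟨hy, hb, hb'⟩
    refine ⟨⟨?_, hb⟩, y, b, rfl, hy, hb'⟩
    exact ZFSet.mem_vonNeumann.2 ((ZFSet.subset_vonNeumann.1 hy).trans_lt hαγ)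

/-- The relations among the terms of `s` are coded by sets of tuples of natural numbers, on which
`j` is the identity. In `M` the sequence `s` witnesses that some sequence realizes this pattern in
the sets `j(y(n))`, so `V` has one in the sets `y(n)`. -/
theorem IsElementary.exists_coherent_sequence (hj : IsElementary M j) {s y : ZFSet.{u}}
    (hs : s ∈ M) (h : ∀ n ∈ Ordinal.omega0.{u}.toZFSet, app s n ∈ j (app y n)) :
    ∃ t, (∀ n ∈ Ordinal.omega0.{u}.toZFSet, app t n ∈ app y n) ∧ PreservesRelations s t := by
  let ω := Ordinal.omega0.{u}.toZFSet
  let y' := graphOn (app y) ω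
  let ρ₁ := ZFSet.sep (fun z => ∃ m n, z = ZFSet.pair m n ∧ app s m = app s n) (ω.prod ω)
  let ρ₂ := ZFSet.sep (fun z => ∃ m n, z = ZFSet.pair m n ∧ app s m ∈ app s n) (ω.prod ω)
  let ρ₃ := ZFSet.sep (fun z => ∃ k m n, z = ZFSet.pair k (ZFSet.pair m n) ∧
    app s k = ZFSet.pair (app s m) (app s n)) (ω.prod (ω.prod ω))
  have hnat : ∀ n ∈ ω, j n = n := by
    intro n hn
    obtain ⟨n, rfl⟩ := toZFSet_omega_mem_iff.1 hn
    exact hj.map_nat n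
  have h₁ : ∀ m ∈ ω, ∀ n ∈ ω, (ZFSet.pair m n ∈ ρ₁ ↔ app s m = app s n) := by
    intro m hm n hn
    simp only [ρ₁, ZFSet.mem_sep, ZFSet.pair_mem_prod, hm, hn, true_and, ZFSet.pair_inj]
    exact ⟨fun ⟨_, _, ⟨rfl, rfl⟩, h⟩ => h, fun h => ⟨_, _, ⟨rfl, rfl⟩, h⟩⟩
  have h₂ : ∀ m ∈ ω, ∀ n ∈ ω, (ZFSet.pair m n ∈ ρ₂ ↔ app s m ∈ app s n) := by
    intro m hm n hn
    simp only [ρ₂, ZFSet.mem_sep, ZFSet.pair_mem_prod, hm, hn, true_and, ZFSet.pair_inj]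
    exact ⟨fun ⟨_, _, ⟨rfl, rfl⟩, h⟩ => h, fun h => ⟨_, _, ⟨rfl, rfl⟩, h⟩⟩
  have h₃ : ∀ k ∈ ω, ∀ m ∈ ω, ∀ n ∈ ω, (ZFSet.pair k (ZFSet.pair m n) ∈ ρ₃ ↔
      app s k = ZFSet.pair (app s m) (app s n)) := by
    intro k hk m hm n hn
    simp only [ρ₃, ZFSet.mem_sep, ZFSet.pair_mem_prod, hk, hm, hn, true_and, ZFSet.pair_inj]
    exact ⟨fun ⟨_, _, _, ⟨rfl, rfl, rfl⟩, h⟩ => h, fun h => ⟨_, _, _, ⟨rfl, rfl, rfl⟩, h⟩⟩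
  obtain ⟨t, -, ht, hrel⟩ := (hj.transfer (fun M v => ∃ t ∈ M,
    (∀ n ∈ Ordinal.omega0.{u}.toZFSet, app t n ∈ app (v 0) n) ∧
    ∀ m ∈ Ordinal.omega0.{u}.toZFSet, ∀ n ∈ Ordinal.omega0.{u}.toZFSet,
      (ZFSet.pair m n ∈ v 1 → app t m = app t n) ∧
      (ZFSet.pair m n ∈ v 2 → app t m ∈ app t n) ∧
      ∀ k ∈ Ordinal.omega0.{u}.toZFSet, ZFSet.pair k (ZFSet.pair m n) ∈ v 3 →
        app t k = ZFSet.pair (app t m) (app t n)) (y' ::ₛ ρ₁ ::ₛ ρ₂ ::ₛ fun _ => ρ₃)).2 (by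
    refine ⟨s, hs, fun n hn => ?_, fun m hm n hn => ⟨fun hr => ?_, fun hr => ?_,
      fun k hk hr => ?_⟩⟩
    · change app s n ∈ app (j y') n
      have := h n hn
      rw [← app_graphOn (F := app y) hn, hj.map_app, hnat n hn] at this
      exact this
    · change ZFSet.pair m n ∈ j ρ₁ at hr
      rw [← hnat m hm, ← hnat n hn, ← hj.map_pair, hj.mem_iff] at hr
      exact (h₁ m hm n hn).1 hr
    · change ZFSet.pair m n ∈ j ρ₂ at hr
      rw [← hnat m hm, ← hnat n hn, ← hj.map_pair, hj.mem_iff] at hr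
      exact (h₂ m hm n hn).1 hr
    · change ZFSet.pair k (ZFSet.pair m n) ∈ j ρ₃ at hr
      rw [← hnat m hm, ← hnat n hn, ← hnat k hk, ← hj.map_pair, ← hj.map_pair, hj.mem_iff] at hr
      exact (h₃ k hk m hm n hn).1 hr)
  refine ⟨t, fun n hn => ?_, fun m hm n hn => ⟨fun hr => ?_, fun hr => ?_, fun k hk hr => ?_⟩⟩
  · have := ht n hn
    change app t n ∈ app y' n at this
    rwa [app_graphOn hn] at this
  · exact (hrel m hm n hn).1 ((h₁ m hm n hn).2 hr)
  · exact (hrel m hm n hn).2.1 ((h₂ m hm n hn).2 hr)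
  · exact (hrel m hm n hn).2.2 k hk ((h₃ k hk m hm n hn).2 hr)

/-- As `V_γ ⊆ j(V_α)`, each `b ∈ V_γ` is a generating point and the conditions become statements
about `b ∈ j(y)`. For instance, normality holds because the element of `b` witnessing regressiveness
is itself the required index. -/
theorem IsElementary.strongSystem (hj : IsElementary M j) (hc : IsCrit j α)
    (hγ : ∀ ζ < γ, ζ + 1 < γ) (hαγ : α < γ) (hγj : γ < (j α.toZFSet).rank)
    (hM : (ZFSet.vonNeumann γ : Set ZFSet.{u}) ⊆ M) (X : ZFSet.{u}) :
    StrongSystem M (ZFSet.vonNeumann α) (ZFSet.vonNeumann γ) (pointSystem j α γ) (j X)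
      α.toZFSet := by
  have hα : ∀ ζ < α, ζ + 1 < α := fun ζ hζ => hj.succ_lt_crit hc hζ
  have hE : ∀ {y b}, ZFSet.pair y b ∈ pointSystem j α γ ↔
    y ⊆ ZFSet.vonNeumann α ∧ b ∈ ZFSet.vonNeumann γ ∧ b ∈ j y := pair_mem_pointSystem hγ hαγ
  have hsub : ZFSet.vonNeumann α ⊆ ZFSet.vonNeumann γ := ZFSet.vonNeumann_subset_of_le hαγ.le
  have hpt : ∀ b ∈ ZFSet.vonNeumann γ, b ∈ j (ZFSet.vonNeumann α) := fun b hb =>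
    hj.mem_map_vonNeumann.2 ⟨hM hb, (ZFSet.mem_vonNeumann.1 hb).trans hγj⟩
  constructor
  case pair_left => exact fun x hx y hy => (pair_mem_vonNeumann hα).2 ⟨hx, hy⟩
  case pair_right => exact fun x hx y hy => (pair_mem_vonNeumann hγ).2 ⟨hx, hy⟩
  case subset => exact hsub
  case univ_mem => exact fun b hb => hE.2 ⟨fun z hz => hz, hb, hpt b hb⟩
  case inter_mem =>
    intro b hb y _ z _ hy hz
    rw [hE] at *
    refine ⟨fun w hw => hy.1 (ZFSet.mem_inter.1 hw).1, hb, ?_⟩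
    rw [hj.map_inter]
    exact ZFSet.mem_inter.2 ⟨hy.2.2, hz.2.2⟩
  case mono =>
    intro b hb y _ z _ hz hyz hy
    rw [hE] at *
    exact ⟨hz, hb, hj.subset_iff.2 hyz hy.2.2⟩
  case compl =>
    intro b hb y _ hy
    have h' : j (ZFSet.vonNeumann α \ y) = j (ZFSet.vonNeumann α) \ j y :=
      hj.map_absFun (fun v => v 0 \ v 1) (ZFSet.vonNeumann α ::ₛ fun _ => y)
    rw [hE, hE, h', ZFSet.mem_sdiff]
    have h1 : ZFSet.vonNeumann α \ y ⊆ ZFSet.vonNeumann α := fun z hz => (ZFSet.mem_sdiff.1 hz).1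
    have h2 := hpt b hb
    tauto
  case coherent =>
    intro s hs y _ h
    obtain ⟨t, ht, hrel⟩ := hj.exists_coherent_sequence hs fun n hn => (hE.1 (h n hn).2).2.2
    -- `t` itself need not be in `M`; its restriction to `ω` is a subset of `V_α`, so it is in `V_γ
    -- ⊆ M`.
    refine ⟨graphOn (app t) Ordinal.omega0.toZFSet, hM ?_, fun n hn => ?_, fun m hm n hn => ?_⟩
    · refine ZFSet.mem_vonNeumann.2 (lt_of_le_of_lt (ZFSet.subset_vonNeumann.1 ?_) hαγ)
      intro z hz
      obtain ⟨n, hn, rfl⟩ := mem_graphOn.1 hz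
      refine (pair_mem_vonNeumann hα).2 ⟨?_, (hE.1 (h n hn).2).1 (ht n hn)⟩
      exact ZFSet.vonNeumann_subset_of_le (hj.omega_lt_crit hc).le
        (Ordinal.omega0.toZFSet_subset_vonNeumann hn)
    · rw [app_graphOn hn]
      exact ht n hn
    · obtain ⟨h1, h2, h3⟩ := hrel m hm n hn
      rw [app_graphOn hm, app_graphOn hn]
      refine ⟨h1, h2, fun k hk => ?_⟩
      rw [app_graphOn hk]
      exact h3 k hk
  case normal =>
    intro h _ hh c hc' b hb hreg
    have h' : j (regressive (ZFSet.vonNeumann α) h) = regressive (j (ZFSet.vonNeumann α)) (j h) :=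
      hj.map_absFun (fun v => regressive (v 0) (v 1)) (ZFSet.vonNeumann α ::ₛ fun _ => h)
    rw [hE, h'] at hreg
    obtain ⟨-, s, -, x, -, he, w, hw, hsw⟩ := ZFSet.mem_sep.1 hreg.2.2
    obtain ⟨rfl, rfl⟩ := ZFSet.pair_injective he
    exact ⟨w, hw, hE.2 ⟨hh, (pair_mem_vonNeumann hγ).2
      ⟨hc', (ZFSet.isTransitive_vonNeumann γ).mem_trans hw hb⟩, hsw⟩⟩
  case fixed =>
    intro x hx
    have h1 : j {x} = {j x} := hj.map_absFun (fun v => {v 0}) (fun _ => x)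
    refine hE.2 ⟨fun z hz => ?_, hsub hx, ?_⟩
    · rwa [ZFSet.mem_singleton.1 hz]
    · rw [h1, hj.map_eq_of_rank_lt hc x (ZFSet.mem_vonNeumann.1 hx)]
      exact ZFSet.mem_singleton.2 rfl
  case agree =>
    intro b hb
    have h1 : j X ∩ ZFSet.vonNeumann α = X ∩ ZFSet.vonNeumann α := by
      ext x
      simp only [ZFSet.mem_inter, and_congr_left_iff]
      intro hx
      conv_lhs => rw [← hj.map_eq_of_rank_lt hc x (ZFSet.mem_vonNeumann.1 hx)]
      exact hj.mem_iff
    rw [h1, hE, hj.map_inter, ZFSet.mem_inter]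
    exact ⟨fun h => h.2.2.1, fun h => ⟨fun z hz => (ZFSet.mem_inter.1 hz).2, hb, h, hpt b hb⟩⟩
  case ord_mem =>
    intro b hb hbo
    refine hE.2 ⟨α.toZFSet_subset_vonNeumann, hb, ?_⟩
    rw [hj.map_ord, ← hbo.toZFSet_rank_eq, Ordinal.toZFSet_mem_toZFSet_iff]
    exact (ZFSet.mem_vonNeumann.1 hb).trans hγj

theorem eq_vonNeumann_of_mem_iff {T : ZFSet.{u}} (h : ∀ y, y ∈ T ↔ rk y ∈ α.toZFSet) :
    T = ZFSet.vonNeumann α := by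
  ext y
  rw [h, ZFSet.mem_vonNeumann, rk, Ordinal.toZFSet_mem_toZFSet_iff]

theorem HasEmbeddingPoints.isWoodin {κ : Cardinal.{u}} (h : HasEmbeddingPoints κ) :
    IsWoodin κ := by
  have hin := h.isInaccessible
  refine ⟨hin, fun X _ => ?_⟩
  by_contra! hcon
  -- An ordinal that is not a cardinal is no critical point, so degree `0` already fails for it.
  have hN : ∀ ξ : Ordinal.{u}, ∃ ν : Cardinal.{u}, ξ < κ.ord → ν < κ ∧ ¬ IsStrong ξ ν X := by
    intro ξ
    by_cases hξ : ξ.card.ord = ξ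
    · by_cases hlt : ξ < κ.ord
      · obtain ⟨ν, hν, hs⟩ := hcon ξ.card (lt_ord.1 hlt)
        rw [hξ] at hs
        exact ⟨ν, fun _ => ⟨hν, hs⟩⟩
      · exact ⟨0, fun h => (hlt h).elim⟩
    · exact ⟨0, fun _ => ⟨hin.pos, fun hs => hξ hs.isCritical.ord_card⟩⟩
  choose N hN using hN
  -- The successor cardinal is regular and above both the failing degree and `ξ`. Regularity gives
  -- `H_ν ⊆ V_{G ξ}` for the failing degree `ν`.
  let c : Ordinal.{u} → Cardinal.{u} := fun ξ => Order.succ (max (max (N ξ) ℵ₀) ξ.card)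
  let G : Ordinal.{u} → Ordinal.{u} := fun ξ => (c ξ).ord
  have hcκ : ∀ ξ < κ.ord, c ξ < κ := fun ξ hξ => hin.isSuccLimit.succ_lt
    (max_lt (max_lt (hN ξ hξ).1 hin.aleph0_lt) (lt_ord.1 hξ))
  have hGκ : ∀ ξ < κ.ord, G ξ < κ.ord := fun ξ hξ => ord_lt_ord.2 (hcκ ξ hξ)
  have hcω : ∀ ξ, ℵ₀ ≤ max (max (N ξ) ℵ₀) ξ.card := fun ξ =>
    (le_max_right _ _).trans (le_max_left _ _)
  have hcreg : ∀ ξ, (c ξ).IsRegular := fun ξ => isRegular_succ (hcω ξ)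
  have hGlim : ∀ ξ, ∀ ζ < G ξ, ζ + 1 < G ξ := fun ξ ζ hζ =>
    (isSuccLimit_ord (hcreg ξ).aleph0_le).add_one_lt hζ
  have hξG : ∀ ξ, ξ < G ξ := fun ξ => lt_ord.2 ((le_max_right _ _).trans_lt (Order.lt_succ _))
  have hκlim : ∀ ζ < κ.ord, ζ + 1 < κ.ord := fun ζ hζ =>
    (isSuccLimit_ord hin.aleph0_lt.le).add_one_lt hζ
  -- The extra `1` gives `V_{γ+1} ⊆ M`, so that `M` contains every subset of `V_γ`, the system
  -- included.
  let f := ordGraph κ fun ξ => G ξ + 1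
  let g := ordGraph κ G
  have hf : ZFSet.IsFunc κ.ord.toZFSet κ.ord.toZFSet f :=
    isFunc_ordGraph fun ξ hξ => hκlim _ (hGκ ξ hξ)
  have hg : ZFSet.IsFunc κ.ord.toZFSet κ.ord.toZFSet g := isFunc_ordGraph hGκ
  have happ : ∀ ξ < κ.ord, app g ξ.toZFSet = (G ξ).toZFSet := fun ξ hξ =>
    (isFunctional_of_isFunc hg).app_eq (pair_mem_ordGraph.2 ⟨hξ, rfl⟩)
  obtain ⟨α, hα, hcl, M, j, hj, hc, η, hη, hV⟩ := h f hf
  rw [isClosurePoint_ordGraph hα] at hcl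
  have hακ : α.toZFSet ∈ j κ.ord.toZFSet := by
    rw [hj.map_ord, Ordinal.toZFSet_mem_toZFSet_iff]
    exact hα.trans_le (hj.le_ord _)
  have hval := (hj.transfer (fun _ v => ∀ ξ ∈ v 0, (∀ x ∈ app (v 1) ξ, insert x x ∈ app (v 1) ξ) ∧
      ξ ∈ app (v 1) ξ ∧ (app (v 1) ξ).IsOrdinal ∧
      ZFSet.pair ξ (insert (app (v 1) ξ) (app (v 1) ξ)) ∈ v 2)
    (κ.ord.toZFSet ::ₛ g ::ₛ fun _ => f)).1 (by
      intro x hx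
      obtain ⟨ξ, hξ, rfl⟩ := Ordinal.mem_toZFSet_iff.1 hx
      change (∀ x ∈ app g ξ.toZFSet, insert x x ∈ app g ξ.toZFSet) ∧ ξ.toZFSet ∈ app g ξ.toZFSet ∧
        (app g ξ.toZFSet).IsOrdinal ∧
        ZFSet.pair ξ.toZFSet (insert (app g ξ.toZFSet) (app g ξ.toZFSet)) ∈ f
      rw [happ ξ hξ]
      refine ⟨fun z hz => ?_, Ordinal.toZFSet_mem_toZFSet_iff.2 (hξG ξ), ZFSet.isOrdinal_toZFSet _,
        ?_⟩
      · obtain ⟨ζ, hζ, rfl⟩ := Ordinal.mem_toZFSet_iff.1 hz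
        rw [← Ordinal.toZFSet_add_one, Ordinal.toZFSet_mem_toZFSet_iff]
        exact hGlim ξ ζ hζ
      · rw [← Ordinal.toZFSet_add_one]
        exact pair_mem_ordGraph.2 ⟨hξ, rfl⟩)
  obtain ⟨hlim, hmem, hord, hpair⟩ := hval _ hακ
  -- Closure of `α` under `G`, applied at `α ∈ j(α)`, yields `j(G)(α) < j(α)`.
  have hclosed := (hj.transfer (fun _ v => ∀ ξ ∈ v 0, app (v 1) ξ ∈ v 0)
    (α.toZFSet ::ₛ fun _ => g)).1 (by
      intro x hx
      obtain ⟨ξ, hξ, rfl⟩ := Ordinal.mem_toZFSet_iff.1 hx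
      change app g ξ.toZFSet ∈ α.toZFSet
      rw [happ ξ (hξ.trans hα), Ordinal.toZFSet_mem_toZFSet_iff]
      exact (lt_add_one _).trans (hcl ξ hξ)) _ (hj.crit_mem hc)
  change ∀ x ∈ app (j g) α.toZFSet, insert x x ∈ app (j g) α.toZFSet at hlim
  change α.toZFSet ∈ app (j g) α.toZFSet at hmem
  change (app (j g) α.toZFSet).IsOrdinal at hord
  change ZFSet.pair α.toZFSet (insert (app (j g) α.toZFSet) (app (j g) α.toZFSet)) ∈ j f at hpair
  change app (j g) α.toZFSet ∈ j α.toZFSet at hclosed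
  obtain ⟨γ, hγ⟩ : ∃ γ : Ordinal.{u}, app (j g) α.toZFSet = γ.toZFSet :=
    ⟨_, hord.toZFSet_rank_eq.symm⟩
  rw [hγ] at hlim hmem hpair hclosed
  rw [← Ordinal.toZFSet_add_one] at hpair
  obtain rfl : η = γ + 1 := Ordinal.toZFSet_injective
    (hj.map_functional (isFunctional_of_isFunc hf) _ _ _ hη hpair)
  have hγlim : ∀ ζ < γ, ζ + 1 < γ := fun ζ hζ => by
    have := hlim _ (Ordinal.toZFSet_mem_toZFSet_iff.2 hζ)
    rwa [← Ordinal.toZFSet_add_one, Ordinal.toZFSet_mem_toZFSet_iff] at this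
  rw [Ordinal.toZFSet_mem_toZFSet_iff] at hmem
  rw [hj.map_ord, Ordinal.toZFSet_mem_toZFSet_iff] at hclosed
  have hVM : ∀ x ⊆ ZFSet.vonNeumann γ, x ∈ M := fun x hx => hV
    (ZFSet.mem_vonNeumann.2 (Order.lt_add_one_iff.2 (ZFSet.subset_vonNeumann.1 hx)))
  have hsys := hj.strongSystem hc hγlim hmem hclosed
    (fun x hx => hVM x (ZFSet.isTransitive_vonNeumann γ x hx)) X
  -- `V` has no strong system for any `ξ < κ` at level `G ξ`, since it would make `ξ` strong to the
  -- failing degree. The levels of the hierarchy are described by rank, so that the statement is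
  -- first-order.
  have hneg := (hj.transfer (fun M v => ∀ ξ ∈ v 0, ∀ T ∈ M, ∀ B ∈ M, ∀ E ∈ M,
      (∀ y ∈ M, (y ∈ T ↔ rk y ∈ ξ)) → (∀ y ∈ M, (y ∈ B ↔ rk y ∈ app (v 1) ξ)) →
        ¬ StrongSystem M T B E (v 2) ξ) (κ.ord.toZFSet ::ₛ g ::ₛ fun _ => X)).1 (by
    intro x hx T _ B _ E _ hT hB hE
    obtain ⟨ξ, hξ, rfl⟩ := Ordinal.mem_toZFSet_iff.1 hx
    change StrongSystem Set.univ T B E X ξ.toZFSet at hE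
    change ∀ y ∈ Set.univ, (y ∈ B ↔ rk y ∈ app g ξ.toZFSet) at hB
    rw [happ ξ hξ] at hB
    obtain rfl := eq_vonNeumann_of_mem_iff fun y => hT y trivial
    obtain rfl := eq_vonNeumann_of_mem_iff fun y => hB y trivial
    refine (hN ξ hξ).2 (hE.isStrong (ZFSet.isTransitive_vonNeumann _)
      (ZFSet.isTransitive_vonNeumann _) ξ.toZFSet_subset_vonNeumann ?_ fun y hy => ?_)
    · exact (G ξ).toZFSet_subset_vonNeumann (Ordinal.toZFSet_mem_toZFSet_iff.2 (hξG ξ))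
    · refine ZFSet.mem_vonNeumann.2 (rank_lt_of_mem_H (hcreg ξ) (H_mono ?_ hy))
      exact ((le_max_left _ _).trans (le_max_left _ _)).trans (Order.le_succ _))
  refine hneg _ hακ _ (hVM _ (ZFSet.vonNeumann_subset_of_le hmem.le)) _ (hVM _ fun z hz => hz)
    (pointSystem j α γ) (hVM _ ZFSet.sep_subset) (fun y _ => ?_) (fun y _ => ?_) hsys
  · rw [ZFSet.mem_vonNeumann, rk, Ordinal.toZFSet_mem_toZFSet_iff]
  · change y ∈ _ ↔ rk y ∈ app (j g) α.toZFSet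
    rw [hγ, ZFSet.mem_vonNeumann, rk, Ordinal.toZFSet_mem_toZFSet_iff]

end WoodinCard

/-! ### The equivalence. -/

theorem theorem1p1 (κ : Cardinal.{u}) :
    List.TFAE [
      -- (1)
      WoodinCard.IsWoodin κ,
      -- (2)
      ∀ f : ZFSet.{u}, ZFSet.IsFunc κ.ord.toZFSet κ.ord.toZFSet f →
        ∃ α < κ.ord, WoodinCard.IsEmbeddingPoint f α,
      -- (3)
      ∀ A : ZFSet.{u}, A ⊆ ZFSet.vonNeumann κ.ord →
        IsStationary {α : Set.Iio κ.ord | ∀ γ : Cardinal.{u}, γ < κ → WoodinCard.IsStrong α γ A},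
      -- (4)
      ∃ F : Filter (Set.Iio κ.ord),
        F.sets = {X | ¬ WoodinCard.IsWoodinIn κ Xᶜ} ∧ F.NeBot,
      -- (5)
      ∀ f : ZFSet.{u}, ZFSet.IsFunc κ.ord.toZFSet κ.ord.toZFSet f →
        ∃ α < κ.ord, WoodinCard.IsExtenderPoint κ f α] := by
  tfae_have 1 → 3 := WoodinCard.IsWoodin.hasStationaryStrong
  tfae_have 3 → 1 := WoodinCard.HasStationaryStrong.isWoodin
  tfae_have 2 ↔ 4 := WoodinCard.hasEmbeddingPoints_iff_filter
  tfae_have 1 → 5 := WoodinCard.IsWoodin.hasExtenderPoints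
  tfae_have 5 → 2 := fun h f hf =>
    let ⟨α, hα, hp⟩ := h f hf
    ⟨α, hα, hp.isEmbeddingPoint⟩
  tfae_have 2 → 1 := WoodinCard.HasEmbeddingPoints.isWoodin
  tfae_finish
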